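/- Work with parametrized rational tropical curves $h:\Gamma\to\mathbb{R}^2$ of degree $d$: $\Gamma$ is a metric tree all of whose vertices have valency at least $3$, $h$ is affine with integer slope on each edge and balanced at each vertex, and the non-contracted ends have the slopes $(0,-1)^d,(-1,0)^d,(1,1)^d$; the marked points are labelled contracted ends. Let $\psi_1^{k_1}\cdots\psi_N^{k_N}$ denote the weighted subfan of the moduli space $\mathcal{M}_{0,N}(\mathbb{R}^2,d)$ of such curves with $N$ marked points whose top-dimensional cones consist of the curves with $\mathrm{val}(V)=3+\sum_{i\in I_V}k_i$ at each vertex $V$, where $I_V$ is the set of marked points adjacent to $V$; the weight of the cone is $\prod_V\big(\sum_{i\in I_V}k_i\big)!\,/\prod_i k_i!$. For constraints $\Xi_i$, each a point ($P$) or a standard tropical line ($L$, with a vertex and rays in the directions $(0,-1)$, $(-1,0)$, $(1,1)$), the tropical descendant invariant $$\langle\psi^{k_1}\Xi_1,\dots,\psi^{k_N}\Xi_N\rangle_d$$ is the number of curves in this subfan whose $i$-th marked point is mapped into $\Xi_i$ for all $i$, for generic positions of the constraints. The curves, with labelled ends, are counted with the weight of their cone times the intersection index of the evaluation map $\mathrm{ev}:\psi_1^{k_1}\cdots\psi_N^{k_N}\to(\mathbb{R}^2)^N$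 with $\prod_i\Xi_i$, and the total is divided by the number $(d!)^3$ of labellings of the non-contracted ends. Simple point conditions $\psi^0P$ are dropped from the notation. **Divisor equation.** Let $d,k,n\ge 0$ be integers with $n+k=3d-1$. Then the three invariants below, each with $n$ further simple point conditions, are well defined (the count is the same for all generic constraints), and $$\langle L,\psi^kL\rangle_d=d\,\langle\psi^kL\rangle_d+\langle\psi^{k-1}P\rangle_d ,$$ where the last term is absent (read as $0$) when $k=0$. -/

import Mathlib

namespace TropDesc

/-- The inclusion `ℤ² ⊂ ℝ²`. -/
def toReal (v : ℤ × ℤ) : ℝ × ℝ := ((v.1 : ℝ), (v.2 : ℝ))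

/-- The three directions of the ends of the standard tropical line. -/
def dir : Fin 3 → ℤ × ℤ := ![(0, -1), (-1, 0), (1, 1)]

/-- The degree `Δ_d`, with labelled ends: `d` ends of slope `dir j` for each `j`. -/
def degreeEnds (d : ℕ) : Fin 3 × Fin d → ℤ × ℤ := fun e => dir e.1

open Classical in
/-- A parametrized rational tropical curve `h : Γ → ℝ²` of degree `Δ` (the slopes of the
non-contracted ends, which are labelled by `δ`), with contracted ends (marked points) labelled
by `ι`. The graph is the finite tree formed by the vertices and the bounded edges of `Γ`; the
ends are recorded by the vertex to which they are attached. -/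
structure Curve {δ : Type} [Fintype δ] (ι : Type) [Fintype ι] (Δ : δ → ℤ × ℤ) where
  /-- vertices of `Γ` -/
  V : Type
  [fintypeV : Fintype V]
  /-- bounded edges -/
  graph : SimpleGraph V
  /-- the vertex adjacent to an end -/
  att : δ ⊕ ι → V
  /-- lengths of the bounded edges (only the values on edges are relevant) -/
  length : Sym2 V → ℝ
  /-- the map `h` on the vertices -/
  pos : V → ℝ × ℝ
  /-- slope of `h` on the bounded edge from the first vertex to the second one, oriented that way
  (only the values on pairs of adjacent vertices are relevant) -/
  slope : V → V → ℤ × ℤ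
  isTree : graph.IsTree
  /-- no univalent and no bivalent vertices -/
  three_le : ∀ v, 3 ≤ (Finset.univ.filter fun w => graph.Adj v w).card +
    (Finset.univ.filter fun x => att x = v).card
  length_pos : ∀ u v, graph.Adj u v → 0 < length s(u, v)
  /-- `h` is affine with integer slope on each bounded edge -/
  affine : ∀ u v, graph.Adj u v → pos v - pos u = length s(u, v) • toReal (slope u v)
  /-- at each vertex the outgoing slopes sum up to zero (contracted ends have slope zero) -/
  balanced : ∀ v, ∑ w with graph.Adj v w, slope v w + ∑ x with att (Sum.inl x) = v, Δ x = 0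

attribute [instance] Curve.fintypeV

namespace Curve

variable {δ ι : Type} [Fintype δ] [Fintype ι] {Δ : δ → ℤ × ℤ}

open Classical in
/-- The valency of a vertex; bounded edges, ends and marked points all count. -/
noncomputable def valency (C : Curve ι Δ) (v : C.V) : ℕ :=
  (Finset.univ.filter fun w => C.graph.Adj v w).card +
    (Finset.univ.filter fun x => C.att x = v).card

/-- The evaluation map at the marked point `i`. -/
def ev (C : Curve ι Δ) (i : ι) : ℝ × ℝ := C.pos (C.att (Sum.inr i))

/-- Isomorphism of parametrized tropical curves with labelled ends: an isometry of the underlying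
graphs which respects the labels of the ends and commutes with the maps to `ℝ²`. -/
def Iso (C C' : Curve ι Δ) : Prop :=
  ∃ e : C.V ≃ C'.V,
    (∀ u v, C'.graph.Adj (e u) (e v) ↔ C.graph.Adj u v) ∧
    (∀ x, C'.att x = e (C.att x)) ∧
    (∀ u v, C.graph.Adj u v → C'.length s(e u, e v) = C.length s(u, v)) ∧
    (∀ v, C'.pos (e v) = C.pos v)

open Classical in
/-- The sum of the `k i` over the marked points `i` adjacent to `v`. -/
noncomputable def psiAt (C : Curve ι Δ) (k : ι → ℕ) (v : C.V) : ℕ :=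
  ∑ i with C.att (Sum.inr i) = v, k i

/-- `C` lies in (the interior of) a top-dimensional cone of the subfan `∏ ψ_i ^ k_i`. -/
def InPsi (C : Curve ι Δ) (k : ι → ℕ) : Prop :=
  ∀ v, C.valency v = 3 + C.psiAt k v

/-- The weight of the cone of `C` in the subfan `∏ ψ_i ^ k_i`. -/
noncomputable def psiWeight (C : Curve ι Δ) (k : ι → ℕ) : ℚ :=
  (∏ v, ((C.psiAt k v).factorial : ℚ)) / ∏ i, ((k i).factorial : ℚ)

/-- The lattice of the cone of the moduli space which contains `C`, through the position of the
vertices: the vertices have integral positions, and the edges have integral lengths. -/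
def coneLattice (C : Curve ι Δ) : AddSubgroup (C.V → ℤ × ℤ) where
  carrier := {h | ∀ u v, C.graph.Adj u v → h v - h u ∈ AddSubgroup.zmultiples (C.slope u v)}
  zero_mem' := fun u v _ => by simp
  add_mem' := fun {a b} ha hb u v huv => by
    have := add_mem (ha u v huv) (hb u v huv)
    simpa [add_sub_add_comm] using this
  neg_mem' := fun {a} ha u v huv => by
    have := neg_mem (ha u v huv)
    simp only [Pi.neg_apply]
    convert this using 1
    abel

/-- The image of the lattice of the cone of `C` under the (linear) evaluation map at all marked
points. -/
def evLattice (C : Curve ι Δ) : AddSubgroup (ι → ℤ × ℤ) :=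
  C.coneLattice.map
    (AddMonoidHom.pi fun i => Pi.evalAddMonoidHom (fun _ : C.V => ℤ × ℤ) (C.att (Sum.inr i)))

end Curve

/-- Points and lines: the possible constraints for the position of a marked point. -/
inductive Kind
  | point
  | line

/-- An insertion `ψ^k P` or `ψ^k L`. -/
structure Insertion where
  psi : ℕ
  kind : Kind

/-- `ψ^k P` -/
def psiP (k : ℕ) : Insertion := ⟨k, Kind.point⟩

/-- `ψ^k L` -/
def psiL (k : ℕ) : Insertion := ⟨k, Kind.line⟩

/-- The constraint cycle in `ℝ²`: the point `p`, or the standard tropical line with vertex `p`. -/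
def Kind.cycle : Kind → ℝ × ℝ → Set (ℝ × ℝ)
  | Kind.point, p => {p}
  | Kind.line, p => {q | ∃ j : Fin 3, ∃ t : ℝ, 0 ≤ t ∧ q = p + t • toReal (dir j)}

/-- The lattice of integral tangent vectors of the constraint cycle at its point `q`: zero for a
point, and generated by the primitive direction of the ray through `q` for a line. (At the
vertex of a line, where it is irrelevant for generic constraints, it is zero.) -/
def Kind.tangent : Kind → ℝ × ℝ → ℝ × ℝ → AddSubgroup (ℤ × ℤ)
  | Kind.point, _, _ => ⊥
  | Kind.line, p, q => AddSubgroup.closure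
      {u | ∃ j : Fin 3, u = dir j ∧ ∃ t : ℝ, 0 < t ∧ q = p + t • toReal u}

section Count

variable {ι : Type} [Fintype ι]

/-- `C` is a tropical solution: it lies in the subfan of the `ψ`-conditions, and the `i`-th marked
point is mapped to the `i`-th constraint, the position of which is `Ξ i`. -/
def IsSolution {d : ℕ} (ins : ι → Insertion) (Ξ : ι → ℝ × ℝ) (C : Curve ι (degreeEnds d)) :
    Prop :=
  C.InPsi (fun i => (ins i).psi) ∧ ∀ i, C.ev i ∈ (ins i).kind.cycle (Ξ i)

/-- The multiplicity of a solution: the weight of its cone in the subfan of the `ψ`-conditions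
times the intersection index of the evaluation map with the cycle of constraints, i.e. the index
in `(ℤ²)^ι` of the sum of the lattices of both. (`AddSubgroup.index` is zero when the index is
infinite, that is, when the intersection is not transversal.) -/
noncomputable def curveMultiplicity {d : ℕ} (ins : ι → Insertion) (Ξ : ι → ℝ × ℝ)
    (C : Curve ι (degreeEnds d)) : ℚ :=
  C.psiWeight (fun i => (ins i).psi) *
    ((C.evLattice ⊔ AddSubgroup.pi Set.univ
      (fun i => (ins i).kind.tangent (Ξ i) (C.ev i))).index : ℚ)

/-- There are finitely many solutions of degree `d` for the constraints `Ξ` up to isomorphism, and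
`N` is their number, counted with multiplicity and divided by the number `(d!)³` of labellings
of the non-contracted ends. -/
def HasCount (d : ℕ) (ins : ι → Insertion) (Ξ : ι → ℝ × ℝ) (N : ℚ) : Prop :=
  ∃ (r : ℕ) (c : Fin r → Curve ι (degreeEnds d)),
    (∀ a, IsSolution ins Ξ (c a)) ∧
    (∀ a b, (c a).Iso (c b) → a = b) ∧
    (∀ C : Curve ι (degreeEnds d), IsSolution ins Ξ C → ∃ a, C.Iso (c a)) ∧
    N = (∑ a, curveMultiplicity ins Ξ (c a)) / ((d.factorial : ℚ) ^ 3)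

/-- A property holds for generic constraints if it holds outside finitely many hyperplanes of the
space of all configurations. -/
def ForGeneric (p : (ι → ℝ × ℝ) → Prop) : Prop :=
  ∃ S : Finset (Module.Dual ℝ (ι → ℝ × ℝ)), (∀ φ ∈ S, φ ≠ 0) ∧
    ∀ Ξ : ι → ℝ × ℝ, (∀ φ ∈ S, φ Ξ ≠ 0) → p Ξ

end Count

/-- All the insertions of `⟨s_1, …, s_r⟩_d`, with the `n` simple point conditions which are
dropped from the notation. -/
def withPoints (n : ℕ) {r : ℕ} (s : Fin r → Insertion) : Fin n ⊕ Fin r → Insertion :=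
  Sum.elim (fun _ => psiP 0) s

/-- `N` is the invariant `⟨s_1, …, s_r⟩_d` with `n` further simple point conditions: the count of
solutions is `N` for all generic constraints. -/
def IsInvariant (d n : ℕ) {r : ℕ} (s : Fin r → Insertion) (N : ℚ) : Prop :=
  ForGeneric fun Ξ => HasCount d (withPoints n s) Ξ N

/-- The tropical descendant invariant `⟨s_1, …, s_r⟩_d` with `n` further simple point conditions
(a meaningful number if there is exactly one `N` with `IsInvariant d n s N`). -/
noncomputable def invariant (d n : ℕ) {r : ℕ} (s : Fin r → Insertion) : ℚ :=
  Classical.epsilon (IsInvariant d n s)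

end TropDesc

/-! Root every curve at the marked point that carries `ψ^k`. A rooted stable tree is the same as a
laminar family `σ` of subsets of the set `X` of the remaining ends and marked points: each vertex is
recorded by the set of leaves above it (`exists_isClusterMap`, `IsClusterMap.unique`). Balancing
forces the slope of the edge below `A` to be the sum of the slopes of the leaves in `A`
(`Rep.slope_eq`). Up to isomorphism a curve is therefore a triple (type, edge lengths, root
position), and the positions of the marked points relative to the root are a combination of integral
vectors `m.vecs A`, with the lengths as coefficients. The `ψ`-condition says that all vertices other
than the root are trivalent and that the root has valency `k + 3`; the weight of the cone is `1`.
After division by translations the intersection index becomes the index of the lattice generated by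
the vectors of `σ` and the directions of the line constraints. So, by `hasCount_iff`, solutions with
one special insertion are the simplicial cones that contain a given generic vector, weighted by
lattice indices.

Independence of the constraints is the statement that a balanced fan has a degree: along a segment
between two generic points the weighted count changes only at walls, and balancing makes each change
zero (`sum_inCone_eq_of_path`). Balancing of the fan of trees has a short reason. A functional
applied to `m.vecs A` is a quadratic expression `U A = ∑ x ∈ A, ∑ y ∈ A, β x y` with zero diagonal
and zero total. A type of codimension one has one vertex `P` with one child too many, and its
resolutions join two children `a`, `b` of `P`. If `U` vanishes on the vertices of the type, the sum
of all `U (a ∪ b)` is the sum of the mixed terms, which is `U P` minus the sum of the `U a`, that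
is, zero (`sum_resolutions_eq_zero`). A line constraint multiplies this fan by a tropical line,
whose three directions sum to zero.

For the divisor equation, forget the marked point `x` on the line without a `ψ`-power
(`IsType.forget_cases`, `generic_hasCount_extension`). If `x` is not at the root vertex, its vertex
disappears and a solution for `ψ^k L` remains, together with a crossing of one of its edges or ends
with the line; the multiplicity is that of the smaller solution times the determinant of the two
directions. By tropical Bézout (`sum_cross_eq`) these determinants sum to `d`. If `x` is at the root
vertex and `k ≥ 1`, the root lies on both lines, hence at their single intersection point, and
forgetting `x` removes one child of the root: this is a solution for `ψ^(k-1) P` with the same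
multiplicity. If `k = 0` and `x` is at the root, a contracted edge carries all the other leaves, and
such curves have too few parameters to occur for generic constraints. The intersection point of the
two lines is again a generic point condition (`generic_update_inter`), so the counts of the smaller
problems may be inserted. -/

namespace TropDesc

set_option linter.unusedSectionVars false

/-! ### Calculus of generic properties. -/

section Generic

variable {E E' : Type*} [AddCommGroup E] [Module ℝ E] [AddCommGroup E'] [Module ℝ E']

/-- A property which holds outside finitely many hyperplanes of a real vector space. -/
def Generic (E : Type*) [AddCommGroup E] [Module ℝ E] (p : E → Prop) : Prop :=
  ∃ S : Finset (Module.Dual ℝ E), (∀ φ ∈ S, φ ≠ 0) ∧ ∀ x : E, (∀ φ ∈ S, φ x ≠ 0) → p x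

theorem Generic.mono {p q : E → Prop} (h : Generic E p) (hpq : ∀ x, p x → q x) : Generic E q := by
  obtain ⟨S, hS, h⟩ := h
  exact ⟨S, hS, fun x hx => hpq x (h x hx)⟩

theorem Generic.and {p q : E → Prop} (hp : Generic E p) (hq : Generic E q) :
    Generic E fun x => p x ∧ q x := by
  classical
  obtain ⟨S, hS, h⟩ := hp
  obtain ⟨T, hT, h'⟩ := hq
  refine ⟨S ∪ T, fun φ hφ => ?_, fun x hx => ⟨h x fun φ hφ => hx φ ?_, h' x fun φ hφ => hx φ ?_⟩⟩
  · rcases Finset.mem_union.1 hφ with h | h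
    exacts [hS _ h, hT _ h]
  · exact Finset.mem_union_left _ hφ
  · exact Finset.mem_union_right _ hφ

theorem Generic.of_forall {p : E → Prop} (h : ∀ x, p x) : Generic E p :=
  ⟨∅, by simp, fun x _ => h x⟩

theorem Generic.all_finset {α : Type*} (s : Finset α) {p : α → E → Prop}
    (h : ∀ a ∈ s, Generic E (p a)) : Generic E fun x => ∀ a ∈ s, p a x := by
  classical
  induction s using Finset.induction_on with
  | empty => exact Generic.of_forall (by simp)
  | insert a s _ ih =>
    have h1 := h a (Finset.mem_insert_self _ _)
    have h2 := ih fun b hb => h b (Finset.mem_insert_of_mem hb)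
    exact (h1.and h2).mono fun x hx => by simpa using hx

theorem Generic.all {α : Type*} [Finite α] {p : α → E → Prop} (h : ∀ a, Generic E (p a)) :
    Generic E fun x => ∀ a, p a x := by
  have := Fintype.ofFinite α
  exact (Generic.all_finset Finset.univ fun a _ => h a).mono fun x hx a => hx a (Finset.mem_univ a)

theorem Generic.imp {p : E → Prop} {c : Prop} (h : c → Generic E p) :
    Generic E fun x => c → p x := by
  by_cases hc : c
  · exact (h hc).mono fun x hx _ => hx
  · exact Generic.of_forall fun x h => absurd h hc

theorem Generic.dual_ne_zero {φ : Module.Dual ℝ E} (h : φ ≠ 0) : Generic E fun x => φ x ≠ 0 :=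
  ⟨{φ}, by simpa using h, fun x hx => hx φ (by simp)⟩

/-- Surjectivity keeps the pulled-back functionals nonzero. Most genericity conditions below are
proved for relative positions and transported to configurations of constraints in this way. -/
theorem Generic.comap {p : E → Prop} (h : Generic E p) (f : E' →ₗ[ℝ] E)
    (hf : Function.Surjective f) : Generic E' fun x => p (f x) := by
  classical
  obtain ⟨S, hS, h⟩ := h
  refine ⟨S.image fun φ => φ ∘ₗ f, ?_, fun x hx => h _ fun φ hφ =>
    hx (φ ∘ₗ f) (Finset.mem_image_of_mem _ hφ)⟩
  intro ψ hψ
  obtain ⟨φ, hφ, rfl⟩ := Finset.mem_image.1 hψ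
  intro h0
  refine hS φ hφ (LinearMap.ext fun y => ?_)
  obtain ⟨x, rfl⟩ := hf y
  exact LinearMap.congr_fun h0 x

theorem Generic.notMem {W : Submodule ℝ E} (hW : W ≠ ⊤) : Generic E fun x => x ∉ W := by
  obtain ⟨φ, h0, hφ⟩ := Submodule.exists_le_ker_of_lt_top W (lt_top_iff_ne_top.2 hW)
  exact (Generic.dual_ne_zero h0).mono fun x hx hxW => hx (hφ hxW)

/-- A vector space over an infinite field is not a finite union of proper subspaces; here these are
the kernels of the excluded functionals. -/
theorem Generic.exists {p : E → Prop} (h : Generic E p) : ∃ x, p x := by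
  obtain ⟨S, hS, h⟩ := h
  obtain ⟨x, hx⟩ : ∃ x : E, ∀ φ ∈ S, φ x ≠ 0 := by
    classical
    by_contra! hc
    refine Subspace.biUnion_ne_univ_of_top_notMem (k := ℝ) (E := E)
      (s := S.image fun φ => LinearMap.ker φ) ?_ ?_
    · intro hmem
      obtain ⟨φ, hφ, h⟩ := Finset.mem_image.1 hmem
      exact hS φ hφ (LinearMap.ker_eq_top.1 h)
    · refine Set.eq_univ_of_forall fun x => ?_
      obtain ⟨φ, hφ, h⟩ := hc x
      simp only [Set.mem_iUnion]
      exact ⟨_, Finset.mem_image_of_mem _ hφ, h⟩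
  exact ⟨x, h x hx⟩

end Generic

/-! ### Jumps of positivity indicators along a segment. -/

section Jump

open Classical in
/-- For affine functions on an interval, no two of which vanish simultaneously, the jump of the
indicator of their common positivity set is the sum of the signs of the slopes at the boundary
points of this set. -/
theorem indicator_sub_indicator_eq_sum_sign {Q : Type*} (S : Finset Q) (α β : Q → ℝ) :
    ∀ a b : ℝ, a < b → (∀ q ∈ S, α q + β q * a ≠ 0) → (∀ q ∈ S, α q + β q * b ≠ 0) →
    (∀ q ∈ S, ∀ q' ∈ S, q ≠ q' → ∀ t, a < t → t < b → α q + β q * t = 0 →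
      α q' + β q' * t ≠ 0) →
    (if ∀ q ∈ S, 0 < α q + β q * b then (1 : ℝ) else 0) -
        (if ∀ q ∈ S, 0 < α q + β q * a then 1 else 0) =
      ∑ q ∈ S, if ∃ t, a < t ∧ t < b ∧ α q + β q * t = 0 ∧
        ∀ q' ∈ S, q' ≠ q → 0 < α q' + β q' * t then Real.sign (β q) else 0 := by
  induction S using Finset.induction_on with
  | empty => intro a b _ _ _ _; simp
  | insert r S hr ih =>
    intro a b hab ha hb hd
    have ne_r : ∀ q ∈ S, q ≠ r := fun q hq h => hr (h ▸ hq)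
    have haS : ∀ q ∈ S, α q + β q * a ≠ 0 := fun q hq => ha q (Finset.mem_insert_of_mem hq)
    have hbS : ∀ q ∈ S, α q + β q * b ≠ 0 := fun q hq => hb q (Finset.mem_insert_of_mem hq)
    have hdS : ∀ a' b', a ≤ a' → b' ≤ b → ∀ q ∈ S, ∀ q' ∈ S, q ≠ q' → ∀ t, a' < t → t < b' →
        α q + β q * t = 0 → α q' + β q' * t ≠ 0 := fun a' b' h1 h2 q hq q' hq' hne t ht ht' =>
      hd q (Finset.mem_insert_of_mem hq) q' (Finset.mem_insert_of_mem hq') hne t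
        (lt_of_le_of_lt h1 ht) (lt_of_lt_of_le ht' h2)
    have har := ha r (Finset.mem_insert_self _ _)
    have hbr := hb r (Finset.mem_insert_self _ _)
    simp only [Finset.forall_mem_insert]
    rw [Finset.sum_insert hr]
    have e2 : ∀ q ∈ S, (if ∃ t, a < t ∧ t < b ∧ α q + β q * t = 0 ∧
        (r ≠ q → 0 < α r + β r * t) ∧ ∀ q' ∈ S, q' ≠ q → 0 < α q' + β q' * t
          then Real.sign (β q) else 0) = if ∃ t, a < t ∧ t < b ∧ α q + β q * t = 0 ∧
        0 < α r + β r * t ∧ ∀ q' ∈ S, q' ≠ q → 0 < α q' + β q' * t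
          then Real.sign (β q) else 0 := fun q hq => by
      simp only [ne_eq, (ne_r q hq).symm, not_false_eq_true, true_imp_iff]
    rw [Finset.sum_congr rfl e2]
    have e3 : (∃ t, a < t ∧ t < b ∧ α r + β r * t = 0 ∧ (r ≠ r → 0 < α r + β r * t) ∧
        ∀ q' ∈ S, q' ≠ r → 0 < α q' + β q' * t) ↔
        ∃ t, a < t ∧ t < b ∧ α r + β r * t = 0 ∧ ∀ q' ∈ S, 0 < α q' + β q' * t := by
      refine exists_congr fun t => ?_
      simp only [ne_eq, not_true_eq_false, false_imp_iff, true_and]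
      refine and_congr_right fun _ => and_congr_right fun _ => and_congr_right fun _ =>
        forall₂_congr fun q hq => ?_
      simp [ne_r q hq]
    simp only [e3]
    -- The function of `r` changes sign at most once. Where it is negative nothing is counted. If it
    -- vanishes at `s`, the induction hypothesis is applied to the side of `s` on which it is
    -- positive, and the indicator of `S` at `s` is the boundary term of `r`.
    rcases lt_or_gt_of_ne har with ha' | ha' <;> rcases lt_or_gt_of_ne hbr with hb' | hb'
    · -- negative throughout
      have neg : ∀ t, a < t → t < b → α r + β r * t < 0 := fun t h1 h2 => by
        rcases le_total 0 (β r) with h | h <;> nlinarith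
      rw [if_neg (by intro h; linarith [h.1]), if_neg (by intro h; linarith [h.1]), if_neg,
        Finset.sum_eq_zero]
      · simp
      · intro q hq
        rw [if_neg]
        rintro ⟨t, h1, h2, -, h3, -⟩
        linarith [neg t h1 h2]
      · rintro ⟨t, h1, h2, h3, -⟩
        linarith [neg t h1 h2]
    · have hβ : 0 < β r := by nlinarith
      set s := -α r / β r with hs
      have hs0 : α r + β r * s = 0 := by rw [hs]; field_simp; ring
      have hs1 : a < s := by nlinarith
      have hs2 : s < b := by nlinarith
      have hsS : ∀ q ∈ S, α q + β q * s ≠ 0 := fun q hq =>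
        hd r (Finset.mem_insert_self _ _) q (Finset.mem_insert_of_mem hq) (ne_r q hq).symm s hs1 hs2 hs0
      have key := ih s b hs2 hsS hbS (hdS s b hs1.le le_rfl)
      rw [if_neg (c := 0 < α r + β r * a ∧ _) (by intro h; linarith [h.1])]
      have e4 : (∃ t, a < t ∧ t < b ∧ α r + β r * t = 0 ∧ ∀ q' ∈ S, 0 < α q' + β q' * t) ↔
          ∀ q' ∈ S, 0 < α q' + β q' * s := by
        constructor
        · rintro ⟨t, h1, h2, h3, h4⟩
          have : t = s := by nlinarith
          rwa [this] at h4
        · intro h; exact ⟨s, hs1, hs2, hs0, h⟩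
      have e5 : ∀ q, (∃ t, a < t ∧ t < b ∧ α q + β q * t = 0 ∧
          0 < α r + β r * t ∧ ∀ q' ∈ S, q' ≠ q → 0 < α q' + β q' * t) ↔
          ∃ t, s < t ∧ t < b ∧ α q + β q * t = 0 ∧ ∀ q' ∈ S, q' ≠ q → 0 < α q' + β q' * t := by
        intro q
        refine exists_congr fun t => ⟨?_, ?_⟩
        · rintro ⟨h1, h2, h3, h4, h5⟩
          exact ⟨by nlinarith, h2, h3, h5⟩
        · rintro ⟨h1, h2, h3, h5⟩
          exact ⟨by linarith, h2, h3, by nlinarith, h5⟩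
      simp only [e4, e5, Real.sign_of_pos hβ]
      rw [← key]
      simp [hb']
    · have hβ : β r < 0 := by nlinarith
      set s := -α r / β r with hs
      have hs0 : α r + β r * s = 0 := by
        rw [hs]; have := hβ.ne; field_simp; ring
      have hs1 : a < s := by nlinarith
      have hs2 : s < b := by nlinarith
      have hsS : ∀ q ∈ S, α q + β q * s ≠ 0 := fun q hq =>
        hd r (Finset.mem_insert_self _ _) q (Finset.mem_insert_of_mem hq) (ne_r q hq).symm s hs1 hs2 hs0
      have key := ih a s hs1 haS hsS (hdS a s le_rfl hs2.le)
      rw [if_neg (c := 0 < α r + β r * b ∧ _) (by intro h; linarith [h.1])]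
      have e4 : (∃ t, a < t ∧ t < b ∧ α r + β r * t = 0 ∧ ∀ q' ∈ S, 0 < α q' + β q' * t) ↔
          ∀ q' ∈ S, 0 < α q' + β q' * s := by
        constructor
        · rintro ⟨t, h1, h2, h3, h4⟩
          have : t = s := by nlinarith
          rwa [this] at h4
        · intro h; exact ⟨s, hs1, hs2, hs0, h⟩
      have e5 : ∀ q, (∃ t, a < t ∧ t < b ∧ α q + β q * t = 0 ∧
          0 < α r + β r * t ∧ ∀ q' ∈ S, q' ≠ q → 0 < α q' + β q' * t) ↔
          ∃ t, a < t ∧ t < s ∧ α q + β q * t = 0 ∧ ∀ q' ∈ S, q' ≠ q → 0 < α q' + β q' * t := by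
        intro q
        refine exists_congr fun t => ⟨?_, ?_⟩
        · rintro ⟨h1, h2, h3, h4, h5⟩
          exact ⟨h1, by nlinarith, h3, h5⟩
        · rintro ⟨h1, h2, h3, h5⟩
          exact ⟨h1, by linarith, h3, by nlinarith, h5⟩
      simp only [e4, e5, Real.sign_of_neg hβ]
      rw [← key]
      simp only [ha', true_and]
      split_ifs <;> norm_num
    · have pos : ∀ t, a < t → t < b → 0 < α r + β r * t := fun t h1 h2 => by
        rcases le_total 0 (β r) with h | h <;> nlinarith
      have key := ih a b hab haS hbS (hdS a b le_rfl le_rfl)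
      rw [if_neg (c := ∃ t, a < t ∧ t < b ∧ α r + β r * t = 0 ∧ _)]
      · simp only [ha', hb', true_and, zero_add]
        rw [key]
        refine Finset.sum_congr rfl fun q _ => ?_
        congr 1
        refine propext (exists_congr fun t => ⟨?_, ?_⟩)
        · rintro ⟨h1, h2, h3, h4⟩; exact ⟨h1, h2, h3, pos t h1 h2, h4⟩
        · rintro ⟨h1, h2, h3, _, h4⟩; exact ⟨h1, h2, h3, h4⟩
      · rintro ⟨t, h1, h2, h3, -⟩
        linarith [pos t h1 h2]

end Jump

/-! ### The degree of a balanced simplicial fan. -/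

section Fan

variable {E : Type*} [AddCommGroup E] [Module ℝ E] {Q : Type*} [Fintype Q]

/-- `x` lies in the relative interior of the simplicial cone spanned by the vectors `u q` with
`q ∈ c`, with coordinates `w`. -/
def ConeCoord (u : Q → E) (c : Finset Q) (x : E) (w : Q → ℝ) : Prop :=
  (∀ q ∈ c, 0 < w q) ∧ (∀ q ∉ c, w q = 0) ∧ x = ∑ q, w q • u q

/-- `x` lies in the relative interior of the cone spanned by the vectors `u q` with `q ∈ c`. -/
def InCone (u : Q → E) (c : Finset Q) (x : E) : Prop := ∃ w, ConeCoord u c x w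

variable [DecidableEq Q]

theorem ConeCoord.sum_eq {u : Q → E} {c : Finset Q} {x : E} {w : Q → ℝ}
    (h : ConeCoord u c x w) : x = ∑ q ∈ c, w q • u q := by
  rw [h.2.2]
  refine (Finset.sum_subset (Finset.subset_univ c) fun q _ hq => ?_).symm
  rw [h.2.1 q hq, zero_smul]

variable [FiniteDimensional ℝ E]

/-- `D (σ.erase q)` kills every generator of `σ` except `u q`. The facet functionals thus act as a
dual basis up to scaling, which yields linear independence and coordinates on the cone. -/
theorem dual_sum_erase {u : Q → E} {D : Finset Q → Module.Dual ℝ E}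
    (hD0 : ∀ τ, ∀ q ∈ τ, D τ (u q) = 0) {σ : Finset Q} {q : Q} (hq : q ∈ σ) (w : Q → ℝ) :
    D (σ.erase q) (∑ r ∈ σ, w r • u r) = w q * D (σ.erase q) (u q) := by
  rw [map_sum, Finset.sum_eq_single q]
  · simp
  · intro r hr hrq
    rw [map_smul, hD0 _ r (Finset.mem_erase.2 ⟨hrq, hr⟩), smul_zero]
  · exact fun h => absurd hq h

theorem linearIndepOn_of_dual {u : Q → E} {D : Finset Q → Module.Dual ℝ E}
    (hD0 : ∀ τ, ∀ q ∈ τ, D τ (u q) = 0) {σ : Finset Q}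
    (hne : ∀ q ∈ σ, D (σ.erase q) (u q) ≠ 0) : LinearIndependent ℝ fun q : σ => u q := by
  rw [Fintype.linearIndependent_iff]
  intro g hg q
  have h1 : ∑ r ∈ σ, (fun r => if h : r ∈ σ then g ⟨r, h⟩ else 0) r • u r = 0 := by
    rw [← hg, ← Finset.sum_coe_sort]
    exact Finset.sum_congr rfl fun r _ => by simp
  have h2 := dual_sum_erase hD0 q.2 (fun r => if h : r ∈ σ then g ⟨r, h⟩ else 0)
  rw [h1, map_zero] at h2
  have h3 := (mul_eq_zero.1 h2.symm).resolve_right (hne q q.2)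
  simpa using h3

theorem eq_sum_dual_div {u : Q → E} {D : Finset Q → Module.Dual ℝ E}
    (hD0 : ∀ τ, ∀ q ∈ τ, D τ (u q) = 0) {σ : Finset Q}
    (hne : ∀ q ∈ σ, D (σ.erase q) (u q) ≠ 0) (hcard : σ.card = Module.finrank ℝ E) (x : E) :
    x = ∑ q ∈ σ, (D (σ.erase q) x / D (σ.erase q) (u q)) • u q := by
  have hli := linearIndepOn_of_dual hD0 hne
  have hspan := hli.span_eq_top_of_card_eq_finrank' (by simpa using hcard)
  have hx : x ∈ Submodule.span ℝ (Set.range fun q : σ => u q) := by rw [hspan]; trivial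
  obtain ⟨g, hg⟩ := (Submodule.mem_span_range_iff_exists_fun ℝ).1 hx
  have h1 : ∑ r ∈ σ, (fun r => if h : r ∈ σ then g ⟨r, h⟩ else 0) r • u r = x := by
    rw [← hg, ← Finset.sum_coe_sort]
    exact Finset.sum_congr rfl fun r _ => by simp
  rw [← h1]
  refine Finset.sum_congr rfl fun q hq => ?_
  rw [dual_sum_erase hD0 hq, mul_div_assoc, div_self (hne q hq), mul_one]

theorem inCone_iff_dual {u : Q → E} {D : Finset Q → Module.Dual ℝ E}
    (hD0 : ∀ τ, ∀ q ∈ τ, D τ (u q) = 0) {σ : Finset Q}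
    (hne : ∀ q ∈ σ, D (σ.erase q) (u q) ≠ 0) (hcard : σ.card = Module.finrank ℝ E) (x : E) :
    InCone u σ x ↔ ∀ q ∈ σ, 0 < D (σ.erase q) x / D (σ.erase q) (u q) := by
  constructor
  · rintro ⟨w, hw⟩ q hq
    rw [hw.sum_eq, dual_sum_erase hD0 hq, mul_div_assoc, div_self (hne q hq), mul_one]
    exact hw.1 q hq
  · intro h
    refine ⟨fun q => if q ∈ σ then D (σ.erase q) x / D (σ.erase q) (u q) else 0,
      fun q hq => by simpa [hq] using h q hq, fun q hq => by simp [hq], ?_⟩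
    conv_lhs => rw [eq_sum_dual_div hD0 hne hcard x]
    simp [Finset.sum_ite_mem, ite_smul]

theorem inCone_erase_iff_dual {u : Q → E} {D : Finset Q → Module.Dual ℝ E}
    (hD0 : ∀ τ, ∀ q ∈ τ, D τ (u q) = 0) {σ : Finset Q}
    (hne : ∀ q ∈ σ, D (σ.erase q) (u q) ≠ 0) (hcard : σ.card = Module.finrank ℝ E) (x : E)
    {q : Q} (hq : q ∈ σ) :
    InCone u (σ.erase q) x ↔ D (σ.erase q) x / D (σ.erase q) (u q) = 0 ∧
      ∀ r ∈ σ, r ≠ q → 0 < D (σ.erase r) x / D (σ.erase r) (u r) := by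
  constructor
  · rintro ⟨w, hw⟩
    have hx : x = ∑ r ∈ σ, w r • u r := by
      rw [hw.2.2]
      refine (Finset.sum_subset (Finset.subset_univ σ) fun r _ hr => ?_).symm
      rw [hw.2.1 r (fun h => hr (Finset.mem_of_mem_erase h)), zero_smul]
    have key : ∀ r ∈ σ, D (σ.erase r) x / D (σ.erase r) (u r) = w r := fun r hr => by
      rw [hx, dual_sum_erase hD0 hr, mul_div_assoc, div_self (hne r hr), mul_one]
    refine ⟨by rw [key q hq]; exact hw.2.1 q (Finset.notMem_erase q σ), fun r hr hrq => ?_⟩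
    rw [key r hr]
    exact hw.1 r (Finset.mem_erase.2 ⟨hrq, hr⟩)
  · rintro ⟨h0, h⟩
    refine ⟨fun r => if r ∈ σ.erase q then D (σ.erase r) x / D (σ.erase r) (u r) else 0,
      fun r hr => ?_, fun q hq => by simp [hq], ?_⟩
    · simp only [if_pos hr]
      exact h r (Finset.mem_of_mem_erase hr) (Finset.ne_of_mem_erase hr)
    · conv_lhs => rw [eq_sum_dual_div hD0 hne hcard x, ← Finset.add_sum_erase σ _ hq, h0]
      simp only [ite_smul, zero_smul, Finset.sum_ite_mem, Finset.univ_inter, zero_add]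

omit [FiniteDimensional ℝ E] [Fintype Q] in
-- With `a = D τ (u q)` and `b = D τ (y - x)` this turns weight times crossing sign into an
-- expression linear in `D τ (u q)`, whose remaining factor depends on the wall `τ` only. In this
-- form balancing applies.
theorem abs_mul_sign_div (a b : ℝ) : |a| * Real.sign (b / a) = Real.sign b * a := by
  rcases lt_trichotomy a 0 with ha | rfl | ha
  · rcases lt_trichotomy b 0 with hb | rfl | hb
    · rw [Real.sign_of_pos (div_pos_of_neg_of_neg hb ha), Real.sign_of_neg hb, abs_of_neg ha]; ring
    · simp
    · rw [Real.sign_of_neg (div_neg_of_pos_of_neg hb ha), Real.sign_of_pos hb, abs_of_neg ha]; ring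
  · simp
  · rcases lt_trichotomy b 0 with hb | rfl | hb
    · rw [Real.sign_of_neg (div_neg_of_neg_of_pos hb ha), Real.sign_of_neg hb, abs_of_pos ha]; ring
    · simp
    · rw [Real.sign_of_pos (div_pos hb ha), Real.sign_of_pos hb, abs_of_pos ha]; ring

open Classical in
-- On the segment from `x` to `y` the count changes only where a wall `τ` is crossed. The cones
-- adjacent to `τ` contribute a common sign times `D τ (u q)`, and these sum to zero by `hbal`. The
-- hypothesis `hxy` prevents the segment from crossing two facets of one nondegenerate cone at the
-- same time.
theorem sum_inCone_eq_of_path {u : Q → E} (T : Finset (Finset Q)) (μ : Finset Q → ℝ)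
    (D : Finset Q → Module.Dual ℝ E) (hcard : ∀ σ ∈ T, σ.card = Module.finrank ℝ E)
    (hD0 : ∀ τ, ∀ q ∈ τ, D τ (u q) = 0)
    (hDμ : ∀ σ ∈ T, ∀ q ∈ σ, |D (σ.erase q) (u q)| = μ σ)
    (hbal : ∀ τ, ∑ q with q ∉ τ ∧ insert q τ ∈ T, D τ (u q) = 0) (x y : E)
    (hx : ∀ τ, D τ ≠ 0 → D τ x ≠ 0) (hy : ∀ τ, D τ ≠ 0 → D τ y ≠ 0)
    (hxy : ∀ σ ∈ T, μ σ ≠ 0 → ∀ q ∈ σ, ∀ q' ∈ σ, q ≠ q' →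
      D (σ.erase q) x * D (σ.erase q') y ≠ D (σ.erase q') x * D (σ.erase q) y) :
    ∑ σ ∈ T, (if InCone u σ y then μ σ else 0) = ∑ σ ∈ T, (if InCone u σ x then μ σ else 0) := by
  -- The jump caused by the cone `insert q τ` where the segment meets the interior of its facet `τ`.
  set G : Finset Q → Q → ℝ := fun τ q =>
    if ∃ t : ℝ, 0 < t ∧ t < 1 ∧ InCone u τ (x + t • (y - x)) then
      Real.sign (D τ (y - x)) * D τ (u q) else 0 with hG
  have step : ∀ σ ∈ T, (if InCone u σ y then μ σ else 0) - (if InCone u σ x then μ σ else 0) =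
      ∑ q ∈ σ, G (σ.erase q) q := by
    intro σ hσ
    -- Degenerate cones have weight zero and contribute nothing; they are set aside because the
    -- coordinates below divide by numbers of absolute value `μ σ`.
    by_cases hμ : μ σ = 0
    · rw [hμ, Finset.sum_eq_zero]
      · simp
      · intro q hq
        have h0 : D (σ.erase q) (u q) = 0 := abs_eq_zero.1 (by rw [hDμ σ hσ q hq, hμ])
        simp [hG, h0]
    have hne : ∀ q ∈ σ, D (σ.erase q) (u q) ≠ 0 := fun q hq h0 => hμ (by
      rw [← hDμ σ hσ q hq, h0, abs_zero])
    have hDne : ∀ q ∈ σ, D (σ.erase q) ≠ 0 := fun q hq h0 => hne q hq (by rw [h0]; rfl)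
    set α : Q → ℝ := fun q => D (σ.erase q) x / D (σ.erase q) (u q) with hα
    set β : Q → ℝ := fun q => D (σ.erase q) (y - x) / D (σ.erase q) (u q) with hβ
    have hαβ : ∀ q t, α q + β q * t = D (σ.erase q) (x + t • (y - x)) / D (σ.erase q) (u q) := by
      intro q t
      simp only [hα, hβ, map_add, map_smul, smul_eq_mul]; ring
    have hα0 : ∀ q, α q + β q * 0 = D (σ.erase q) x / D (σ.erase q) (u q) := by
      intro q; rw [hαβ]; simp
    have hα1 : ∀ q, α q + β q * 1 = D (σ.erase q) y / D (σ.erase q) (u q) := by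
      intro q; rw [hαβ]; simp
    have key := indicator_sub_indicator_eq_sum_sign σ α β 0 1 zero_lt_one
      (fun q hq => by rw [hα0]; exact div_ne_zero (hx _ (hDne q hq)) (hne q hq))
      (fun q hq => by rw [hα1]; exact div_ne_zero (hy _ (hDne q hq)) (hne q hq)) (by
        intro q hq q' hq' hqq t _ _ h1 h2
        refine hxy σ hσ hμ q hq q' hq' hqq ?_
        rw [hαβ, div_eq_zero_iff, or_iff_left (hne _ hq)] at h1
        rw [hαβ, div_eq_zero_iff, or_iff_left (hne _ hq')] at h2
        simp only [map_add, map_smul, smul_eq_mul, map_sub] at h1 h2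
        by_cases ht : t = 0
        · subst ht
          exact absurd (by linarith) (hx _ (hDne q hq))
        · have : t * (D (σ.erase q) x * D (σ.erase q') y - D (σ.erase q') x * D (σ.erase q) y) = 0 := by
            linear_combination (D (σ.erase q) x) * h2 - (D (σ.erase q') x) * h1
          exact sub_eq_zero.1 ((mul_eq_zero.1 this).resolve_left ht))
    simp only [hα0, hα1, ← inCone_iff_dual hD0 hne (hcard σ hσ)] at key
    have e1 : (if InCone u σ y then μ σ else 0) - (if InCone u σ x then μ σ else 0) =
        μ σ * ((if InCone u σ y then 1 else 0) - (if InCone u σ x then 1 else 0)) := by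
      split_ifs <;> ring
    rw [e1, key, Finset.mul_sum]
    refine Finset.sum_congr rfl fun q hq => ?_
    simp only [hαβ, ← inCone_erase_iff_dual hD0 hne (hcard σ hσ) _ hq, hG]
    split_ifs with h
    · rw [← hDμ σ hσ q hq, abs_mul_sign_div]
    · simp
  rw [← sub_eq_zero, ← Finset.sum_sub_distrib, Finset.sum_congr rfl step]
  -- A cone with a chosen generator is the same as a wall with a generator that completes it to a
  -- cone of `T`.
  have swap : ∑ σ ∈ T, ∑ q ∈ σ, G (σ.erase q) q =
      ∑ τ : Finset Q, ∑ q with q ∉ τ ∧ insert q τ ∈ T, G τ q := by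
    rw [Finset.sum_sigma', Finset.sum_sigma']
    refine Finset.sum_bij' (fun a _ => ⟨a.1.erase a.2, a.2⟩) (fun a _ => ⟨insert a.2 a.1, a.2⟩)
      ?_ ?_ ?_ ?_ ?_
    · rintro ⟨σ, q⟩ h
      simp only [Finset.mem_sigma] at h
      simp [Finset.insert_erase h.2, h.1]
    · rintro ⟨τ, q⟩ h
      simp only [Finset.mem_sigma, Finset.mem_filter, Finset.mem_univ, true_and] at h
      simp [h.2]
    · rintro ⟨σ, q⟩ h
      simp only [Finset.mem_sigma] at h
      simp [Finset.insert_erase h.2]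
    · rintro ⟨τ, q⟩ h
      simp only [Finset.mem_sigma, Finset.mem_filter, Finset.mem_univ, true_and] at h
      simp [Finset.erase_insert h.1]
    · rintro ⟨σ, q⟩ h
      rfl
  rw [swap]
  refine Finset.sum_eq_zero fun τ _ => ?_
  simp only [hG]
  split_ifs
  · rw [← Finset.mul_sum, hbal, mul_zero]
  · simp

open Classical in
/-- The degree of a balanced simplicial fan: for generic `x`, the number of cones which contain
`x`, counted with multiplicity, does not depend on `x`. The balancing condition is expressed by
linear functionals `D τ` which vanish on the cones `τ` of codimension one. -/
theorem exists_generic_sum_inCone_eq {u : Q → E} (T : Finset (Finset Q)) (μ : Finset Q → ℝ)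
    (D : Finset Q → Module.Dual ℝ E) (hcard : ∀ σ ∈ T, σ.card = Module.finrank ℝ E)
    (hD0 : ∀ τ, ∀ q ∈ τ, D τ (u q) = 0)
    (hDμ : ∀ σ ∈ T, ∀ q ∈ σ, |D (σ.erase q) (u q)| = μ σ)
    (hbal : ∀ τ, ∑ q with q ∉ τ ∧ insert q τ ∈ T, D τ (u q) = 0) :
    ∃ N : ℝ, Generic E fun x => ∑ σ ∈ T, (if InCone u σ x then μ σ else 0) = N := by
  have h0 : Generic E fun x => ∀ τ, D τ ≠ 0 → D τ x ≠ 0 :=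
    Generic.all fun τ => Generic.imp fun h => Generic.dual_ne_zero h
  -- For fixed `x`, a coincidence of two wall crossings is one linear equation for `y`; evaluation
  -- at `u q'` shows that it is nontrivial.
  have h1 : ∀ x : E, (∀ τ, D τ ≠ 0 → D τ x ≠ 0) → Generic E fun y => ∀ σ ∈ T, ∀ q ∈ σ, ∀ q' ∈ σ,
      μ σ ≠ 0 ∧ q ≠ q' →
      D (σ.erase q) x * D (σ.erase q') y ≠ D (σ.erase q') x * D (σ.erase q) y := by
    intro x hx
    refine Generic.all_finset T fun σ hσ => Generic.all_finset σ fun q hq =>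
      Generic.all_finset σ fun q' hq' => Generic.imp fun h => ?_
    obtain ⟨hμ, hqq⟩ := h
    have hne : ∀ q ∈ σ, D (σ.erase q) (u q) ≠ 0 := fun q hq h0 => hμ (by
      rw [← hDμ σ hσ q hq, h0, abs_zero])
    have hDne : ∀ q ∈ σ, D (σ.erase q) ≠ 0 := fun q hq h0 => hne q hq (by rw [h0]; rfl)
    refine (Generic.dual_ne_zero (φ := D (σ.erase q) x • D (σ.erase q') -
      D (σ.erase q') x • D (σ.erase q)) ?_).mono fun y hy => ?_
    · intro h
      have := LinearMap.congr_fun h (u q')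
      simp only [LinearMap.sub_apply, LinearMap.smul_apply, smul_eq_mul, LinearMap.zero_apply,
        hD0 (σ.erase q) q' (Finset.mem_erase.2 ⟨hqq.symm, hq'⟩), mul_zero, sub_zero] at this
      exact mul_ne_zero (hx _ (hDne q hq)) (hne q' hq') this
    · simpa [sub_eq_zero] using hy
  obtain ⟨x₀, hx₀⟩ := h0.exists
  refine ⟨∑ σ ∈ T, (if InCone u σ x₀ then μ σ else 0), h0.mono fun x hx => ?_⟩
  -- The segment from `x₀` to `x` may be special. Both points are compared with a third one that is
  -- generic relative to each of them.
  obtain ⟨y, ⟨hy, hxy⟩, hxy₀⟩ := ((h0.and (h1 x hx)).and (h1 x₀ hx₀)).exists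
  rw [← sum_inCone_eq_of_path T μ D hcard hD0 hDμ hbal x y hx hy
      (fun σ hσ hμ q hq q' hq' hqq => hxy σ hσ q hq q' hq' ⟨hμ, hqq⟩),
    sum_inCone_eq_of_path T μ D hcard hD0 hDμ hbal x₀ y hx₀ hy
      (fun σ hσ hμ q hq q' hq' hqq => hxy₀ σ hσ q hq q' hq' ⟨hμ, hqq⟩)]

end Fan

/-! ### Lattice indices as determinants. -/

section Index

/-- The image of a nonzero homomorphism to `ℤ` is infinite, so its kernel, and any subgroup of it,
has infinite index, recorded as `0`. -/
theorem AddSubgroup.index_eq_zero_of_le_ker {G : Type*} [AddCommGroup G] {H : AddSubgroup G}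
    (φ : G →+ ℤ) (hφ : φ ≠ 0) (h : H ≤ φ.ker) : H.index = 0 := by
  have h1 : φ.ker.index = 0 := by
    rw [AddSubgroup.index_ker]
    obtain ⟨g, hg⟩ : ∃ g, φ g ≠ 0 := by
      by_contra! hc
      exact hφ (AddMonoidHom.ext hc)
    have : Infinite φ.range := by
      refine Infinite.of_injective (fun n : ℤ => (⟨φ (n • g), n • g, rfl⟩ : φ.range)) ?_
      intro a b hab
      have := congrArg Subtype.val hab
      simpa [hg] using this
    exact Nat.card_eq_zero_of_infinite
  have h2 := AddSubgroup.index_dvd_of_le h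
  rw [h1] at h2
  exact zero_dvd_iff.1 h2

/-- Also valid for singular matrices: a null vector then defines a homomorphism to `ℤ` that kills
all rows, and both sides are zero. Degenerate cones therefore need no separate definition of
multiplicity. -/
theorem index_closure_range_rows {J : Type*} [Fintype J] [DecidableEq J] (A : Matrix J J ℤ) :
    (AddSubgroup.closure (Set.range fun j => A j)).index = A.det.natAbs := by
  by_cases hdet : A.det = 0
  · rw [hdet, Int.natAbs_zero]
    obtain ⟨v, hv, hAv⟩ := Matrix.exists_mulVec_eq_zero_iff.2 hdet
    refine AddSubgroup.index_eq_zero_of_le_ker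
      (⟨⟨fun x => dotProduct x v, by simp⟩, fun x y => add_dotProduct x y v⟩ : (J → ℤ) →+ ℤ) ?_ ?_
    · intro h0
      obtain ⟨j, hj⟩ := Function.ne_iff.1 hv
      have := DFunLike.congr_fun h0 (Pi.single j 1)
      simp at this
      exact hj this
    · rw [AddSubgroup.closure_le]
      rintro _ ⟨j, rfl⟩
      have := congrFun hAv j
      simpa [Matrix.mulVec] using this
  · have hli : LinearIndependent ℤ fun j => A j := Matrix.linearIndependent_rows_of_det_ne_zero hdet
    have h := AddSubgroup.index_eq_natAbs_det (Pi.basisFun ℤ J)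
      (Submodule.span ℤ (Set.range fun j => A j)).toAddSubgroup (Module.Basis.span hli)
    rw [← Submodule.span_int_eq_addSubgroupClosure, h]
    congr 1
    rw [Pi.basisFun_det]
    have h2 : (fun j => ((Module.Basis.span hli j : Submodule.span ℤ (Set.range fun j => A j)) :
        J → ℤ)) = A := funext fun j => Module.Basis.coe_span_apply hli j
    exact congrArg Matrix.det h2

variable {M : Type*}

/-- The inclusion of the lattice `(ℤ²)^M` into `(ℝ²)^M`. -/
def castVec : (M → ℤ × ℤ) →+ (M → ℝ × ℝ) where
  toFun a i := toReal (a i)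
  map_zero' := by ext <;> simp [toReal]
  map_add' a b := by ext <;> simp [toReal]

theorem castVec_apply (a : M → ℤ × ℤ) (i : M) : castVec a i = toReal (a i) := rfl

/-- The coordinates of a tuple of vectors in the plane. -/
def coords (R : Type*) [CommRing R] : (M → R × R) ≃ₗ[R] (M × Bool → R) where
  toFun a j := if j.2 then (a j.1).1 else (a j.1).2
  map_add' a b := by ext ⟨i, _ | _⟩ <;> simp
  map_smul' c a := by ext ⟨i, _ | _⟩ <;> simp
  invFun b i := (b (i, true), b (i, false))
  left_inv a := by ext <;> simp
  right_inv b := by ext ⟨i, _ | _⟩ <;> simp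

theorem coords_castVec (a : M → ℤ × ℤ) (j : M × Bool) :
    coords ℝ (castVec a) j = ((coords ℤ a j : ℤ) : ℝ) := by
  obtain ⟨i, _ | _⟩ := j <;> simp [coords, castVec, toReal]

variable [Fintype M] [DecidableEq M]

theorem finrank_plane_pi : Module.finrank ℝ (M → ℝ × ℝ) = 2 * Fintype.card M := by
  rw [LinearEquiv.finrank_eq (coords ℝ), Module.finrank_fintype_fun_eq_card, Fintype.card_prod,
    Fintype.card_bool, mul_comm]

theorem index_closure_eq_natAbs_det (w : M × Bool → M → ℤ × ℤ) :
    (AddSubgroup.closure (Set.range w)).index =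
      (Matrix.of fun j => coords ℤ (w j)).det.natAbs := by
  rw [← index_closure_range_rows,
    ← AddSubgroup.index_map_equiv _ (coords ℤ : (M → ℤ × ℤ) ≃ₗ[ℤ] _).toAddEquiv]
  congr 1
  rw [AddMonoidHom.map_closure, ← Set.range_comp]
  rfl

/-- `D` is the determinant whose rows but one are filled with the vectors of `τ`. Its sign tells the
side of the wall and its absolute value at `u q` is the lattice index of the cone, so one functional
carries both the geometry and the weights. For `τ` of the wrong size `D = 0` serves. -/
theorem exists_dual_abs_eq_index {Q : Type*} [DecidableEq Q] (u : Q → M → ℤ × ℤ) (τ : Finset Q) :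
    ∃ D : Module.Dual ℝ (M → ℝ × ℝ), (∀ q ∈ τ, D (castVec (u q)) = 0) ∧
      (τ.card + 1 = 2 * Fintype.card M → ∀ q,
        |D (castVec (u q))| = ((AddSubgroup.closure (u '' (insert q τ : Finset Q))).index : ℝ)) := by
  by_cases hc : τ.card + 1 = 2 * Fintype.card M
  swap
  · exact ⟨0, by simp, fun h => absurd h hc⟩
  have hcard : Fintype.card (M × Bool) = τ.card + 1 := by
    rw [Fintype.card_prod, Fintype.card_bool, hc, mul_comm]
  obtain ⟨j₀⟩ : Nonempty (M × Bool) := Fintype.card_pos_iff.1 (by omega)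
  have e : {j // j ≠ j₀} ≃ τ := Fintype.equivOfCardEq (by
    rw [Fintype.card_subtype_compl, hcard]; simp)
  set m : M × Bool → M × Bool → ℝ := fun j =>
    if h : j ≠ j₀ then coords ℝ (castVec (u (e ⟨j, h⟩))) else 0 with hm
  set D : Module.Dual ℝ (M → ℝ × ℝ) :=
    (Matrix.detRowAlternating (R := ℝ) (n := M × Bool)).toMultilinearMap.toLinearMap m j₀ ∘ₗ
      (coords ℝ).toLinearMap with hD
  have hDv : ∀ v, D v = Matrix.det (Function.update m j₀ (coords ℝ v)) := fun v => rfl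
  refine ⟨D, fun q hq => ?_, fun _ q => ?_⟩
  · rw [hDv]
    refine Matrix.det_zero_of_row_eq (i := j₀) (j := (e.symm ⟨q, hq⟩).1)
      (e.symm ⟨q, hq⟩).2.symm ?_
    rw [Function.update_self, Function.update_of_ne (e.symm ⟨q, hq⟩).2, hm]
    simp only [(e.symm ⟨q, hq⟩).2, not_false_eq_true, dif_pos, ne_eq, Subtype.coe_eta,
      Equiv.apply_symm_apply]
  · set w : M × Bool → M → ℤ × ℤ := fun j => if h : j ≠ j₀ then u (e ⟨j, h⟩) else u q with hw
    have h1 : Function.update m j₀ (coords ℝ (castVec (u q))) =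
        (Matrix.of fun j => coords ℤ (w j)).map (fun z : ℤ => (z : ℝ)) := by
      ext j i
      rw [Matrix.map_apply, Matrix.of_apply, ← coords_castVec]
      by_cases hj : j = j₀
      · subst hj; simp [hw]
      · rw [Function.update_of_ne hj]; simp [hm, hw, hj]
    have h2 : u '' (insert q τ : Finset Q) = Set.range w := by
      ext a
      constructor
      · rintro ⟨r, hr, rfl⟩
        rcases Finset.mem_insert.1 hr with rfl | hr
        · exact ⟨j₀, by simp [hw]⟩
        · exact ⟨(e.symm ⟨r, hr⟩).1, by simp [hw, (e.symm ⟨r, hr⟩).2]⟩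
      · rintro ⟨j, rfl⟩
        by_cases hj : j = j₀
        · exact ⟨q, by simp, by simp [hw, hj]⟩
        · exact ⟨e ⟨j, hj⟩, by simp, by simp [hw, hj]⟩
    rw [hDv, h1, h2, index_closure_eq_natAbs_det, Nat.cast_natAbs]
    have h3 := (Int.castRingHom ℝ).map_det (Matrix.of fun j => coords ℤ (w j))
    rw [RingHom.mapMatrix_apply] at h3
    erw [← h3]
    simp

end Index

/-! ### Laminar families as rooted trees; contraction of an edge. -/

section Hierarchy

variable {X : Type*} [Fintype X] [DecidableEq X]

/-- A laminar family of proper subsets with at least two elements: the combinatorial type of a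
rooted tree with leaves `X`. The members are the vertices other than the root, each given as the
set of the leaves above it. -/
def IsHier (σ : Finset (Finset X)) : Prop :=
  (∀ A ∈ σ, 2 ≤ A.card ∧ A ≠ Finset.univ) ∧ ∀ A ∈ σ, ∀ B ∈ σ, A ⊆ B ∨ B ⊆ A ∨ Disjoint A B

/-- The vertices other than the root, and the leaves. -/
def nodes (σ : Finset (Finset X)) : Finset (Finset X) :=
  σ ∪ Finset.univ.image fun x => {x}

/-- The children of the vertex `B`. -/
def ch (σ : Finset (Finset X)) (B : Finset X) : Finset (Finset X) :=
  (nodes σ).filter fun a => a ⊂ B ∧ ∀ C ∈ σ, a ⊂ C → B ⊆ C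

/-- All vertices but the root have two children, and the root has `k + 2` of them. -/
def IsType (k : ℕ) (σ : Finset (Finset X)) : Prop :=
  IsHier σ ∧ (∀ B ∈ σ, (ch σ B).card = 2) ∧ (ch σ Finset.univ).card = k + 2

theorem mem_nodes {σ : Finset (Finset X)} {a : Finset X} :
    a ∈ nodes σ ↔ a ∈ σ ∨ ∃ x, a = {x} := by
  simp [nodes, eq_comm]

theorem mem_ch {σ : Finset (Finset X)} {a B : Finset X} :
    a ∈ ch σ B ↔ a ∈ nodes σ ∧ a ⊂ B ∧ ∀ C ∈ σ, a ⊂ C → B ⊆ C := by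
  simp [ch]

theorem singleton_mem_nodes (σ : Finset (Finset X)) (x : X) : {x} ∈ nodes σ :=
  mem_nodes.2 (Or.inr ⟨x, rfl⟩)

namespace IsHier

variable {σ : Finset (Finset X)} (h : IsHier σ)
include h

theorem nodes_nonempty {a : Finset X} (ha : a ∈ nodes σ) : a.Nonempty := by
  rcases mem_nodes.1 ha with ha | ⟨x, rfl⟩
  · exact Finset.card_pos.1 (by have := (h.1 a ha).1; omega)
  · exact Finset.singleton_nonempty x

theorem singleton_notMem (x : X) : {x} ∉ σ := fun hx => by
  simpa using (h.1 _ hx).1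

theorem laminar_nodes {a b : Finset X} (ha : a ∈ nodes σ) (hb : b ∈ nodes σ) :
    a ⊆ b ∨ b ⊆ a ∨ Disjoint a b := by
  rcases mem_nodes.1 ha with ha | ⟨x, rfl⟩
  · rcases mem_nodes.1 hb with hb | ⟨y, rfl⟩
    · exact h.2 a ha b hb
    · by_cases hy : y ∈ a
      · exact Or.inr (Or.inl (by simpa using hy))
      · exact Or.inr (Or.inr (by simpa using hy))
  · by_cases hx : x ∈ b
    · exact Or.inl (by simpa using hx)
    · exact Or.inr (Or.inr (by simpa using hx))

theorem comparable {a b : Finset X} (ha : a ∈ insert Finset.univ (nodes σ))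
    (hb : b ∈ insert Finset.univ (nodes σ)) {x : X} (hxa : x ∈ a) (hxb : x ∈ b) :
    a ⊆ b ∨ b ⊆ a := by
  rcases Finset.mem_insert.1 ha with rfl | ha
  · exact Or.inr (Finset.subset_univ _)
  rcases Finset.mem_insert.1 hb with rfl | hb
  · exact Or.inl (Finset.subset_univ _)
  rcases h.laminar_nodes ha hb with h | h | h
  · exact Or.inl h
  · exact Or.inr h
  · exact absurd hxb (Finset.disjoint_left.1 h hxa)

omit h in
theorem vertex_mem {B : Finset X} (hB : B ∈ insert Finset.univ σ) :
    B ∈ insert Finset.univ (nodes σ) := by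
  rcases Finset.mem_insert.1 hB with rfl | hB
  · exact Finset.mem_insert_self _ _
  · exact Finset.mem_insert_of_mem (mem_nodes.2 (Or.inl hB))

theorem nodes_ne_univ [Nontrivial X] {a : Finset X} (ha : a ∈ nodes σ) : a ≠ Finset.univ := by
  rcases mem_nodes.1 ha with ha | ⟨x, rfl⟩
  · exact (h.1 a ha).2
  · intro hx
    have := congrArg Finset.card hx
    rw [Finset.card_singleton, Finset.card_univ] at this
    have := Fintype.one_lt_card (α := X)
    omega

theorem two_le_card [Nontrivial X] {B : Finset X} (hB : B ∈ insert Finset.univ σ) :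
    2 ≤ B.card := by
  rcases Finset.mem_insert.1 hB with rfl | hB
  · rw [Finset.card_univ]; exact Fintype.one_lt_card
  · exact (h.1 B hB).1

/-- The parent is a smallest vertex strictly containing `a`; laminarity puts it inside every other
such vertex. -/
theorem exists_parent [Nontrivial X] {a : Finset X} (ha : a ∈ nodes σ) :
    ∃ B ∈ insert Finset.univ σ, a ∈ ch σ B := by
  have hne : ((insert Finset.univ σ).filter fun B => a ⊂ B).Nonempty :=
    ⟨Finset.univ, by simp [Finset.ssubset_univ_iff, h.nodes_ne_univ ha]⟩
  obtain ⟨B, hB, hmin⟩ := Finset.exists_min_image _ Finset.card hne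
  rw [Finset.mem_filter] at hB
  refine ⟨B, hB.1, mem_ch.2 ⟨ha, hB.2, fun C hC haC => ?_⟩⟩
  obtain ⟨x, hx⟩ := h.nodes_nonempty ha
  have hCt : C ∈ insert Finset.univ σ := Finset.mem_insert_of_mem hC
  rcases h.comparable (vertex_mem hCt) (vertex_mem hB.1) (haC.1 hx) (hB.2.1 hx) with hCB | hBC
  · exact (Finset.eq_of_subset_of_card_le hCB
      (hmin C (Finset.mem_filter.2 ⟨hCt, haC⟩))).symm.subset
  · exact hBC

omit h in
theorem parent_subset {a B C : Finset X} (haB : a ∈ ch σ B) (hC : C ∈ insert Finset.univ σ)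
    (haC : a ⊂ C) : B ⊆ C := by
  rcases Finset.mem_insert.1 hC with rfl | hC
  · exact Finset.subset_univ _
  · exact (mem_ch.1 haB).2.2 C hC haC

omit h in
theorem parent_unique {a B B' : Finset X} (hB : B ∈ insert Finset.univ σ)
    (hB' : B' ∈ insert Finset.univ σ) (haB : a ∈ ch σ B) (haB' : a ∈ ch σ B') : B = B' :=
  (parent_subset haB hB' (mem_ch.1 haB').2.1).antisymm (parent_subset haB' hB (mem_ch.1 haB).2.1)

theorem disjoint_ch {a b B : Finset X} (ha : a ∈ ch σ B) (hb : b ∈ ch σ B) (hab : a ≠ b) :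
    Disjoint a b := by
  have key : ∀ a b, a ∈ ch σ B → b ∈ ch σ B → a ≠ b → a ⊆ b → False := by
    intro a b ha hb hab hsub
    rw [mem_ch] at ha hb
    have hss : a ⊂ b := hsub.ssubset_of_ne hab
    rcases mem_nodes.1 hb.1 with hbσ | ⟨x, rfl⟩
    · exact hb.2.1.2 (ha.2.2 b hbσ hss)
    · rw [Finset.ssubset_singleton_iff] at hss
      exact (h.nodes_nonempty ha.1).ne_empty hss
  rcases h.laminar_nodes (mem_ch.1 ha).1 (mem_ch.1 hb).1 with hs | hs | hs
  · exact (key a b ha hb hab hs).elim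
  · exact (key b a hb ha hab.symm hs).elim
  · exact hs

theorem exists_mem_ch [Nontrivial X] {B : Finset X} (hB : B ∈ insert Finset.univ σ) {x : X}
    (hx : x ∈ B) : ∃ a ∈ ch σ B, x ∈ a := by
  have hne : ((nodes σ).filter fun a => x ∈ a ∧ a ⊂ B).Nonempty := by
    refine ⟨{x}, Finset.mem_filter.2 ⟨singleton_mem_nodes σ x, Finset.mem_singleton_self x, ?_⟩⟩
    refine (Finset.singleton_subset_iff.2 hx).ssubset_of_ne fun he => ?_
    have := h.two_le_card hB
    rw [← he] at this
    simp at this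
  obtain ⟨a, ha, hmax⟩ := Finset.exists_max_image _ Finset.card hne
  rw [Finset.mem_filter] at ha
  refine ⟨a, mem_ch.2 ⟨ha.1, ha.2.2, fun C hC haC => ?_⟩, ha.2.1⟩
  have hCt : C ∈ insert Finset.univ σ := Finset.mem_insert_of_mem hC
  rcases h.comparable (vertex_mem hCt) (vertex_mem hB) (haC.1 ha.2.1) hx with hCB | hBC
  · by_cases he : C = B
    · exact he.symm.subset
    · have := hmax C (Finset.mem_filter.2 ⟨mem_nodes.2 (Or.inl hC), haC.1 ha.2.1,
        hCB.ssubset_of_ne he⟩)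
      exact absurd (Finset.card_lt_card haC) (by omega)
  · exact hBC

theorem biUnion_ch [Nontrivial X] {B : Finset X} (hB : B ∈ insert Finset.univ σ) :
    (ch σ B).biUnion id = B := by
  ext x
  simp only [Finset.mem_biUnion, id]
  constructor
  · rintro ⟨a, ha, hx⟩
    exact (mem_ch.1 ha).2.1.1 hx
  · exact fun hx => h.exists_mem_ch hB hx

theorem sum_ch [Nontrivial X] {G : Type*} [AddCommMonoid G] {B : Finset X}
    (hB : B ∈ insert Finset.univ σ) (f : X → G) :
    ∑ a ∈ ch σ B, ∑ x ∈ a, f x = ∑ x ∈ B, f x := by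
  conv_rhs => rw [← h.biUnion_ch hB]
  rw [Finset.sum_biUnion]
  · rfl
  · exact fun a ha b hb hab => h.disjoint_ch ha hb hab

/-- Each node has exactly one parent. This drives both the edge count and the telescoping in
Bézout's theorem. -/
theorem sum_nodes [Nontrivial X] {G : Type*} [AddCommMonoid G] (f : Finset X → G) :
    ∑ B ∈ insert Finset.univ σ, ∑ a ∈ ch σ B, f a = ∑ a ∈ nodes σ, f a := by
  rw [← Finset.sum_biUnion]
  · refine Finset.sum_congr ?_ fun _ _ => rfl
    ext a
    simp only [Finset.mem_biUnion]
    constructor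
    · rintro ⟨B, _, ha⟩
      exact (mem_ch.1 ha).1
    · exact fun ha => h.exists_parent ha
  · intro B hB B' hB' hne
    rw [Function.onFun, Finset.disjoint_left]
    exact fun a ha ha' => hne (parent_unique hB hB' ha ha')

theorem card_nodes : (nodes σ).card = σ.card + Fintype.card X := by
  rw [nodes, Finset.card_union_of_disjoint, Finset.card_image_of_injective, Finset.card_univ]
  · exact Finset.singleton_injective
  · rw [Finset.disjoint_right]
    intro a ha
    obtain ⟨x, -, rfl⟩ := Finset.mem_image.1 ha
    exact h.singleton_notMem x

omit h in
theorem subset {τ : Finset (Finset X)} (hσ : IsHier σ) (hτ : τ ⊆ σ) : IsHier τ :=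
  ⟨fun A hA => hσ.1 A (hτ hA), fun A hA B hB => hσ.2 A (hτ hA) B (hτ hB)⟩

omit h in
theorem univ_notMem (hσ : IsHier σ) : Finset.univ ∉ σ := fun hu => (hσ.1 _ hu).2 rfl

theorem two_le_card_ch [Nontrivial X] {B : Finset X} (hB : B ∈ insert Finset.univ σ) :
    2 ≤ (ch σ B).card := by
  have hc := h.two_le_card hB
  obtain ⟨x, hx⟩ : B.Nonempty := Finset.card_pos.1 (by omega)
  obtain ⟨a, ha, hxa⟩ := h.exists_mem_ch hB hx
  obtain ⟨y, hy, hya⟩ := Finset.exists_of_ssubset (mem_ch.1 ha).2.1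
  obtain ⟨b, hb, hyb⟩ := h.exists_mem_ch hB hy
  exact Finset.one_lt_card.2 ⟨a, ha, b, hb, fun he => hya (he ▸ hyb)⟩

end IsHier

/-- Counting the nodes by their parents gives `k + 2 + 2 * σ.card` on one side and `σ.card + card X`
on the other. All dimension counts below rest on this. -/
theorem IsType.card_eq [Nontrivial X] {k : ℕ} {σ : Finset (Finset X)} (h : IsType k σ) :
    σ.card + k + 2 = Fintype.card X := by
  have h1 := h.1.sum_nodes fun _ => 1
  simp only [Finset.sum_const, smul_eq_mul, mul_one] at h1
  rw [Finset.sum_insert h.1.univ_notMem, h.2.2, Finset.sum_congr rfl h.2.1, h.1.card_nodes] at h1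
  simp at h1
  omega

section Erase

variable {σ : Finset (Finset X)} {A P : Finset X}

theorem nodes_erase (hA : A ∈ σ) : nodes σ = insert A (nodes (σ.erase A)) := by
  ext a
  simp only [mem_nodes, Finset.mem_insert, Finset.mem_erase]
  by_cases ha : a = A
  · simp [ha, hA]
  · simp [ha]

theorem notMem_nodes_erase (h : IsHier σ) (hA : A ∈ σ) : A ∉ nodes (σ.erase A) := by
  rw [mem_nodes]
  rintro (hA' | ⟨x, rfl⟩)
  · exact Finset.notMem_erase _ _ hA'
  · exact h.singleton_notMem x hA

theorem mem_ch_iff_erase (h : IsHier σ) (hA : A ∈ σ) {C a : Finset X} :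
    a ∈ ch σ C ↔ (a = A ∧ A ∈ ch σ C) ∨ (a ∈ ch (σ.erase A) C ∧ (a ⊂ A → C ⊆ A)) := by
  by_cases ha : a = A
  · subst ha
    simp [mem_ch, notMem_nodes_erase h hA]
  · simp only [mem_ch, nodes_erase hA, Finset.mem_insert, ha, false_or, false_and,
      Finset.mem_erase, and_assoc]
    refine and_congr_right fun _ => and_congr_right fun _ => ?_
    constructor
    · exact fun H => ⟨fun D hD => H D hD.2, H A hA⟩
    · rintro ⟨H1, H2⟩ D hD
      by_cases hDA : D = A
      · subst hDA; exact H2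
      · exact H1 D ⟨hDA, hD⟩

theorem ch_erase_of_ne (h : IsHier σ) (hA : A ∈ σ) (hP : P ∈ insert Finset.univ σ)
    (hAP : A ∈ ch σ P) {C : Finset X} (hC : C ∈ insert Finset.univ (σ.erase A)) (hCP : C ≠ P) :
    ch (σ.erase A) C = ch σ C := by
  have hCσ : C ∈ insert Finset.univ σ := by
    rw [Finset.mem_insert, Finset.mem_erase] at hC
    rw [Finset.mem_insert]; tauto
  have hACch : A ∉ ch σ C := fun hh => hCP (IsHier.parent_unique hCσ hP hh hAP)
  ext a
  rw [mem_ch_iff_erase h hA (C := C)]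
  simp only [hACch, and_false, false_or]
  refine ⟨fun ha => ⟨ha, fun haA => ?_⟩, fun ha => ha.1⟩
  by_contra hCA
  have ha' := mem_ch.1 ha
  have hnode : a ∈ nodes σ := by rw [nodes_erase hA]; exact Finset.mem_insert_of_mem ha'.1
  obtain ⟨x, hx⟩ := h.nodes_nonempty hnode
  have hAC : A ⊆ C := by
    rcases h.comparable (IsHier.vertex_mem hCσ) (IsHier.vertex_mem (Finset.mem_insert_of_mem hA))
      (ha'.2.1.1 hx) (haA.1 hx) with h1 | h1
    exacts [absurd h1 hCA, h1]
  refine hACch (mem_ch.2 ⟨mem_nodes.2 (Or.inl hA), ⟨hAC, hCA⟩, fun D hD hAD => ?_⟩)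
  exact ha'.2.2 D (Finset.mem_erase.2 ⟨fun e => by subst e; exact hAD.2 hAD.1, hD⟩) (haA.trans hAD)

/-- Removing `A` contracts the edge below it, so the parent inherits its children. -/
theorem ch_erase_parent (h : IsHier σ) (hA : A ∈ σ) (hAP : A ∈ ch σ P) :
    ch (σ.erase A) P = (ch σ P).erase A ∪ ch σ A := by
  ext a
  rw [Finset.mem_union, Finset.mem_erase, mem_ch_iff_erase h hA (C := P),
    mem_ch_iff_erase h hA (C := A)]
  have hA' := mem_ch.1 hAP
  have hAA : A ∉ ch σ A := fun hh => (mem_ch.1 hh).2.1.2 subset_rfl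
  have hPA : ¬ P ⊆ A := hA'.2.1.2
  simp only [hAA, and_false, false_or, subset_rfl, implies_true, and_true, hPA]
  by_cases haA : a ⊂ A
  · simp only [haA, true_imp_iff, and_false, or_false]
    constructor
    · intro ha
      refine Or.inr (mem_ch.2 ⟨(mem_ch.1 ha).1, haA, fun D hD haD => ?_⟩)
      exact hA'.2.1.1.trans ((mem_ch.1 ha).2.2 D hD haD)
    · rintro (⟨hne, he, -⟩ | ha)
      · exact absurd he hne
      · refine mem_ch.2 ⟨(mem_ch.1 ha).1, haA.trans hA'.2.1, fun D hD haD => ?_⟩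
        refine hA'.2.2 D (Finset.mem_of_mem_erase hD)
          (((mem_ch.1 ha).2.2 D hD haD).ssubset_of_ne (Finset.ne_of_mem_erase hD).symm)
  · have h1 : a ∉ ch (σ.erase A) A := fun hh => haA (mem_ch.1 hh).2.1
    simp only [haA, h1, or_false, false_imp_iff, and_true]
    constructor
    · intro ha
      exact ⟨fun e => notMem_nodes_erase h hA (e ▸ (mem_ch.1 ha).1), Or.inr ha⟩
    · rintro ⟨hne, he | he⟩
      · exact absurd he.1 hne
      · exact he

theorem disjoint_ch_erase (hAσ : A ∈ σ) (hA : A ∈ ch σ P) :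
    Disjoint ((ch σ P).erase A) (ch σ A) := by
  rw [Finset.disjoint_right]
  intro a haA haP
  exact (mem_ch.1 hA).2.1.2
    ((mem_ch.1 (Finset.mem_of_mem_erase haP)).2.2 A hAσ (mem_ch.1 haA).2.1)

end Erase

end Hierarchy

/-! ### Resolutions of a vertex and balancing of the fan of trees. -/

section Hierarchy

variable {X : Type*} [Fintype X] [DecidableEq X]

section Join

variable {τ : Finset (Finset X)} {a b P : Finset X}

/-- A third child is nonempty and disjoint from `a` and `b`, so the join leaves out a part of `P`.
-/
theorem join_ssubset (h : IsHier τ) (ha : a ∈ ch τ P) (hb : b ∈ ch τ P)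
    (h3 : 3 ≤ (ch τ P).card) : a ∪ b ⊂ P := by
  have hab : ({a, b} : Finset (Finset X)).card ≤ 2 := Finset.card_le_two
  obtain ⟨c, hc, hcab⟩ := Finset.exists_mem_notMem_of_card_lt_card (lt_of_le_of_lt hab h3)
  simp only [Finset.mem_insert, Finset.mem_singleton, not_or] at hcab
  obtain ⟨x, hx⟩ := h.nodes_nonempty (mem_ch.1 hc).1
  refine ⟨Finset.union_subset (mem_ch.1 ha).2.1.1 (mem_ch.1 hb).2.1.1, fun hP => ?_⟩
  rcases Finset.mem_union.1 (hP ((mem_ch.1 hc).2.1.1 hx)) with h1 | h1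
  · exact Finset.disjoint_left.1 (h.disjoint_ch hc ha hcab.1) hx h1
  · exact Finset.disjoint_left.1 (h.disjoint_ch hc hb hcab.2) hx h1

theorem ssubset_join (h : IsHier τ) (ha : a ∈ ch τ P) (hb : b ∈ ch τ P) (hab : a ≠ b) :
    a ⊂ a ∪ b := by
  obtain ⟨x, hx⟩ := h.nodes_nonempty (mem_ch.1 hb).1
  exact ⟨Finset.subset_union_left, fun hs => Finset.disjoint_left.1 (h.disjoint_ch ha hb hab)
    (hs (Finset.mem_union_right _ hx)) hx⟩

theorem join_notMem (h : IsHier τ) (ha : a ∈ ch τ P) (hb : b ∈ ch τ P)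
    (h3 : 3 ≤ (ch τ P).card) (hab : a ≠ b) : a ∪ b ∉ τ := fun hmem =>
  (join_ssubset h ha hb h3).2 ((mem_ch.1 ha).2.2 _ hmem (ssubset_join h ha hb hab))

theorem isHier_insert_join (h : IsHier τ) (ha : a ∈ ch τ P) (hb : b ∈ ch τ P)
    (h3 : 3 ≤ (ch τ P).card) (hab : a ≠ b) : IsHier (insert (a ∪ b) τ) := by
  have key : ∀ C ∈ τ, C ⊆ a ∪ b ∨ a ∪ b ⊆ C ∨ Disjoint C (a ∪ b) := by
    intro C hC
    have key' : ∀ c ∈ ch τ P, C ⊆ c ∨ P ⊆ C ∨ Disjoint C c := by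
      intro c hc
      rcases h.laminar_nodes (mem_nodes.2 (Or.inl hC)) (mem_ch.1 hc).1 with h1 | h1 | h1
      · exact Or.inl h1
      · by_cases he : c = C
        · exact Or.inl he.symm.subset
        · exact Or.inr (Or.inl ((mem_ch.1 hc).2.2 C hC (h1.ssubset_of_ne he)))
      · exact Or.inr (Or.inr h1)
    have hP := (join_ssubset h ha hb h3).1
    rcases key' a ha with h1 | h1 | h1
    · exact Or.inl (h1.trans Finset.subset_union_left)
    · exact Or.inr (Or.inl (hP.trans h1))
    rcases key' b hb with h2 | h2 | h2
    · exact Or.inl (h2.trans Finset.subset_union_right)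
    · exact Or.inr (Or.inl (hP.trans h2))
    · exact Or.inr (Or.inr (Finset.disjoint_union_right.2 ⟨h1, h2⟩))
  constructor
  · intro A hA
    rcases Finset.mem_insert.1 hA with rfl | hA
    · constructor
      · obtain ⟨x, hx⟩ := h.nodes_nonempty (mem_ch.1 ha).1
        obtain ⟨y, hy, hya⟩ := Finset.exists_of_ssubset (ssubset_join h ha hb hab)
        exact Finset.one_lt_card.2 ⟨x, Finset.mem_union_left _ hx, y, hy, fun e => hya (e ▸ hx)⟩
      · intro hu
        exact (join_ssubset h ha hb h3).2 (hu ▸ Finset.subset_univ _)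
    · exact h.1 A hA
  · intro A hA B hB
    rcases Finset.mem_insert.1 hA with rfl | hA
    · rcases Finset.mem_insert.1 hB with rfl | hB
      · exact Or.inl subset_rfl
      · rcases key B hB with h1 | h1 | h1
        exacts [Or.inr (Or.inl h1), Or.inl h1, Or.inr (Or.inr h1.symm)]
    · rcases Finset.mem_insert.1 hB with rfl | hB
      · exact key A hA
      · exact h.2 A hA B hB

theorem mem_ch_join (h : IsHier τ) (ha : a ∈ ch τ P) (hb : b ∈ ch τ P) (hab : a ≠ b) :
    a ∈ ch (insert (a ∪ b) τ) (a ∪ b) := by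
  have ha' := mem_ch.1 ha
  refine mem_ch.2 ⟨?_, ssubset_join h ha hb hab, fun C hC haC => ?_⟩
  · rcases mem_nodes.1 ha'.1 with h1 | h1
    · exact mem_nodes.2 (Or.inl (Finset.mem_insert_of_mem h1))
    · exact mem_nodes.2 (Or.inr h1)
  · rcases Finset.mem_insert.1 hC with rfl | hC
    · exact subset_rfl
    · exact (Finset.union_subset ha'.2.1.1 (mem_ch.1 hb).2.1.1).trans (ha'.2.2 C hC haC)

theorem ch_join (h : IsHier τ) (ha : a ∈ ch τ P) (hb : b ∈ ch τ P)
    (h3 : 3 ≤ (ch τ P).card) (hab : a ≠ b) : ch (insert (a ∪ b) τ) (a ∪ b) = {a, b} := by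
  have h' := isHier_insert_join h ha hb h3 hab
  have ha1 := mem_ch_join h ha hb hab
  have hb1 : b ∈ ch (insert (a ∪ b) τ) (a ∪ b) := by
    rw [Finset.union_comm]; exact mem_ch_join h hb ha hab.symm
  ext c
  simp only [Finset.mem_insert, Finset.mem_singleton]
  constructor
  · intro hc
    by_contra! hne
    obtain ⟨x, hx⟩ := h'.nodes_nonempty (mem_ch.1 hc).1
    rcases Finset.mem_union.1 ((mem_ch.1 hc).2.1.1 hx) with h1 | h1
    · exact Finset.disjoint_left.1 (h'.disjoint_ch hc ha1 hne.1) hx h1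
    · exact Finset.disjoint_left.1 (h'.disjoint_ch hc hb1 hne.2) hx h1
  · rintro (rfl | rfl)
    exacts [ha1, hb1]

theorem join_mem_ch (h : IsHier τ) (ha : a ∈ ch τ P) (hb : b ∈ ch τ P)
    (h3 : 3 ≤ (ch τ P).card) (hab : a ≠ b) : a ∪ b ∈ ch (insert (a ∪ b) τ) P := by
  refine mem_ch.2 ⟨mem_nodes.2 (Or.inl (Finset.mem_insert_self _ _)), join_ssubset h ha hb h3,
    fun C hC hCa => ?_⟩
  rcases Finset.mem_insert.1 hC with rfl | hC
  · exact absurd subset_rfl hCa.2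
  · exact (mem_ch.1 ha).2.2 C hC ((ssubset_join h ha hb hab).trans hCa)

/-- The number of children of the vertex `B` in a tree of type `k`. -/
def req (k : ℕ) (B : Finset X) : ℕ := if B = Finset.univ then k + 2 else 2

theorem isType_iff {k : ℕ} {σ : Finset (Finset X)} :
    IsType k σ ↔ IsHier σ ∧ ∀ B ∈ insert Finset.univ σ, (ch σ B).card = req k B := by
  refine and_congr_right fun h => ?_
  rw [Finset.forall_mem_insert, and_comm]
  refine and_congr (by simp [req]) (forall₂_congr fun B hB => ?_)
  rw [req, if_neg (h.1 B hB).2]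

theorem two_le_req (k : ℕ) (B : Finset X) : 2 ≤ req k B := by
  unfold req; split_ifs <;> omega

theorem card_ch_join (h : IsHier τ) (ha : a ∈ ch τ P) (hb : b ∈ ch τ P)
    (h3 : 3 ≤ (ch τ P).card) (hab : a ≠ b) :
    (ch (insert (a ∪ b) τ) P).card + 1 = (ch τ P).card := by
  have h' := isHier_insert_join h ha hb h3 hab
  have hm : a ∪ b ∈ insert (a ∪ b) τ := Finset.mem_insert_self _ _
  have hP := join_mem_ch h ha hb h3 hab
  have h1 := ch_erase_parent h' hm hP
  rw [Finset.erase_insert (join_notMem h ha hb h3 hab)] at h1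
  rw [h1, Finset.card_union_of_disjoint (disjoint_ch_erase hm hP), Finset.card_erase_of_mem hP,
    ch_join h ha hb h3 hab, Finset.card_pair hab]
  have : 0 < (ch (insert (a ∪ b) τ) P).card := Finset.card_pos.2 ⟨_, hP⟩
  omega

theorem ch_insert_join_of_ne (h : IsHier τ) (hP : P ∈ insert Finset.univ τ) (ha : a ∈ ch τ P)
    (hb : b ∈ ch τ P) (h3 : 3 ≤ (ch τ P).card) (hab : a ≠ b) {C : Finset X}
    (hC : C ∈ insert Finset.univ τ) (hCP : C ≠ P) : ch (insert (a ∪ b) τ) C = ch τ C := by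
  have h1 := ch_erase_of_ne (isHier_insert_join h ha hb h3 hab) (Finset.mem_insert_self _ _)
    (Finset.insert_subset_insert _ (Finset.subset_insert _ _) hP)
    (join_mem_ch h ha hb h3 hab) (C := C)
  rw [Finset.erase_insert (join_notMem h ha hb h3 hab)] at h1
  exact (h1 hC hCP).symm

/-- Joining two children of the only vertex which has one child too much. -/
theorem isType_insert_join {k : ℕ} (h : IsHier τ) (hP : P ∈ insert Finset.univ τ)
    (hcP : (ch τ P).card = req k P + 1)
    (hc : ∀ C ∈ insert Finset.univ τ, C ≠ P → (ch τ C).card = req k C)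
    (ha : a ∈ ch τ P) (hb : b ∈ ch τ P) (hab : a ≠ b) : IsType k (insert (a ∪ b) τ) := by
  have h3 : 3 ≤ (ch τ P).card := by have := two_le_req k P; omega
  refine isType_iff.2 ⟨isHier_insert_join h ha hb h3 hab, fun C hC => ?_⟩
  rw [Finset.insert_comm, Finset.mem_insert] at hC
  rcases hC with rfl | hC
  · rw [ch_join h ha hb h3 hab, Finset.card_pair hab, req, if_neg]
    exact fun hu => (join_ssubset h ha hb h3).2 (hu ▸ Finset.subset_univ _)
  · by_cases hCP : C = P
    · subst hCP
      have := card_ch_join h ha hb h3 hab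
      omega
    · rw [ch_insert_join_of_ne h hP ha hb h3 hab hC hCP, hc C hC hCP]

end Join

/-- Removing a vertex `A` other than the root from a tree of type `k`. -/
theorem IsType.erase [Nontrivial X] {k : ℕ} {σ : Finset (Finset X)} (h : IsType k σ)
    {A P : Finset X} (hA : A ∈ σ) (hP : P ∈ insert Finset.univ σ) (hAP : A ∈ ch σ P) :
    IsHier (σ.erase A) ∧ P ∈ insert Finset.univ (σ.erase A) ∧
    (ch (σ.erase A) P).card = req k P + 1 ∧
    (∀ C ∈ insert Finset.univ (σ.erase A), C ≠ P → (ch (σ.erase A) C).card = req k C) ∧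
    ∃ a ∈ ch (σ.erase A) P, ∃ b ∈ ch (σ.erase A) P, a ≠ b ∧ A = a ∪ b ∧ ch σ A = {a, b} := by
  have h' := isType_iff.1 h
  have hsub : ∀ C ∈ insert Finset.univ (σ.erase A), C ∈ insert Finset.univ σ := fun C hC =>
    Finset.insert_subset_insert _ (Finset.erase_subset _ _) hC
  refine ⟨h.1.subset (Finset.erase_subset _ _), ?_, ?_, ?_, ?_⟩
  · rw [Finset.mem_insert, Finset.mem_erase]
    rw [Finset.mem_insert] at hP
    exact hP.imp id fun hp => ⟨fun e => (mem_ch.1 hAP).2.1.2 e.subset, hp⟩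
  · rw [ch_erase_parent h.1 hA hAP, Finset.card_union_of_disjoint (disjoint_ch_erase hA hAP),
      Finset.card_erase_of_mem hAP, h'.2 P hP, h.2.1 A hA]
    have := two_le_req k P
    omega
  · intro C hC hCP
    rw [ch_erase_of_ne h.1 hA hP hAP hC hCP, h'.2 C (hsub C hC)]
  · obtain ⟨a, b, hab, he⟩ := Finset.card_eq_two.1 (h.2.1 A hA)
    rw [ch_erase_parent h.1 hA hAP]
    refine ⟨a, Finset.mem_union_right _ (by simp [he]), b,
      Finset.mem_union_right _ (by simp [he]), hab, ?_, he⟩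
    have := h.1.biUnion_ch (Finset.mem_insert_of_mem hA)
    rw [he] at this
    simpa using this.symm

/-- Polarization: on disjoint sets the quadratic expression fails to be additive by the mixed terms
only. -/
theorem sum_union_quadratic {G : Type*} [AddCommGroup G] (β : X → X → G) {a b : Finset X}
    (hab : Disjoint a b) :
    ∑ x ∈ a ∪ b, ∑ y ∈ a ∪ b, β x y = (∑ x ∈ a, ∑ y ∈ a, β x y) + (∑ x ∈ b, ∑ y ∈ b, β x y) +
      ((∑ x ∈ a, ∑ y ∈ b, β x y) + ∑ x ∈ b, ∑ y ∈ a, β x y) := by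
  rw [Finset.sum_union hab]
  simp only [Finset.sum_union hab, Finset.sum_add_distrib]
  abel

/-- The fan of trees of type `k` is balanced, in every realization which is given by a bilinear
form. -/
theorem sum_resolutions_eq_zero [Nontrivial X] (k : ℕ) (β : X → X → ℝ)
    (hdiag : ∀ x, β x x = 0) (htot : ∑ x, ∑ y, β x y = 0) (τ : Finset (Finset X))
    (hτ : ∀ A ∈ τ, ∑ x ∈ A, ∑ y ∈ A, β x y = 0) (R : Finset (Finset X))
    (hR : ∀ A, A ∈ R ↔ A ∉ τ ∧ IsType k (insert A τ)) :
    ∑ A ∈ R, ∑ x ∈ A, ∑ y ∈ A, β x y = 0 := by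
  rcases R.eq_empty_or_nonempty with rfl | ⟨A₀, hA₀⟩
  · simp
  obtain ⟨hA₀τ, hA₀t⟩ := (hR A₀).1 hA₀
  have hmem : A₀ ∈ insert A₀ τ := Finset.mem_insert_self _ _
  -- A single resolution locates the vertex `P` of `τ` that has one child too many; all other
  -- vertices of `τ` already have the right number.
  obtain ⟨P, hP, hAP⟩ := hA₀t.1.exists_parent (mem_nodes.2 (Or.inl hmem))
  obtain ⟨h, hPτ, hcP, hc, -⟩ := hA₀t.erase hmem hP hAP
  rw [Finset.erase_insert hA₀τ] at h hPτ hcP hc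
  -- Every resolution has to split this same `P`, so the resolutions are exactly the joins of two of
  -- its children.
  have hRimg : ∀ A, A ∈ R ↔ ∃ a ∈ ch τ P, ∃ b ∈ ch τ P, a ≠ b ∧ A = a ∪ b := by
    intro A
    rw [hR]
    constructor
    · rintro ⟨hAτ, hAt⟩
      have hm : A ∈ insert A τ := Finset.mem_insert_self _ _
      obtain ⟨P', hP', hAP'⟩ := hAt.1.exists_parent (mem_nodes.2 (Or.inl hm))
      obtain ⟨-, hP'τ, hcP', -, a, ha, b, hb, hab, hAe, -⟩ := hAt.erase hm hP' hAP'
      rw [Finset.erase_insert hAτ] at hP'τ hcP' ha hb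
      have : P' = P := by
        by_contra hne
        have := hc P' hP'τ hne
        omega
      subst this
      exact ⟨a, ha, b, hb, hab, hAe⟩
    · rintro ⟨a, ha, b, hb, hab, rfl⟩
      exact ⟨join_notMem h ha hb (by have := two_le_req k P; omega) hab,
        isType_insert_join h hPτ hcP hc ha hb hab⟩
  set U : Finset X → ℝ := fun A => ∑ x ∈ A, ∑ y ∈ A, β x y with hU
  set V : Finset X → Finset X → ℝ := fun a b => ∑ x ∈ a, ∑ y ∈ b, β x y with hV
  have hU0 : ∀ a ∈ ch τ P, U a = 0 := by
    intro a ha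
    rcases mem_nodes.1 (mem_ch.1 ha).1 with h1 | ⟨x, rfl⟩
    · exact hτ a h1
    · simp [hU, hdiag]
  have hUP : U P = 0 := by
    rcases Finset.mem_insert.1 hPτ with rfl | h1
    · exact htot
    · exact hτ P h1
  -- The children partition `P`, so all mixed terms together with the diagonal ones sum to `U P`;
  -- both `U P` and the diagonal terms vanish.
  have hoff : ∑ p ∈ (ch τ P).offDiag, V p.1 p.2 = 0 := by
    have h1 : ∑ a ∈ ch τ P, ∑ b ∈ ch τ P, V a b = U P := by
      have e1 : ∀ a ∈ ch τ P, ∑ b ∈ ch τ P, V a b = ∑ x ∈ a, ∑ y ∈ P, β x y := by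
        intro a _
        simp only [hV]
        rw [Finset.sum_comm]
        exact Finset.sum_congr rfl fun x _ => h.sum_ch hPτ _
      rw [Finset.sum_congr rfl e1, h.sum_ch hPτ]
    rw [← Finset.sum_product', ← Finset.diag_union_offDiag,
      Finset.sum_union (Finset.disjoint_diag_offDiag _), Finset.sum_diag, hUP] at h1
    have h2 : ∑ a ∈ ch τ P, V a a = 0 := Finset.sum_eq_zero hU0
    linarith
  have hdouble : ∑ p ∈ (ch τ P).offDiag, U (p.1 ∪ p.2) = 0 := by
    have e1 : ∀ p ∈ (ch τ P).offDiag, U (p.1 ∪ p.2) = V p.1 p.2 + V p.2 p.1 := by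
      rintro ⟨a, b⟩ hp
      obtain ⟨ha, hb, hab⟩ := Finset.mem_offDiag.1 hp
      have e2 := sum_union_quadratic β (h.disjoint_ch ha hb hab)
      have e3 := hU0 a ha
      have e4 := hU0 b hb
      simp only [hU, hV] at e2 e3 e4 ⊢
      rw [e2, e3, e4]; ring
    rw [Finset.sum_congr rfl e1, Finset.sum_add_distrib, hoff, zero_add, ← hoff]
    refine Finset.sum_bij' (fun p _ => p.swap) (fun p _ => p.swap) ?_ ?_ ?_ ?_ ?_ <;>
      simp +contextual [eq_comm]
  -- A join determines its two children, so it comes from exactly two ordered pairs.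
  have hfib : ∑ p ∈ (ch τ P).offDiag, U (p.1 ∪ p.2) = ∑ A ∈ R, (2 : ℕ) • U A := by
    rw [← Finset.sum_fiberwise_of_maps_to (g := fun p => p.1 ∪ p.2) (t := R)]
    · refine Finset.sum_congr rfl fun A hA => ?_
      obtain ⟨a, ha, b, hb, hab, rfl⟩ := (hRimg A).1 hA
      have e1 : (ch τ P).offDiag.filter (fun p => p.1 ∪ p.2 = a ∪ b) = {(a, b), (b, a)} := by
        have sub : ∀ c ∈ ch τ P, c ⊆ a ∪ b → c = a ∨ c = b := by
          intro c hc hcab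
          by_contra! hne
          obtain ⟨x, hx⟩ := h.nodes_nonempty (mem_ch.1 hc).1
          rcases Finset.mem_union.1 (hcab hx) with h1 | h1
          · exact Finset.disjoint_left.1 (h.disjoint_ch hc ha hne.1) hx h1
          · exact Finset.disjoint_left.1 (h.disjoint_ch hc hb hne.2) hx h1
        ext ⟨c, d⟩
        simp only [Finset.mem_filter, Finset.mem_offDiag, Finset.mem_insert, Finset.mem_singleton,
          Prod.mk.injEq]
        constructor
        · rintro ⟨⟨hc, hd, hcd⟩, he⟩
          rcases sub c hc (he ▸ Finset.subset_union_left) with rfl | rfl <;>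
            rcases sub d hd (he ▸ Finset.subset_union_right) with rfl | rfl <;> simp_all
        · rintro (⟨rfl, rfl⟩ | ⟨rfl, rfl⟩)
          · exact ⟨⟨ha, hb, hab⟩, rfl⟩
          · exact ⟨⟨hb, ha, hab.symm⟩, Finset.union_comm _ _⟩
      rw [e1, Finset.sum_pair (by simp [hab]), Finset.union_comm b a, two_smul]
    · rintro ⟨a, b⟩ hp
      obtain ⟨ha, hb, hab⟩ := Finset.mem_offDiag.1 hp
      exact (hRimg _).2 ⟨a, ha, b, hb, hab, rfl⟩
  rw [hfib, ← Finset.smul_sum] at hdouble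
  simpa using hdouble

end Hierarchy

/-! ### Attaching, grafting and forgetting a leaf of a tree. -/

section Forget

variable {X : Type*} [Fintype X] [DecidableEq X]

/-- The set of leaves above the vertex `A`, when a further leaf is attached to the vertex `P`. -/
def plus (P A : Finset X) : Finset (Option X) :=
  if P ⊆ A then Finset.insertNone A else A.map Function.Embedding.some

/-- The tree with a further leaf attached to the vertex `P`. -/
def att (σ : Finset (Finset X)) (P : Finset X) : Finset (Finset (Option X)) := σ.image (plus P)

theorem some_mem_plus {P A : Finset X} {x : X} : some x ∈ plus P A ↔ x ∈ A := by
  unfold plus; split_ifs <;> simp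

theorem none_mem_plus {P A : Finset X} : none ∈ plus P A ↔ P ⊆ A := by
  unfold plus; split_ifs with h <;> simp [h]

theorem plus_subset_plus {P A B : Finset X} : plus P A ⊆ plus P B ↔ A ⊆ B := by
  constructor
  · intro h x hx
    exact some_mem_plus.1 (h (some_mem_plus.2 hx))
  · rintro h (_ | x) hx
    · exact none_mem_plus.2 ((none_mem_plus.1 hx).trans h)
    · exact some_mem_plus.2 (h (some_mem_plus.1 hx))

theorem plus_ssubset_plus {P A B : Finset X} : plus P A ⊂ plus P B ↔ A ⊂ B := by
  simp only [Finset.ssubset_def, plus_subset_plus]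

theorem plus_injective (P : Finset X) : Function.Injective (plus P) := fun _ _ h =>
  (plus_subset_plus.1 h.subset).antisymm (plus_subset_plus.1 h.symm.subset)

theorem plus_univ (P : Finset X) : plus P Finset.univ = Finset.univ := by
  ext (_ | x)
  · simp [none_mem_plus]
  · simp [some_mem_plus]

theorem plus_eq_univ_iff {P A : Finset X} : plus P A = Finset.univ ↔ A = Finset.univ := by
  rw [← plus_univ P, (plus_injective P).eq_iff]

theorem plus_singleton {P : Finset X} (hP : 2 ≤ P.card) (x : X) : plus P {x} = {some x} := by
  rw [plus, if_neg]
  · simp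
  · intro h
    have := Finset.card_le_card h
    simp at this
    omega

theorem plus_ne_singleton_none {P A : Finset X} (hA : A.Nonempty) : plus P A ≠ {none} := by
  obtain ⟨x, hx⟩ := hA
  intro h
  have : some x ∈ plus P A := some_mem_plus.2 hx
  simp [h] at this

theorem singleton_none_ssubset_plus {P A : Finset X} (hA : A.Nonempty) :
    {none} ⊂ plus P A ↔ P ⊆ A := by
  constructor
  · intro h
    exact none_mem_plus.1 (h.1 (Finset.mem_singleton_self _))
  · intro h
    exact (Finset.singleton_subset_iff.2 (none_mem_plus.2 h)).ssubset_of_ne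
      (plus_ne_singleton_none hA).symm

theorem nodes_att {σ : Finset (Finset X)} {P : Finset X} (hP : 2 ≤ P.card) :
    nodes (att σ P) = insert {none} ((nodes σ).image (plus P)) := by
  ext a
  simp only [mem_nodes, att, Finset.mem_insert, Finset.mem_image]
  constructor
  · rintro (⟨A, hA, rfl⟩ | ⟨_ | x, rfl⟩)
    · exact Or.inr ⟨A, Or.inl hA, rfl⟩
    · exact Or.inl rfl
    · exact Or.inr ⟨{x}, Or.inr ⟨x, rfl⟩, plus_singleton hP x⟩
  · rintro (rfl | ⟨A, hA | ⟨x, rfl⟩, rfl⟩)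
    · exact Or.inr ⟨none, rfl⟩
    · exact Or.inl ⟨A, hA, rfl⟩
    · exact Or.inr ⟨some x, plus_singleton hP x⟩

variable {σ : Finset (Finset X)} {P : Finset X}

theorem IsHier.att [Nontrivial X] (h : IsHier σ) (hP : P ∈ insert Finset.univ σ) :
    IsHier (att σ P) := by
  obtain ⟨p, hp⟩ : P.Nonempty := Finset.card_pos.1 (by have := h.two_le_card hP; omega)
  constructor
  · intro A' hA'
    obtain ⟨A, hA, rfl⟩ := Finset.mem_image.1 hA'
    refine ⟨?_, fun hu => (h.1 A hA).2 (plus_eq_univ_iff.1 hu)⟩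
    calc 2 ≤ A.card := (h.1 A hA).1
      _ = (A.map Function.Embedding.some).card := (Finset.card_map _).symm
      _ ≤ _ := Finset.card_le_card (by
        intro o ho
        obtain ⟨x, hx, rfl⟩ := Finset.mem_map.1 ho
        exact some_mem_plus.2 hx)
  · intro A' hA' B' hB'
    obtain ⟨A, hA, rfl⟩ := Finset.mem_image.1 hA'
    obtain ⟨B, hB, rfl⟩ := Finset.mem_image.1 hB'
    rw [plus_subset_plus, plus_subset_plus]
    refine (h.2 A hA B hB).imp id (Or.imp id fun hd => ?_)
    rw [Finset.disjoint_left] at hd ⊢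
    rintro (_ | x) h1 h2
    · exact hd (none_mem_plus.1 h1 hp) (none_mem_plus.1 h2 hp)
    · exact hd (some_mem_plus.1 h1) (some_mem_plus.1 h2)

theorem mem_ch_att [Nontrivial X] (h : IsHier σ) (hP : P ∈ insert Finset.univ σ) {B : Finset X}
    (hB : B ∈ insert Finset.univ σ) {a : Finset (Option X)} :
    a ∈ ch (att σ P) (plus P B) ↔ (a = {none} ∧ B = P) ∨ ∃ b ∈ ch σ B, a = plus P b := by
  have hne : ∀ C ∈ insert Finset.univ σ, C.Nonempty := fun C hC =>
    Finset.card_pos.1 (by have := h.two_le_card hC; omega)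
  have h1 : {none} ∈ ch (att σ P) (plus P B) ↔ B = P := by
    rw [mem_ch, nodes_att (h.two_le_card hP), singleton_none_ssubset_plus (hne B hB)]
    constructor
    · rintro ⟨-, hPB, hC⟩
      refine subset_antisymm ?_ hPB
      rcases Finset.mem_insert.1 hP with rfl | hP'
      · exact Finset.subset_univ _
      · exact plus_subset_plus.1 (hC _ (Finset.mem_image_of_mem _ hP')
          ((singleton_none_ssubset_plus (hne P hP)).2 subset_rfl))
    · rintro rfl
      refine ⟨Finset.mem_insert_self _ _, subset_rfl, fun C' hC' hs => ?_⟩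
      obtain ⟨C, hC, rfl⟩ := Finset.mem_image.1 hC'
      exact plus_subset_plus.2 ((singleton_none_ssubset_plus
        (hne C (Finset.mem_insert_of_mem hC))).1 hs)
  have h2 : ∀ b, b ∈ nodes σ → (plus P b ∈ ch (att σ P) (plus P B) ↔ b ∈ ch σ B) := by
    intro b hb
    rw [mem_ch, mem_ch, nodes_att (h.two_le_card hP), plus_ssubset_plus]
    refine and_congr (iff_of_true (Finset.mem_insert_of_mem (Finset.mem_image_of_mem _ hb)) hb)
      (and_congr_right fun _ => ?_)
    simp only [TropDesc.att, Finset.forall_mem_image, plus_ssubset_plus, plus_subset_plus]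
  constructor
  · intro ha
    have := (mem_ch.1 ha).1
    rw [nodes_att (h.two_le_card hP), Finset.mem_insert, Finset.mem_image] at this
    rcases this with rfl | ⟨b, hb, rfl⟩
    · exact Or.inl ⟨rfl, h1.1 ha⟩
    · exact Or.inr ⟨b, (h2 b hb).1 ha, rfl⟩
  · rintro (⟨rfl, hBP⟩ | ⟨b, hb, rfl⟩)
    · exact h1.2 hBP
    · exact (h2 b (mem_ch.1 hb).1).2 hb

theorem card_ch_att [Nontrivial X] (h : IsHier σ) (hP : P ∈ insert Finset.univ σ) {B : Finset X}
    (hB : B ∈ insert Finset.univ σ) :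
    (ch (att σ P) (plus P B)).card = (ch σ B).card + if B = P then 1 else 0 := by
  have hn : ({none} : Finset (Option X)) ∉ (ch σ B).image (plus P) := by
    intro hm
    obtain ⟨b, hb, he⟩ := Finset.mem_image.1 hm
    exact plus_ne_singleton_none (h.nodes_nonempty (mem_ch.1 hb).1) he
  split_ifs with hBP
  · have : ch (att σ P) (plus P B) = insert {none} ((ch σ B).image (plus P)) := by
      ext a
      rw [mem_ch_att h hP hB]
      simp [hBP, eq_comm]
    rw [this, Finset.card_insert_of_notMem hn, Finset.card_image_of_injective _ (plus_injective P)]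
  · have : ch (att σ P) (plus P B) = (ch σ B).image (plus P) := by
      ext a
      rw [mem_ch_att h hP hB]
      simp [hBP, eq_comm]
    rw [this, Finset.card_image_of_injective _ (plus_injective P), add_zero]

theorem mem_insert_univ_att {P : Finset X} {C : Finset (Option X)} :
    C ∈ insert Finset.univ (att σ P) ↔ ∃ B ∈ insert Finset.univ σ, C = plus P B := by
  rw [Finset.mem_insert, att, Finset.mem_image]
  constructor
  · rintro (rfl | ⟨B, hB, rfl⟩)
    · exact ⟨_, Finset.mem_insert_self _ _, (plus_univ P).symm⟩
    · exact ⟨B, Finset.mem_insert_of_mem hB, rfl⟩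
  · rintro ⟨B, hB, rfl⟩
    rcases Finset.mem_insert.1 hB with rfl | hB
    · exact Or.inl (plus_univ P)
    · exact Or.inr ⟨B, hB, rfl⟩

theorem req_plus (k : ℕ) (P B : Finset X) : req k (plus P B) = req k B := by
  simp [req, plus_eq_univ_iff]

/-- The new leaf is an extra child of the root and changes no other vertex. This is the
combinatorial source of the passage from `ψ^k` to `ψ^(k-1)`. -/
theorem isType_att_univ [Nontrivial X] {k : ℕ} (h : IsHier σ) :
    IsType (k + 1) (att σ Finset.univ) ↔ IsType k σ := by
  have hu : Finset.univ ∈ insert Finset.univ σ := Finset.mem_insert_self _ _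
  rw [isType_iff, isType_iff]
  simp only [h, h.att hu, true_and]
  constructor
  · intro H B hB
    have := H _ (mem_insert_univ_att.2 ⟨B, hB, rfl⟩)
    rw [card_ch_att h hu hB, req_plus] at this
    unfold req at this ⊢
    split_ifs at this ⊢ <;> omega
  · intro H C hC
    obtain ⟨B, hB, rfl⟩ := mem_insert_univ_att.1 hC
    have := H B hB
    rw [card_ch_att h hu hB, req_plus]
    unfold req at this ⊢
    split_ifs at this ⊢ <;> omega

/-- The tree with a further leaf attached to the edge (or end) below the node `B`. -/
def graft (σ : Finset (Finset X)) (B : Finset X) : Finset (Finset (Option X)) :=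
  insert (Finset.insertNone B)
    (σ.image fun A => if B ⊂ A then Finset.insertNone A else A.map Function.Embedding.some)

theorem image_eq_att {B : Finset X} (hB : B ∈ ch σ P) :
    (σ.image fun A => if B ⊂ A then Finset.insertNone A else A.map Function.Embedding.some) =
      att σ P := by
  refine Finset.image_congr fun A hA => ?_
  have : B ⊂ A ↔ P ⊆ A := ⟨(mem_ch.1 hB).2.2 A hA, fun hPA => (mem_ch.1 hB).2.1.trans_subset hPA⟩
  simp only [plus, this]

theorem plus_of_mem_ch {B : Finset X} (hB : B ∈ ch σ P) :
    plus P B = B.map Function.Embedding.some := if_neg (mem_ch.1 hB).2.1.2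

theorem plus_union_none {B : Finset X} (hB : B ∈ ch σ P) :
    plus P B ∪ {none} = Finset.insertNone B := by
  rw [plus_of_mem_ch hB]
  ext (_ | x) <;> simp

/-- Grafting onto the edge below `B` factors into attaching the leaf at the parent `P` and joining
it with `B`, so that the results on joins apply. -/
theorem graft_eq {B : Finset X} (hB : B ∈ ch σ P) :
    graft σ B = insert (plus P B ∪ {none}) (att σ P) := by
  rw [graft, image_eq_att hB, plus_union_none hB]

section

variable [Nontrivial X] (h : IsHier σ) (hP : P ∈ insert Finset.univ σ) {B : Finset X}
  (hB : B ∈ ch σ P)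
include h hP hB

theorem plus_mem_ch_att : plus P B ∈ ch (att σ P) (plus P P) :=
  (mem_ch_att h hP hP).2 (Or.inr ⟨B, hB, rfl⟩)

theorem none_mem_ch_att : {none} ∈ ch (att σ P) (plus P P) :=
  (mem_ch_att h hP hP).2 (Or.inl ⟨rfl, rfl⟩)

theorem plus_ne_none : plus P B ≠ {none} :=
  plus_ne_singleton_none (h.nodes_nonempty (mem_ch.1 hB).1)

theorem three_le_card_ch_att : 3 ≤ (ch (att σ P) (plus P P)).card := by
  rw [card_ch_att h hP hP, if_pos rfl]
  have := h.two_le_card_ch hP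
  omega

theorem insertNone_notMem_att : Finset.insertNone B ∉ att σ P := by
  have := join_notMem (h.att hP) (plus_mem_ch_att h hP hB) (none_mem_ch_att h hP hB)
    (three_le_card_ch_att h hP hB) (plus_ne_none h hP hB)
  rwa [plus_union_none hB] at this

theorem none_mem_ch_graft : {none} ∈ ch (graft σ B) (Finset.insertNone B) := by
  have := mem_ch_join (h.att hP) (none_mem_ch_att h hP hB) (plus_mem_ch_att h hP hB)
    (plus_ne_none h hP hB).symm
  rwa [Finset.union_comm, plus_union_none hB, ← plus_union_none hB, ← graft_eq hB,
    plus_union_none hB] at this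

end

theorem IsType.graft [Nontrivial X] {k : ℕ} (h : IsType k σ) {B : Finset X} (hB : B ∈ nodes σ) :
    IsType k (graft σ B) := by
  obtain ⟨P, hP, hBP⟩ := h.1.exists_parent hB
  have h' := (isType_iff.1 h).2
  rw [graft_eq hBP]
  refine isType_insert_join (P := plus P P) (h.1.att hP) (mem_insert_univ_att.2 ⟨P, hP, rfl⟩) ?_ ?_
    (plus_mem_ch_att h.1 hP hBP) (none_mem_ch_att h.1 hP hBP) (plus_ne_none h.1 hP hBP)
  · rw [card_ch_att h.1 hP hP, if_pos rfl, req_plus, h' P hP]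
  · intro C hC hCP
    obtain ⟨B, hB, rfl⟩ := mem_insert_univ_att.1 hC
    rw [card_ch_att h.1 hP hB, if_neg (fun e => hCP (by rw [e])), req_plus, h' B hB, add_zero]

/-- The vertex of the leaf keeps at least two other children, so the tree stays stable when the leaf
is deleted. Points `x₁`, `x₂` in two such children ensure that the vertices containing `none` still
have two elements after the deletion. -/
theorem exists_eq_att [Nontrivial X] {τ : Finset (Finset (Option X))} (h : IsHier τ)
    {P' : Finset (Option X)} (hP' : P' ∈ insert Finset.univ τ) (hn : {none} ∈ ch τ P')
    (h3 : 3 ≤ (ch τ P').card) :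
    ∃ (σ : Finset (Finset X)) (P : Finset X), IsHier σ ∧ P ∈ insert Finset.univ σ ∧
      τ = att σ P ∧ P' = plus P P := by
  obtain ⟨c₁, hc₁, c₂, hc₂, h12, h1n, h2n⟩ : ∃ c₁ ∈ ch τ P', ∃ c₂ ∈ ch τ P', c₁ ≠ c₂ ∧
      c₁ ≠ {none} ∧ c₂ ≠ {none} := by
    have : 1 < ((ch τ P').erase {none}).card := by rw [Finset.card_erase_of_mem hn]; omega
    obtain ⟨c₁, hc₁, c₂, hc₂, h12⟩ := Finset.one_lt_card.1 this
    exact ⟨c₁, Finset.mem_of_mem_erase hc₁, c₂, Finset.mem_of_mem_erase hc₂, h12,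
      Finset.ne_of_mem_erase hc₁, Finset.ne_of_mem_erase hc₂⟩
  have hsome : ∀ c ∈ ch τ P', c ≠ {none} → none ∉ c ∧ ∃ x, some x ∈ c := by
    intro c hc hcn
    have h1 : none ∉ c := fun hnc =>
      Finset.disjoint_left.1 (h.disjoint_ch hc hn hcn) hnc (Finset.mem_singleton_self _)
    obtain ⟨_ | x, hx⟩ := h.nodes_nonempty (mem_ch.1 hc).1
    · exact absurd hx h1
    · exact ⟨h1, x, hx⟩
  obtain ⟨hn₁, x₁, hx₁⟩ := hsome c₁ hc₁ h1n
  obtain ⟨hn₂, x₂, hx₂⟩ := hsome c₂ hc₂ h2n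
  have hxP₁ : some x₁ ∈ P' := (mem_ch.1 hc₁).2.1.1 hx₁
  have hxP₂ : some x₂ ∈ P' := (mem_ch.1 hc₂).2.1.1 hx₂
  have hx12 : x₁ ≠ x₂ := by
    rintro rfl
    exact Finset.disjoint_left.1 (h.disjoint_ch hc₁ hc₂ h12) hx₁ hx₂
  have hnP : none ∈ P' := (mem_ch.1 hn).2.1.1 (Finset.mem_singleton_self _)
  set P := Finset.eraseNone P' with hPdef
  have key : ∀ A ∈ insert Finset.univ τ, plus P (Finset.eraseNone A) = A := by
    intro A hA
    -- A vertex is above the leaf exactly if it contains the parent of the leaf. A vertex avoiding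
    -- `none` but containing `P` would strictly contain the child `c₁`, hence the parent `P'` and
    -- with it `none`.
    have hmem : P ⊆ Finset.eraseNone A ↔ none ∈ A := by
      constructor
      · intro hs
        have hA1 : some x₁ ∈ A :=
          Finset.mem_eraseNone.1 (hs (Finset.mem_eraseNone.2 hxP₁))
        rcases h.comparable (IsHier.vertex_mem hA) (IsHier.vertex_mem hP') hA1 hxP₁ with h1 | h1
        · by_contra hnA
          have hss : c₁ ⊂ A := by
            refine Finset.ssubset_iff_of_subset ?_ |>.2 ⟨some x₂,
              Finset.mem_eraseNone.1 (hs (Finset.mem_eraseNone.2 hxP₂)), fun h' =>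
              Finset.disjoint_left.1 (h.disjoint_ch hc₁ hc₂ h12) h' hx₂⟩
            rintro (_ | x) hx
            · exact absurd hx hn₁
            · exact Finset.mem_eraseNone.1 (hs (Finset.mem_eraseNone.2
                ((mem_ch.1 hc₁).2.1.1 hx)))
          exact hnA (IsHier.parent_subset hc₁ hA hss hnP)
        · exact h1 hnP
      · intro hnA
        have hss : {none} ⊂ A := by
          refine (Finset.singleton_subset_iff.2 hnA).ssubset_of_ne fun e => ?_
          have := h.two_le_card hA
          rw [← e] at this
          simp at this
        exact Finset.eraseNone.monotone (IsHier.parent_subset hn hA hss)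
    ext (_ | x)
    · rw [none_mem_plus, hmem]
    · rw [some_mem_plus, Finset.mem_eraseNone]
  have hPP : P' = plus P P := (key P' hP').symm
  refine ⟨τ.image Finset.eraseNone, P, ⟨?_, ?_⟩, ?_, ?_, hPP⟩
  · intro A hA
    obtain ⟨A', hA', rfl⟩ := Finset.mem_image.1 hA
    have hk := key A' (Finset.mem_insert_of_mem hA')
    constructor
    · by_cases hnA : none ∈ A'
      · rw [← hk, none_mem_plus] at hnA
        refine Finset.one_lt_card.2 ⟨x₁, hnA (Finset.mem_eraseNone.2 hxP₁), x₂,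
          hnA (Finset.mem_eraseNone.2 hxP₂), hx12⟩
      · rw [Finset.card_eraseNone_of_not_mem hnA]
        exact (h.1 A' hA').1
    · intro hu
      exact (h.1 A' hA').2 (by rw [← hk, hu, plus_univ])
  · intro A hA B hB
    obtain ⟨A', hA', rfl⟩ := Finset.mem_image.1 hA
    obtain ⟨B', hB', rfl⟩ := Finset.mem_image.1 hB
    refine (h.2 A' hA' B' hB').imp (fun hs => Finset.eraseNone.monotone hs)
      (Or.imp (fun hs => Finset.eraseNone.monotone hs) fun hd => ?_)
    rw [Finset.disjoint_left] at hd ⊢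
    intro x hx hx'
    exact hd (Finset.mem_eraseNone.1 hx) (Finset.mem_eraseNone.1 hx')
  · rcases Finset.mem_insert.1 hP' with rfl | hP'
    · rw [plus_eq_univ_iff.1 hPP.symm]
      exact Finset.mem_insert_self _ _
    · exact Finset.mem_insert_of_mem (Finset.mem_image_of_mem _ hP')
  · rw [att, Finset.image_image]
    conv_lhs => rw [← Finset.image_id (s := τ)]
    exact Finset.image_congr fun A hA => (key A (Finset.mem_insert_of_mem hA)).symm

/-- Forgetting a leaf of a tree. -/
theorem IsType.forget_cases [Nontrivial X] {k : ℕ} {σ' : Finset (Finset (Option X))}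
    (h : IsType k σ') :
    (Finset.univ.map Function.Embedding.some ∈ σ') ∨
    (∃ l σ, k = l + 1 ∧ IsType l σ ∧ σ' = att σ Finset.univ) ∨
    ∃ σ, IsType k σ ∧ ∃ B ∈ nodes σ, σ' = TropDesc.graft σ B := by
  obtain ⟨A₀, hA₀, hn⟩ := h.1.exists_parent (singleton_mem_nodes σ' none)
  rcases Finset.mem_insert.1 hA₀ with rfl | hA₀'
  · cases k with
    | zero =>
      -- The root has only two children. One is the leaf, so the other consists of all the old
      -- leaves.
      left
      have hc := h.2.2
      obtain ⟨x⟩ : Nonempty X := inferInstance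
      obtain ⟨b, hb, hxb⟩ := h.1.exists_mem_ch hA₀ (Finset.mem_univ (some x))
      have hbn : b ≠ {none} := by rintro rfl; simp at hxb
      have he : ch σ' Finset.univ = {b, {none}} := by
        refine (Finset.eq_of_subset_of_card_le ?_ ?_).symm
        · intro c hc
          rcases Finset.mem_insert.1 hc with rfl | hc
          · exact hb
          · rw [Finset.mem_singleton.1 hc]; exact hn
        · rw [hc, Finset.card_pair hbn]
      have hU := h.1.biUnion_ch hA₀
      have hbe : b = Finset.univ.map Function.Embedding.some := by
        ext (_ | y)
        · simp only [Finset.mem_map, Function.Embedding.some_apply, reduceCtorEq, and_false,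
            exists_false, iff_false]
          exact fun hnb => Finset.disjoint_left.1 (h.1.disjoint_ch hb hn hbn) hnb
            (Finset.mem_singleton_self _)
        · have : some y ∈ (ch σ' Finset.univ).biUnion id := by rw [hU]; exact Finset.mem_univ _
          rw [he] at this
          simpa using this
      rcases mem_nodes.1 (mem_ch.1 hb).1 with h1 | ⟨z, hz⟩
      · rwa [hbe] at h1
      · exfalso
        have := congrArg Finset.card (hbe.symm.trans hz)
        rw [Finset.card_map, Finset.card_univ, Finset.card_singleton] at this
        have := Fintype.one_lt_card (α := X)
        omega
    | succ l =>
      right; left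
      obtain ⟨σ, P, hσ, hP, he, hPe⟩ := exists_eq_att h.1 hA₀ hn (by rw [h.2.2]; omega)
      have hPu : P = Finset.univ := plus_eq_univ_iff.1 hPe.symm
      subst hPu
      subst he
      exact ⟨l, σ, rfl, (isType_att_univ hσ).1 h, rfl⟩
  -- The vertex of the leaf has one other child, which names the grafted edge. Contracting the edge
  -- below this vertex moves the leaf to a vertex with at least three children, where it can be
  -- dropped.
  · right; right
    obtain ⟨P', hP', hAP'⟩ := h.1.exists_parent (mem_nodes.2 (Or.inl hA₀'))
    obtain ⟨hτ, hP'τ, hcP, hc, a, ha, b, hb, hab, hAe, hche⟩ := h.erase hA₀' hP' hAP'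
    wlog hbn : b = {none} generalizing a b
    · rw [hche, Finset.mem_insert, Finset.mem_singleton] at hn
      have han : a = {none} := by
        rcases hn with h1 | h1
        · exact h1.symm
        · exact absurd h1.symm hbn
      exact this b hb a ha hab.symm (by rw [hAe, Finset.union_comm])
        (by rw [hche, Finset.pair_comm]) han
    subst hbn
    obtain ⟨σ, P, hσ, hP, he, hPe⟩ := exists_eq_att hτ hP'τ hb
      (by rw [hcP]; have := two_le_req k P'; omega)
    rw [he, hPe, mem_ch_att hσ hP hP] at ha
    obtain ⟨B, hB, rfl⟩ : ∃ B ∈ ch σ P, a = plus P B := by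
      rcases ha with ⟨rfl, -⟩ | ha
      · exact absurd rfl hab
      · exact ha
    refine ⟨σ, isType_iff.2 ⟨hσ, fun C hC => ?_⟩, B, (mem_ch.1 hB).1, ?_⟩
    · have h1 := card_ch_att hσ hP hC
      rw [← he] at h1
      by_cases hCP : C = P
      · subst hCP
        rw [← hPe, hcP, if_pos rfl, hPe, req_plus] at h1
        omega
      · rw [hc _ (by rw [he]; exact mem_insert_univ_att.2 ⟨C, hC, rfl⟩)
          (fun e => hCP (plus_injective P (e.trans hPe))), if_neg hCP, req_plus] at h1
        omega
    · rw [graft_eq hB, ← he, ← hAe, Finset.insert_erase hA₀']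

theorem att_injective (P : Finset X) : Function.Injective fun σ : Finset (Finset X) => att σ P :=
  Finset.image_injective (plus_injective P)

/-- The parent of the new leaf is `insertNone B`, which recovers `B`; deleting that vertex and the
leaf recovers the tree. -/
theorem graft_inj [Nontrivial X] {σ₁ σ₂ : Finset (Finset X)} (h₁ : IsHier σ₁)
    (h₂ : IsHier σ₂) {B₁ B₂ : Finset X} (hB₁ : B₁ ∈ nodes σ₁) (hB₂ : B₂ ∈ nodes σ₂)
    (he : graft σ₁ B₁ = graft σ₂ B₂) : σ₁ = σ₂ ∧ B₁ = B₂ := by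
  obtain ⟨P₁, hP₁, hBP₁⟩ := h₁.exists_parent hB₁
  obtain ⟨P₂, hP₂, hBP₂⟩ := h₂.exists_parent hB₂
  have hn₁ := none_mem_ch_graft h₁ hP₁ hBP₁
  have hn₂ := none_mem_ch_graft h₂ hP₂ hBP₂
  rw [← he] at hn₂
  have hmem : Finset.insertNone B₂ ∈ graft σ₁ B₁ := by
    rw [he]; exact Finset.mem_insert_self _ _
  have hB : B₁ = B₂ := by
    have := IsHier.parent_unique (Finset.mem_insert_of_mem (Finset.mem_insert_self _ _))
      (Finset.mem_insert_of_mem hmem) hn₁ hn₂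
    exact Finset.insertNone.injective this
  subst hB
  refine ⟨?_, rfl⟩
  have e₁ := insertNone_notMem_att h₁ hP₁ hBP₁
  have e₂ := insertNone_notMem_att h₂ hP₂ hBP₂
  rw [← image_eq_att hBP₁] at e₁
  rw [← image_eq_att hBP₂] at e₂
  have := congrArg (fun s => s.erase (Finset.insertNone B₁)) he
  simp only [graft, Finset.erase_insert e₁, Finset.erase_insert e₂] at this
  refine Finset.image_injective ?_ this
  intro A A' hA
  have := congrArg Finset.eraseNone hA
  simpa [apply_ite Finset.eraseNone] using this

end Forget

/-! ### Tropical Bézout theorem for a line and a rational curve. -/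

section Bezout

open Classical in
theorem indicator_sub_indicator_pair (α β α' β' L : ℝ) (hL : 0 < L) (h₀ : α ≠ 0) (h₀' : α' ≠ 0)
    (hL₀ : α + β * L ≠ 0) (hL₀' : α' + β' * L ≠ 0)
    (hd : ∀ t, α + β * t = 0 → α' + β' * t ≠ 0) :
    (if 0 < α + β * L ∧ 0 < α' + β' * L then (1 : ℝ) else 0) -
        (if 0 < α ∧ 0 < α' then 1 else 0) =
      (if ∃ t, 0 < t ∧ t < L ∧ α + β * t = 0 ∧ 0 < α' + β' * t then Real.sign β else 0) +
      (if ∃ t, 0 < t ∧ t < L ∧ α' + β' * t = 0 ∧ 0 < α + β * t then Real.sign β' else 0) := by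
  have key := indicator_sub_indicator_eq_sum_sign (Finset.univ : Finset Bool)
    (fun b => if b then α else α') (fun b => if b then β else β') 0 L hL
    (by simpa using ⟨h₀', h₀⟩) (by simpa using ⟨hL₀', hL₀⟩) (by
      rintro (_ | _) - (_ | _) - hne t - - h1 h2
      · exact hne rfl
      · simp at h1 h2; exact hd t h2 h1
      · simp at h1 h2; exact hd t h1 h2
      · exact hne rfl)
  simp only [Finset.mem_univ, true_imp_iff, Bool.forall_bool, Fintype.sum_bool] at key
  simpa [and_comm, and_assoc] using key

/-- The derivative in the direction `w`, at a point `v` not on the standard tropical line with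
vertex `0`, of the tropical polynomial `max x y 0` which defines this line. -/
noncomputable def lineSlope (v w : ℝ × ℝ) : ℝ :=
  (if 0 < v.1 - v.2 ∧ 0 < v.1 then 1 else 0) * w.1 +
    (if 0 < v.2 - v.1 ∧ 0 < v.2 then 1 else 0) * w.2

/-- The determinant of two integral vectors. -/
def idet (v w : ℤ × ℤ) : ℤ := v.1 * w.2 - v.2 * w.1

/-- `v` does not lie on one of the lines through the origin which contain the rays of the standard
tropical line. -/
def OffLine (v : ℝ × ℝ) : Prop := v.1 ≠ 0 ∧ v.2 ≠ 0 ∧ v.1 ≠ v.2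

theorem mul_sign_self (a : ℝ) : a * Real.sign a = |a| := by
  rcases lt_trichotomy a 0 with h | rfl | h
  · rw [Real.sign_of_neg h, abs_of_neg h]; ring
  · simp
  · rw [Real.sign_of_pos h, abs_of_pos h]; ring

open Classical in
-- Restricted to the segment, `max x y 0` is piecewise affine, and its slope jumps by the
-- determinant at each crossing with a ray. The jumps sum to the difference of the slopes at the two
-- endpoints. The hypothesis `haw` keeps the segment away from the vertex of the line.
theorem sum_cross_segment (a : ℝ × ℝ) (w : ℤ × ℤ) (L : ℝ) (hL : 0 < L) (ha : OffLine a)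
    (hb : OffLine (a + L • toReal w)) (haw : w ≠ 0 → a.1 * w.2 - a.2 * w.1 ≠ 0) :
    (∑ j : Fin 3, if ∃ s t : ℝ, 0 < s ∧ s < L ∧ 0 < t ∧ a + s • toReal w = t • toReal (dir j) then
      |((idet w (dir j) : ℤ) : ℝ)| else 0) =
    lineSlope (a + L • toReal w) (toReal w) - lineSlope a (toReal w) := by
  obtain ⟨a1, a2⟩ := a
  obtain ⟨w1, w2⟩ := w
  obtain ⟨ha1, ha2, ha3⟩ := ha
  obtain ⟨hb1, hb2, hb3⟩ := hb
  simp only [toReal, Prod.smul_mk, Prod.mk_add_mk, smul_eq_mul] at ha1 ha2 ha3 hb1 hb2 hb3 haw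
  obtain ⟨x, hx⟩ : ∃ x : ℝ, (w1 : ℝ) = x := ⟨_, rfl⟩
  obtain ⟨y, hy⟩ : ∃ y : ℝ, (w2 : ℝ) = y := ⟨_, rfl⟩
  simp only [hx, hy] at hb1 hb2 hb3 haw
  have hno : ∀ t, a1 + x * t = 0 → a2 + y * t = 0 → False := by
    intro t h1 h2
    by_cases hw : w1 = 0 ∧ w2 = 0
    · refine ha1 ?_
      have : x = 0 := by rw [← hx, hw.1]; simp
      rwa [this, zero_mul, add_zero] at h1
    · refine haw (by simpa [Prod.ext_iff] using hw) ?_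
      linear_combination y * h1 - x * h2
  have J0 := indicator_sub_indicator_pair (a1 - a2) (x - y) a1 x L hL (sub_ne_zero.2 ha3) ha1
    (by intro h; apply hb3; linear_combination h) (by intro h; apply hb1; linear_combination h)
    (fun t h1 h2 => hno t h2 (by linear_combination h2 - h1))
  have J1 := indicator_sub_indicator_pair (a2 - a1) (y - x) a2 y L hL
    (sub_ne_zero.2 (Ne.symm ha3)) ha2
    (by intro h; apply hb3; linear_combination -h) (by intro h; apply hb2; linear_combination h)
    (fun t h1 h2 => hno t (by linear_combination h2 - h1) h2)
  have e0 : a1 + L * x - (a2 + L * y) = a1 - a2 + (x - y) * L := by ring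
  have e1 : a2 + L * y - (a1 + L * x) = a2 - a1 + (y - x) * L := by ring
  have e2 : a1 + L * x = a1 + x * L := by ring
  have e3 : a2 + L * y = a2 + y * L := by ring
  have hR : lineSlope ((a1, a2) + L • toReal (w1, w2)) (toReal (w1, w2)) -
      lineSlope (a1, a2) (toReal (w1, w2)) =
      ((if 0 < a1 - a2 + (x - y) * L ∧ 0 < a1 + x * L then (1 : ℝ) else 0) -
        (if 0 < a1 - a2 ∧ 0 < a1 then 1 else 0)) * x +
      ((if 0 < a2 - a1 + (y - x) * L ∧ 0 < a2 + y * L then (1 : ℝ) else 0) -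
        (if 0 < a2 - a1 ∧ 0 < a2 then 1 else 0)) * y := by
    simp only [lineSlope, toReal, Prod.smul_mk, Prod.mk_add_mk, smul_eq_mul, hx, hy, e0, e1]
    rw [e2, e3]
    ring
  rw [hR, J0, J1, Fin.sum_univ_three]
  have c0 : (∃ s t : ℝ, 0 < s ∧ s < L ∧ 0 < t ∧ 
      (a1, a2) + s • toReal (w1, w2) = t • toReal (dir 0)) ↔
      ∃ t, 0 < t ∧ t < L ∧ a1 + x * t = 0 ∧ 0 < a1 - a2 + (x - y) * t := by
    simp only [toReal, dir, Prod.smul_mk, Prod.mk_add_mk, smul_eq_mul, Prod.mk.injEq, hx, hy]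
    constructor
    · rintro ⟨s, t, h1, h2, h3, h4, h5⟩
      simp at h4 h5
      exact ⟨s, h1, h2, by linarith, by nlinarith⟩
    · rintro ⟨s, h1, h2, h4, h5⟩
      refine ⟨s, -(a2 + s * y), h1, h2, by nlinarith, ?_, ?_⟩ <;> simp <;> linarith
  have c1 : (∃ s t : ℝ, 0 < s ∧ s < L ∧ 0 < t ∧ 
      (a1, a2) + s • toReal (w1, w2) = t • toReal (dir 1)) ↔
      ∃ t, 0 < t ∧ t < L ∧ a2 + y * t = 0 ∧ 0 < a2 - a1 + (y - x) * t := by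
    simp only [toReal, dir, Prod.smul_mk, Prod.mk_add_mk, smul_eq_mul, Prod.mk.injEq, hx, hy]
    constructor
    · rintro ⟨s, t, h1, h2, h3, h4, h5⟩
      simp at h4 h5
      exact ⟨s, h1, h2, by linarith, by nlinarith⟩
    · rintro ⟨s, h1, h2, h4, h5⟩
      refine ⟨s, -(a1 + s * x), h1, h2, by nlinarith, ?_, ?_⟩ <;> simp <;> linarith
  have c2 : (∃ s t : ℝ, 0 < s ∧ s < L ∧ 0 < t ∧ 
      (a1, a2) + s • toReal (w1, w2) = t • toReal (dir 2)) ↔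
      ∃ t, 0 < t ∧ t < L ∧ a1 - a2 + (x - y) * t = 0 ∧ 0 < a1 + x * t := by
    simp only [toReal, dir, Prod.smul_mk, Prod.mk_add_mk, smul_eq_mul, Prod.mk.injEq, hx, hy]
    constructor
    · rintro ⟨s, t, h1, h2, h3, h4, h5⟩
      simp at h4 h5
      exact ⟨s, h1, h2, by linarith, by nlinarith⟩
    · rintro ⟨s, h1, h2, h4, h5⟩
      refine ⟨s, a1 + s * x, h1, h2, by nlinarith, ?_, ?_⟩ <;> simp; linarith
  have c2' : (∃ t, 0 < t ∧ t < L ∧ a2 - a1 + (y - x) * t = 0 ∧ 0 < a2 + y * t) ↔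
      ∃ t, 0 < t ∧ t < L ∧ a1 - a2 + (x - y) * t = 0 ∧ 0 < a1 + x * t := by
    refine exists_congr fun t => and_congr_right fun _ => and_congr_right fun _ => ?_
    constructor <;> rintro ⟨h1, h2⟩ <;> exact ⟨by linarith, by linarith⟩
  rw [if_congr c0 rfl rfl, if_congr c1 rfl rfl, if_congr c2 rfl rfl, if_congr c2' rfl rfl]
  have i0 : |((idet (w1, w2) (dir 0) : ℤ) : ℝ)| = x * Real.sign x := by
    rw [mul_sign_self]; simp [idet, dir, hx]
  have i1 : |((idet (w1, w2) (dir 1) : ℤ) : ℝ)| = y * Real.sign y := by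
    rw [mul_sign_self]; simp [idet, dir, hy]
  -- The diagonal ray bounds both regions on which `max x y 0` is nonzero, so its determinant
  -- collects one jump from each of the two indicators.
  have i2 : |((idet (w1, w2) (dir 2) : ℤ) : ℝ)| = x * Real.sign (x - y) + y * Real.sign (y - x) := by
    have : Real.sign (y - x) = - Real.sign (x - y) := by rw [← Real.sign_neg, neg_sub]
    rw [this]
    have h3 := mul_sign_self (x - y)
    have h4 : |((idet (w1, w2) (dir 2) : ℤ) : ℝ)| = |x - y| := by simp [idet, dir, hx, hy]
    rw [h4]; linarith
  rw [i0, i1, i2]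
  split_ifs <;> ring

open Classical in
-- Far out in direction `dir i` the slope of `max x y 0` is `1` for `(1, 1)` and `0` for the other
-- two directions; the crossings account for its difference to the initial slope. Checked sector by
-- sector.
theorem sum_cross_ray (a : ℝ × ℝ) (i : Fin 3) (ha : OffLine a) :
    (∑ j : Fin 3, if ∃ s t : ℝ, 0 < s ∧ 0 < t ∧ a + s • toReal (dir i) = t • toReal (dir j) then
      |((idet (dir i) (dir j) : ℤ) : ℝ)| else 0) =
    (if i = 2 then 1 else 0) - lineSlope a (toReal (dir i)) := by
  obtain ⟨x, y⟩ := a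
  obtain ⟨h1, h2, h3⟩ := ha
  simp only at h1 h2 h3
  have h1' := lt_or_gt_of_ne h1
  have h2' := lt_or_gt_of_ne h2
  have h3' := lt_or_gt_of_ne h3
  rw [Fin.sum_univ_three]
  fin_cases i
  · have c1 : (∃ s t : ℝ, 0 < s ∧ 0 < t ∧ (x, y) + s • toReal (dir 0) = t • toReal (dir 1)) ↔
        x < 0 ∧ 0 < y := by
      simp only [toReal, dir, Prod.smul_mk, Prod.mk_add_mk, smul_eq_mul, Prod.mk.injEq]
      constructor
      · rintro ⟨s, t, hs, ht, h4, h5⟩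
        simp at h4 h5
        exact ⟨by linarith, by linarith⟩
      · rintro ⟨h4, h5⟩
        exact ⟨y, -x, h5, by linarith, by simp, by simp⟩
    have c2 : (∃ s t : ℝ, 0 < s ∧ 0 < t ∧ (x, y) + s • toReal (dir 0) = t • toReal (dir 2)) ↔
        0 < x ∧ x < y := by
      simp only [toReal, dir, Prod.smul_mk, Prod.mk_add_mk, smul_eq_mul, Prod.mk.injEq]
      constructor
      · rintro ⟨s, t, hs, ht, h4, h5⟩
        simp at h4 h5
        exact ⟨by linarith, by linarith⟩
      · rintro ⟨h4, h5⟩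
        exact ⟨y - x, x, by linarith, by linarith, by simp, by simp⟩
    simp only [Fin.zero_eta, c1, c2]
    simp only [idet, dir, lineSlope, toReal]
    rcases h1' with h1 | h1 <;> rcases h2' with h2 | h2 <;> rcases h3' with h3 | h3 <;>
      simp [h1, h2, h3, h1.le, h2.le, h3.le, not_lt.2] <;> linarith
  · have c1 : (∃ s t : ℝ, 0 < s ∧ 0 < t ∧ (x, y) + s • toReal (dir 1) = t • toReal (dir 0)) ↔
        0 < x ∧ y < 0 := by
      simp only [toReal, dir, Prod.smul_mk, Prod.mk_add_mk, smul_eq_mul, Prod.mk.injEq]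
      constructor
      · rintro ⟨s, t, hs, ht, h4, h5⟩
        simp at h4 h5
        exact ⟨by linarith, by linarith⟩
      · rintro ⟨h4, h5⟩
        exact ⟨x, -y, h4, by linarith, by simp, by simp⟩
    have c2 : (∃ s t : ℝ, 0 < s ∧ 0 < t ∧ (x, y) + s • toReal (dir 1) = t • toReal (dir 2)) ↔
        0 < y ∧ y < x := by
      simp only [toReal, dir, Prod.smul_mk, Prod.mk_add_mk, smul_eq_mul, Prod.mk.injEq]
      constructor
      · rintro ⟨s, t, hs, ht, h4, h5⟩
        simp at h4 h5
        exact ⟨by linarith, by linarith⟩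
      · rintro ⟨h4, h5⟩
        exact ⟨x - y, y, by linarith, by linarith, by simp, by simp⟩
    simp only [Fin.mk_one, c1, c2]
    simp only [idet, dir, lineSlope, toReal]
    rcases h1' with h1 | h1 <;> rcases h2' with h2 | h2 <;> rcases h3' with h3 | h3 <;>
      simp [h1, h2, h3, h1.le, h2.le, h3.le, not_lt.2] <;> linarith
  · have c1 : (∃ s t : ℝ, 0 < s ∧ 0 < t ∧ (x, y) + s • toReal (dir 2) = t • toReal (dir 0)) ↔
        x < 0 ∧ y < x := by
      simp only [toReal, dir, Prod.smul_mk, Prod.mk_add_mk, smul_eq_mul, Prod.mk.injEq]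
      constructor
      · rintro ⟨s, t, hs, ht, h4, h5⟩
        simp at h4 h5
        exact ⟨by linarith, by linarith⟩
      · rintro ⟨h4, h5⟩
        exact ⟨-x, x - y, by linarith, by linarith, by simp, by simp; ring⟩
    have c2 : (∃ s t : ℝ, 0 < s ∧ 0 < t ∧ (x, y) + s • toReal (dir 2) = t • toReal (dir 1)) ↔
        y < 0 ∧ x < y := by
      simp only [toReal, dir, Prod.smul_mk, Prod.mk_add_mk, smul_eq_mul, Prod.mk.injEq]
      constructor
      · rintro ⟨s, t, hs, ht, h4, h5⟩
        simp at h4 h5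
        exact ⟨by linarith, by linarith⟩
      · rintro ⟨h4, h5⟩
        exact ⟨-y, y - x, by linarith, by linarith, by simp; ring, by simp⟩
    simp only [Fin.reduceFinMk, c1, c2]
    simp only [idet, dir, lineSlope, toReal]
    rcases h1' with h1 | h1 <;> rcases h2' with h2 | h2 <;> rcases h3' with h3 | h3 <;>
      simp [h1, h2, h3, h1.le, h2.le, h3.le, not_lt.2]

variable {X : Type*} [Fintype X] [DecidableEq X] (Δ : X → ℤ × ℤ)

/-- The slope of the edge below the vertex `A`. -/
def slopeOf (A : Finset X) : ℤ × ℤ := ∑ x ∈ A, Δ x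

/-- The position of the lower end of the edge below the node `B`. -/
noncomputable def startPos (l : Finset X → ℝ) (p : ℝ × ℝ) (B : Finset X) : ℝ × ℝ :=
  p + ∑ A with B ⊂ A, l A • toReal (slopeOf Δ A)

/-- The position of the vertex `B`. -/
noncomputable def vertexPos (l : Finset X → ℝ) (p : ℝ × ℝ) (B : Finset X) : ℝ × ℝ :=
  p + ∑ A with B ⊆ A, l A • toReal (slopeOf Δ A)

theorem vertexPos_eq (l : Finset X → ℝ) (p : ℝ × ℝ) (B : Finset X) :
    vertexPos Δ l p B = startPos Δ l p B + l B • toReal (slopeOf Δ B) := by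
  have : (Finset.univ.filter fun A => B ⊆ A) = insert B (Finset.univ.filter fun A => B ⊂ A) := by
    ext A
    simp only [Finset.mem_filter, Finset.mem_univ, true_and, Finset.mem_insert,
      Finset.ssubset_iff_subset_ne]
    constructor
    · intro h
      by_cases he : A = B
      · exact Or.inl he
      · exact Or.inr ⟨h, Ne.symm he⟩
    · rintro (rfl | h)
      · exact subset_rfl
      · exact h.1
  rw [vertexPos, startPos, this, Finset.sum_insert (by simp)]
  abel

theorem startPos_of_mem_ch {σ : Finset (Finset X)} {l : Finset X → ℝ}
    (hl : ∀ A ∉ σ, l A = 0) (p : ℝ × ℝ) {a B : Finset X} (ha : a ∈ ch σ B) :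
    startPos Δ l p a = vertexPos Δ l p B := by
  rw [startPos, vertexPos, Finset.sum_filter, Finset.sum_filter]
  congr 1
  refine Finset.sum_congr rfl fun A _ => ?_
  by_cases hA : A ∈ σ
  · have : a ⊂ A ↔ B ⊆ A := ⟨(mem_ch.1 ha).2.2 A hA, fun h => (mem_ch.1 ha).2.1.trans_subset h⟩
    simp only [this]
  · simp [hl A hA]

/-- The edge (or end) below the node `B` crosses the ray `j` of the tropical line with vertex
`q`. -/
def Cross (σ : Finset (Finset X)) (l : Finset X → ℝ) (p q : ℝ × ℝ) (B : Finset X) (j : Fin 3) :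
    Prop :=
  ∃ s t : ℝ, 0 < s ∧ (B ∈ σ → s < l B) ∧ 0 < t ∧
    startPos Δ l p B + s • toReal (slopeOf Δ B) = q + t • toReal (dir j)

theorem lineSlope_sum {α : Type*} (s : Finset α) (v : ℝ × ℝ) (w : α → ℝ × ℝ) :
    ∑ a ∈ s, lineSlope v (w a) = lineSlope v (∑ a ∈ s, w a) := by
  simp only [lineSlope, Prod.fst_sum, Prod.snd_sum, Finset.mul_sum, Finset.sum_add_distrib]

theorem toReal_sum {α : Type*} (s : Finset α) (w : α → ℤ × ℤ) :
    toReal (∑ a ∈ s, w a) = ∑ a ∈ s, toReal (w a) := by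
  ext <;> simp [toReal, Prod.fst_sum, Prod.snd_sum]

theorem slopeOf_ch [Nontrivial X] {σ : Finset (Finset X)} (h : IsHier σ) {B : Finset X}
    (hB : B ∈ insert Finset.univ σ) : ∑ a ∈ ch σ B, slopeOf Δ a = slopeOf Δ B :=
  h.sum_ch hB Δ

open Classical in
/-- A tropical line in general position meets a rational tropical curve in as many points, counted
with multiplicity, as the curve has ends of slope `(1, 1)`. -/
theorem sum_cross_eq [Nontrivial X] {σ : Finset (Finset X)} (h : IsHier σ) {l : Finset X → ℝ}
    (hpos : ∀ A ∈ σ, 0 < l A) (hl : ∀ A ∉ σ, l A = 0) (p q : ℝ × ℝ)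
    (hΔ : ∀ x, Δ x = 0 ∨ ∃ j, Δ x = dir j) (htot : ∑ x, Δ x = 0)
    (hoff : ∀ B ∈ insert Finset.univ σ, OffLine (vertexPos Δ l p B - q))
    (hdet : ∀ B ∈ σ, slopeOf Δ B ≠ 0 →
      (vertexPos Δ l p B - q).1 * (slopeOf Δ B).2 - (vertexPos Δ l p B - q).2 * (slopeOf Δ B).1 ≠ 0) :
    ∑ B ∈ nodes σ, ∑ j : Fin 3,
      (if Cross Δ σ l p q B j then |((idet (slopeOf Δ B) (dir j) : ℤ) : ℝ)| else 0) =
    (Finset.univ.filter fun x => Δ x = dir 2).card := by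
  -- `g` and `f` are the slopes of `max x y 0` along the edge below `B`, at its lower and its upper
  -- end; for an unbounded end `f` is the slope at infinity.
  set g : Finset X → ℝ := fun B => lineSlope (startPos Δ l p B - q) (toReal (slopeOf Δ B)) with hg
  set e : Finset X → ℝ := fun B => lineSlope (vertexPos Δ l p B - q) (toReal (slopeOf Δ B)) with he
  set f : Finset X → ℝ := fun B => if B ∈ σ then e B else
    if slopeOf Δ B = dir 2 then 1 else 0 with hf
  have hstart : ∀ B ∈ nodes σ, OffLine (startPos Δ l p B - q) := by
    intro B hB
    obtain ⟨P, hP, hBP⟩ := h.exists_parent hB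
    rw [startPos_of_mem_ch Δ hl p hBP]
    exact hoff P hP
  have hedge : ∀ B ∈ nodes σ, (∑ j : Fin 3,
      if Cross Δ σ l p q B j then |((idet (slopeOf Δ B) (dir j) : ℤ) : ℝ)| else 0) =
      f B - g B := by
    intro B hB
    have hcross : ∀ j, Cross Δ σ l p q B j ↔ ∃ s t : ℝ, 0 < s ∧ (B ∈ σ → s < l B) ∧ 0 < t ∧
        startPos Δ l p B - q + s • toReal (slopeOf Δ B) = t • toReal (dir j) := by
      intro j
      refine exists₂_congr fun s t => and_congr_right fun _ => and_congr_right fun _ =>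
        and_congr_right fun _ => ?_
      rw [← eq_sub_iff_add_eq, ← eq_sub_iff_add_eq, sub_eq_iff_eq_add]
      constructor <;> intro h <;> rw [h] <;> abel
    by_cases hBσ : B ∈ σ
    · have hv : startPos Δ l p B - q + l B • toReal (slopeOf Δ B) = vertexPos Δ l p B - q := by
        rw [vertexPos_eq]; abel
      have key := sum_cross_segment (startPos Δ l p B - q) (slopeOf Δ B) (l B) (hpos B hBσ)
        (hstart B hB) (by rw [hv]; exact hoff B (Finset.mem_insert_of_mem hBσ)) (fun hne => by
          have := hdet B hBσ hne
          rw [← hv] at this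
          intro h0
          apply this
          simp only [toReal, Prod.fst_add, Prod.snd_add, Prod.smul_mk, smul_eq_mul]
          linear_combination h0)
      rw [hv] at key
      simp only [hcross, hf, he, hg, hBσ, if_true, true_imp_iff]
      exact key
    · obtain ⟨x, rfl⟩ := (mem_nodes.1 hB).resolve_left hBσ
      have hs : slopeOf Δ {x} = Δ x := by simp [slopeOf]
      simp only [hcross, hf, hg, hBσ, if_false, false_imp_iff, true_and, hs]
      rcases hΔ x with h0 | ⟨i, hi⟩
      · rw [h0, if_neg (by simp [dir, Prod.ext_iff])]
        simp [idet, lineSlope, toReal]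
      · rw [hi]
        have key := sum_cross_ray _ i (hstart _ hB)
        rw [key]
        congr 1
        refine if_congr ?_ rfl rfl
        constructor
        · rintro rfl; rfl
        · fin_cases i <;> simp [dir]
  rw [Finset.sum_congr rfl hedge, Finset.sum_sub_distrib]
  -- `lineSlope` is linear in the direction, so by balancing the slopes along the children of a
  -- vertex add up to the slope along the edge below it. The sum telescopes; the root gives zero
  -- because the total slope is zero.
  have hsumg : ∑ B ∈ nodes σ, g B = ∑ B ∈ σ, e B := by
    rw [← h.sum_nodes]
    have : ∀ B ∈ insert Finset.univ σ, ∑ a ∈ ch σ B, g a = e B := by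
      intro B hB
      simp only [hg, he]
      rw [← slopeOf_ch Δ h hB, toReal_sum, ← lineSlope_sum]
      exact Finset.sum_congr rfl fun a ha => by rw [startPos_of_mem_ch Δ hl p ha]
    have h0 : e Finset.univ = 0 := by
      simp [he, slopeOf, htot, lineSlope, toReal]
    rw [Finset.sum_congr rfl this, Finset.sum_insert (f := e) h.univ_notMem, h0, zero_add]
  have hsumf : ∑ B ∈ nodes σ, f B = ∑ B ∈ σ, e B + (Finset.univ.filter fun x => Δ x = dir 2).card := by
    rw [nodes, Finset.sum_union, Finset.sum_image]
    · congr 1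
      · exact Finset.sum_congr rfl fun B hB => by simp [hf, hB]
      · simp [hf, h.singleton_notMem, slopeOf]
    · exact fun x _ y _ hxy => Finset.singleton_injective hxy
    · rw [Finset.disjoint_right]
      intro a ha
      obtain ⟨x, -, rfl⟩ := Finset.mem_image.1 ha
      exact h.singleton_notMem x
  rw [hsumg, hsumf]
  ring

end Bezout

/-! ### Rooted graph-theoretic trees and their families of clusters. -/

section Tree

/-- The parent is the neighbour closer to the root. It is unique, since two such neighbours would
extend to two different paths to `r`. -/
theorem exists_parent_function {V : Type*} {G : SimpleGraph V} (hG : G.IsTree) (r : V) :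
    ∃ (p : V → V) (dep : V → ℕ), p r = r ∧ dep r = 0 ∧
      (∀ v, v ≠ r → G.Adj v (p v) ∧ dep v = dep (p v) + 1) ∧
      ∀ u v, G.Adj u v → (u ≠ r ∧ p u = v) ∨ (v ≠ r ∧ p v = u) := by
  classical
  have hex : ∀ v, v ≠ r → ∃ w, G.Adj v w ∧ G.dist r v = G.dist r w + 1 := by
    intro v hv
    obtain ⟨W, hW⟩ := hG.connected.exists_walk_length_eq_dist v r
    cases W with
    | nil => exact absurd rfl hv
    | @cons _ w _ hadj W' =>
      refine ⟨w, hadj, ?_⟩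
      rcases hG.dist_eq_dist_add_one_of_adj r hadj with h | h
      · exact h
      · rw [SimpleGraph.Walk.length_cons] at hW
        have := SimpleGraph.dist_le W'
        have e1 := G.dist_comm (u := v) (v := r)
        have e2 := G.dist_comm (u := w) (v := r)
        omega
  have huniq : ∀ v w w', G.Adj v w → G.Adj v w' → G.dist r v = G.dist r w + 1 →
      G.dist r v = G.dist r w' + 1 → w = w' := by
    intro v w w' h h' hd hd'
    obtain ⟨W, hW⟩ := hG.connected.exists_walk_length_eq_dist w r
    obtain ⟨W', hW'⟩ := hG.connected.exists_walk_length_eq_dist w' r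
    have p1 : (SimpleGraph.Walk.cons h W).IsPath := by
      refine SimpleGraph.Walk.isPath_of_length_eq_dist _ ?_
      rw [SimpleGraph.Walk.length_cons, hW, G.dist_comm, ← hd, G.dist_comm]
    have p2 : (SimpleGraph.Walk.cons h' W').IsPath := by
      refine SimpleGraph.Walk.isPath_of_length_eq_dist _ ?_
      rw [SimpleGraph.Walk.length_cons, hW', G.dist_comm, ← hd', G.dist_comm]
    have he := (hG.existsUnique_path v r).unique p1 p2
    have := congrArg SimpleGraph.Walk.snd he
    simpa using this
  refine ⟨fun v => if hv : v = r then r else (hex v hv).choose, G.dist r, by simp, by simp, ?_, ?_⟩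
  · intro v hv
    simp only [hv, dif_neg, not_false_eq_true]
    exact (hex v hv).choose_spec
  · intro u v huv
    have key : ∀ u v, G.Adj u v → G.dist r u = G.dist r v + 1 → u ≠ r ∧
        (if hv : u = r then r else (hex u hv).choose) = v := by
      intro u v huv hd
      have hu : u ≠ r := by rintro rfl; simp at hd
      refine ⟨hu, ?_⟩
      rw [dif_neg hu]
      exact huniq u _ v (hex u hu).choose_spec.1 huv (hex u hu).choose_spec.2 hd
    rcases hG.dist_eq_dist_add_one_of_adj r huv with h | h
    · exact Or.inl (key u v huv h)
    · exact Or.inr (key v u huv.symm h)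

variable {V : Type*} {X : Type*} [Fintype X] [DecidableEq X]

/-- `f` identifies the vertices of the graph `G`, with root `r` and the leaf `x` attached to the
vertex `a x`, with the vertices of the tree described by the family `σ`. -/
structure IsClusterMap (G : SimpleGraph V) (r : V) (a : X → V) (σ : Finset (Finset X))
    (f : V → Finset X) : Prop where
  inj : Function.Injective f
  mem : ∀ v, f v ∈ insert Finset.univ σ
  surj : ∀ A ∈ insert Finset.univ σ, ∃ v, f v = A
  root : f r = Finset.univ
  adj : ∀ u v, G.Adj u v ↔ f u ∈ ch σ (f v) ∨ f v ∈ ch σ (f u)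
  leaf : ∀ x v, a x = v ↔ {x} ∈ ch σ (f v)

namespace IsClusterMap

variable {G : SimpleGraph V} {r : V} {a : X → V} {σ : Finset (Finset X)} {f : V → Finset X}

theorem mem_of_ne (hf : IsClusterMap G r a σ f) {v : V} (hv : v ≠ r) : f v ∈ σ := by
  refine (Finset.mem_insert.1 (hf.mem v)).resolve_left fun h => hv (hf.inj ?_)
  rw [h, hf.root]

theorem root_notMem_ch (h : IsHier σ) [Nontrivial X] (hf : IsClusterMap G r a σ f) (B : Finset X) :
    f r ∉ ch σ B := by
  rw [hf.root]
  exact fun hm => h.nodes_ne_univ (mem_ch.1 hm).1 rfl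

theorem exists_parent [Nontrivial X] (h : IsHier σ) (hf : IsClusterMap G r a σ f) {v : V}
    (hv : v ≠ r) : ∃ w, f v ∈ ch σ (f w) := by
  obtain ⟨P, hP, hvP⟩ := h.exists_parent (mem_nodes.2 (Or.inl (hf.mem_of_ne hv)))
  obtain ⟨w, rfl⟩ := hf.surj P hP
  exact ⟨w, hvP⟩

theorem parent_unique (hf : IsClusterMap G r a σ f) {u v w : V} (h1 : f u ∈ ch σ (f v))
    (h2 : f u ∈ ch σ (f w)) : v = w :=
  hf.inj (IsHier.parent_unique (hf.mem v) (hf.mem w) h1 h2)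

theorem not_both (_hf : IsClusterMap G r a σ f) {u v : V} (h1 : f u ∈ ch σ (f v)) :
    f v ∉ ch σ (f u) := fun h2 => (mem_ch.1 h1).2.1.2 (mem_ch.1 h2).2.1.1

variable [Fintype V]

open Classical in
theorem sum_children (h : IsHier σ) (hf : IsClusterMap G r a σ f) {Γ : Type*} [AddCommMonoid Γ]
    (g : Finset X → Γ) (v : V) :
    ∑ u with f u ∈ ch σ (f v), g (f u) + ∑ x with a x = v, g {x} = ∑ b ∈ ch σ (f v), g b := by
  have e : ch σ (f v) = ((Finset.univ.filter fun u => f u ∈ ch σ (f v)).image f) ∪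
      ((Finset.univ.filter fun x => a x = v).image fun x => {x}) := by
    ext b
    simp only [Finset.mem_union, Finset.mem_image, Finset.mem_filter, Finset.mem_univ, true_and,
      hf.leaf]
    constructor
    · intro hb
      rcases mem_nodes.1 (mem_ch.1 hb).1 with hbσ | ⟨x, rfl⟩
      · obtain ⟨u, rfl⟩ := hf.surj b (Finset.mem_insert_of_mem hbσ)
        exact Or.inl ⟨u, hb, rfl⟩
      · exact Or.inr ⟨x, hb, rfl⟩
    · rintro (⟨u, hu, rfl⟩ | ⟨x, hx, rfl⟩) <;> assumption
  rw [e, Finset.sum_union, Finset.sum_image, Finset.sum_image]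
  · rw [← e]
  · exact fun x _ y _ hxy => Finset.singleton_injective hxy
  · exact fun x _ y _ hxy => hf.inj hxy
  · rw [Finset.disjoint_right]
    intro b hb hb'
    obtain ⟨x, hx, rfl⟩ := Finset.mem_image.1 hb
    obtain ⟨u, hu, hux⟩ := Finset.mem_image.1 hb'
    rw [Finset.mem_filter, hux] at hu
    rcases Finset.mem_insert.1 (hf.mem u) with h1 | h1
    · rw [hux] at h1
      rw [h1] at hu
      exact (mem_ch.1 hu.2).2.1.2 (Finset.subset_univ _)
    · exact h.singleton_notMem x (hux ▸ h1)

open Classical in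
theorem sum_adj_root [Nontrivial X] (h : IsHier σ) (hf : IsClusterMap G r a σ f) {Γ : Type*}
    [AddCommMonoid Γ] (g : V → Γ) :
    ∑ u with G.Adj r u, g u = ∑ u with f u ∈ ch σ (f r), g u := by
  refine Finset.sum_congr (Finset.filter_congr fun u _ => ?_) fun _ _ => rfl
  rw [hf.adj, or_iff_right (hf.root_notMem_ch h _)]

open Classical in
theorem sum_adj (hf : IsClusterMap G r a σ f) {Γ : Type*}
    [AddCommMonoid Γ] (g : V → Γ) {v w : V} (hvw : f v ∈ ch σ (f w)) :
    ∑ u with G.Adj v u, g u = g w + ∑ u with f u ∈ ch σ (f v), g u := by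
  have e : (Finset.univ.filter fun u => G.Adj v u) =
      insert w (Finset.univ.filter fun u => f u ∈ ch σ (f v)) := by
    ext u
    simp only [Finset.mem_filter, Finset.mem_univ, true_and, Finset.mem_insert, hf.adj]
    constructor
    · rintro (h1 | h1)
      · exact Or.inl (hf.parent_unique h1 hvw)
      · exact Or.inr h1
    · rintro (rfl | h1)
      · exact Or.inl hvw
      · exact Or.inr h1
  rw [e, Finset.sum_insert]
  simp only [Finset.mem_filter, Finset.mem_univ, true_and]
  exact hf.not_both hvw

open Classical in
theorem card_adj [Nontrivial X] (h : IsHier σ) (hf : IsClusterMap G r a σ f) (v : V) :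
    (Finset.univ.filter fun u => G.Adj v u).card + (Finset.univ.filter fun x => a x = v).card =
      (ch σ (f v)).card + if v = r then 0 else 1 := by
  have h1 := hf.sum_children h (fun _ => 1) v
  simp only [Finset.sum_const, smul_eq_mul, mul_one] at h1
  split_ifs with hv
  · subst hv
    have h2 := hf.sum_adj_root h fun _ => 1
    simp only [Finset.sum_const, smul_eq_mul, mul_one] at h2
    omega
  · obtain ⟨w, hw⟩ := hf.exists_parent h hv
    have h2 := hf.sum_adj (fun _ => 1) hw
    simp only [Finset.sum_const, smul_eq_mul, mul_one] at h2
    omega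

omit [Fintype V] in
/-- A function on the vertices is determined by its increments along the edges. -/
theorem eq_root_add_sum [Nontrivial X] (h : IsHier σ) (hf : IsClusterMap G r a σ f) {Γ : Type*}
    [AddCommGroup Γ] (F : V → Γ) (c : Finset X → Γ)
    (hF : ∀ u v, f u ∈ ch σ (f v) → F u = F v + c (f u)) (v : V) :
    F v = F r + ∑ A ∈ σ with f v ⊆ A, c A := by
  obtain ⟨n, hn⟩ : ∃ n, Fintype.card X - (f v).card = n := ⟨_, rfl⟩
  induction n using Nat.strong_induction_on generalizing v with
  | _ n ih =>
    by_cases hv : v = r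
    · subst hv
      rw [Finset.sum_eq_zero, add_zero]
      intro A hA
      rw [Finset.mem_filter, hf.root] at hA
      exact absurd (Finset.univ_subset_iff.1 hA.2) (h.1 A hA.1).2
    · obtain ⟨w, hw⟩ := hf.exists_parent h hv
      have hlt := Finset.card_lt_card (mem_ch.1 hw).2.1
      have hle := Finset.card_le_univ (f w)
      rw [hF v w hw, ih _ (by omega) w rfl]
      have e : (σ.filter fun A => f v ⊆ A) = insert (f v) (σ.filter fun A => f w ⊆ A) := by
        ext A
        simp only [Finset.mem_filter, Finset.mem_insert]
        constructor
        · rintro ⟨hA, hs⟩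
          by_cases he : A = f v
          · exact Or.inl he
          · exact Or.inr ⟨hA, (mem_ch.1 hw).2.2 A hA (hs.ssubset_of_ne (Ne.symm he))⟩
        · rintro (rfl | ⟨hA, hs⟩)
          · exact ⟨hf.mem_of_ne hv, subset_rfl⟩
          · exact ⟨hA, (mem_ch.1 hw).2.1.1.trans hs⟩
      rw [e, Finset.sum_insert]
      · abel
      · rw [Finset.mem_filter]
        exact fun hh => (mem_ch.1 hw).2.1.2 hh.2

end IsClusterMap

section Ancestor

/-- `v` is an ancestor of `u`, for the parent function `p`. -/
def Anc (p : V → V) (v u : V) : Prop := ∃ k, p^[k] u = v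

variable {p : V → V}

theorem Anc.refl (v : V) : Anc p v v := ⟨0, rfl⟩

theorem Anc.parent (v : V) : Anc p (p v) v := ⟨1, rfl⟩

theorem Anc.trans {u v w : V} (h : Anc p u v) (h' : Anc p v w) : Anc p u w := by
  obtain ⟨k, rfl⟩ := h
  obtain ⟨l, rfl⟩ := h'
  exact ⟨k + l, Function.iterate_add_apply p k l w⟩

theorem Anc.of_ne {u v : V} (h : Anc p v u) (hne : u ≠ v) : Anc p v (p u) := by
  obtain ⟨_ | k, rfl⟩ := h
  · exact absurd rfl hne
  · exact ⟨k, (Function.iterate_succ_apply p k u).symm⟩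

theorem Anc.total {u v w : V} (h : Anc p u w) (h' : Anc p v w) : Anc p u v ∨ Anc p v u := by
  obtain ⟨k, rfl⟩ := h
  obtain ⟨l, rfl⟩ := h'
  rcases le_total k l with hkl | hkl
  · exact Or.inr ⟨l - k, by rw [← Function.iterate_add_apply, Nat.sub_add_cancel hkl]⟩
  · exact Or.inl ⟨k - l, by rw [← Function.iterate_add_apply, Nat.sub_add_cancel hkl]⟩

variable {r : V} {dep : V → ℕ}

theorem Anc.dep_le (hr : p r = r) (hp : ∀ v, v ≠ r → dep v = dep (p v) + 1) {u v : V}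
    (h : Anc p v u) : dep v ≤ dep u := by
  obtain ⟨k, rfl⟩ := h
  induction k with
  | zero => exact le_rfl
  | succ k ih =>
    rw [Function.iterate_succ_apply']
    by_cases he : p^[k] u = r
    · rw [he, hr, ← he]; exact ih
    · have := hp _ he
      omega

theorem Anc.root (hp : ∀ v, v ≠ r → dep v = dep (p v) + 1) (u : V) : Anc p r u := by
  obtain ⟨n, hn⟩ : ∃ n, dep u = n := ⟨_, rfl⟩
  induction n using Nat.strong_induction_on generalizing u with
  | _ n ih =>
    by_cases he : u = r
    · exact he ▸ Anc.refl u
    · have := hp u he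
      exact (ih (dep (p u)) (by omega) (p u) rfl).trans (Anc.parent u)

theorem Anc.eq_root (hr : p r = r) {v : V} (h : Anc p v r) : v = r := by
  obtain ⟨k, rfl⟩ := h
  exact Function.iterate_fixed hr k

theorem Anc.antisymm (hr : p r = r) (hp : ∀ v, v ≠ r → dep v = dep (p v) + 1) {u v : V}
    (h : Anc p v u) (h' : Anc p u v) : u = v := by
  by_contra hne
  by_cases hu : u = r
  · subst hu; exact hne (h.eq_root hr).symm
  · have h1 := (h.of_ne hne).dep_le hr hp
    have h2 := h'.dep_le hr hp
    have := hp u hu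
    omega

end Ancestor

/-- The child relation of the family agrees with the one given by the distance from the root. This
leaves no choice for `f v` and is the source of uniqueness. -/
theorem IsClusterMap.eq_filter_anc [Nontrivial X] {G : SimpleGraph V} {r : V} {a : X → V}
    {σ : Finset (Finset X)} {f : V → Finset X} (h : IsHier σ) (hf : IsClusterMap G r a σ f)
    {p : V → V} {dep : V → ℕ} (hr : p r = r)
    (hp : ∀ v, v ≠ r → G.Adj v (p v) ∧ dep v = dep (p v) + 1) (v : V) (x : X) :
    x ∈ f v ↔ Anc p v (a x) := by
  have key : ∀ u, u ≠ r → f u ∈ ch σ (f (p u)) := by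
    intro u
    obtain ⟨n, hn⟩ : ∃ n, dep u = n := ⟨_, rfl⟩
    induction n using Nat.strong_induction_on generalizing u with
    | _ n ih =>
      intro hu
      obtain ⟨hadj, hd⟩ := hp u hu
      rcases (hf.adj _ _).1 hadj with h1 | h1
      · exact h1
      · exfalso
        by_cases hr : p u = r
        · rw [hr] at h1
          exact hf.root_notMem_ch h _ h1
        · have h2 := ih (dep (p u)) (by omega) (p u) rfl hr
          have h3 := hf.parent_unique h1 h2
          have h4 := (hp (p u) hr).2
          rw [← h3] at h4
          omega
  have hmono : ∀ u, f u ⊆ f (p u) ∨ u = r := fun u => by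
    by_cases hu : u = r
    · exact Or.inr hu
    · exact Or.inl (mem_ch.1 (key u hu)).2.1.1
  have hup : ∀ u v, f u ⊆ f v → Anc p v u := by
    intro u
    obtain ⟨n, hn⟩ : ∃ n, dep u = n := ⟨_, rfl⟩
    induction n using Nat.strong_induction_on generalizing u with
    | _ n ih =>
      intro v huv
      by_cases he : f u = f v
      · rw [hf.inj he]; exact Anc.refl v
      · by_cases hu : u = r
        · exfalso
          rw [hu, hf.root] at huv he
          exact he (Finset.univ_subset_iff.1 huv).symm
        · exact (ih (dep (p u)) (by have := (hp u hu).2; omega) (p u) rfl v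
            (IsHier.parent_subset (key u hu) (hf.mem v) (huv.ssubset_of_ne he))).trans
            (Anc.parent u)
  have hleaf := (hf.leaf x (a x)).1 rfl
  constructor
  · intro hx
    refine hup _ _ (IsHier.parent_subset hleaf (hf.mem v)
      ((Finset.singleton_subset_iff.2 hx).ssubset_of_ne fun e => ?_))
    have := h.two_le_card (hf.mem v)
    rw [← e] at this
    simp at this
  · rintro ⟨k, rfl⟩
    induction k with
    | zero => exact (mem_ch.1 hleaf).2.1.1 (Finset.mem_singleton_self x)
    | succ k ih =>
      rw [Function.iterate_succ_apply']
      rcases hmono (p^[k] (a x)) with h2 | h2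
      · exact h2 ih
      · rw [h2, hr, hf.root]; exact Finset.mem_univ x

/-- The family of clusters of a rooted tree is unique. -/
theorem IsClusterMap.unique [Nontrivial X] {G : SimpleGraph V} (hG : G.IsTree) {r : V} {a : X → V}
    {σ σ' : Finset (Finset X)} {f f' : V → Finset X} (h : IsHier σ) (h' : IsHier σ')
    (hf : IsClusterMap G r a σ f) (hf' : IsClusterMap G r a σ' f') : σ = σ' ∧ f = f' := by
  obtain ⟨p, dep, hr, -, hp, -⟩ := exists_parent_function hG r
  have he : f = f' := by
    funext v
    ext x
    rw [hf.eq_filter_anc h hr hp, hf'.eq_filter_anc h' hr hp]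
  subst he
  refine ⟨?_, rfl⟩
  have key : ∀ {σ σ' : Finset (Finset X)}, IsHier σ → IsClusterMap G r a σ f →
      IsClusterMap G r a σ' f → σ ⊆ σ' := by
    intro σ σ' h hf hf' A hA
    obtain ⟨v, rfl⟩ := hf.surj A (Finset.mem_insert_of_mem hA)
    refine hf'.mem_of_ne ?_
    rintro rfl
    exact (h.1 _ hA).2 hf.root
  exact (key h hf hf').antisymm (key h' hf' hf)

open Classical in
/-- Every rooted tree without bivalent vertices is described by its family of clusters. -/
theorem exists_isClusterMap [Fintype V] {G : SimpleGraph V} (hG : G.IsTree) (r : V) (a : X → V)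
    (h3 : ∀ v, 3 ≤ (Finset.univ.filter fun w => G.Adj v w).card +
      (Finset.univ.filter fun x => a x = v).card + if v = r then 1 else 0) :
    ∃ σ f, IsHier σ ∧ IsClusterMap G r a σ f := by
  obtain ⟨p, dep, hr, -, hp, hadj⟩ := exists_parent_function hG r
  have hdep : ∀ v, v ≠ r → dep v = dep (p v) + 1 := fun v hv => (hp v hv).2
  have hpne : ∀ v, v ≠ r → p v ≠ v := fun v hv e => by
    have := hdep v hv; rw [e] at this; omega
  -- the children and the leaves at a vertex
  have h2 : ∀ v, 2 ≤ (Finset.univ.filter fun w => w ≠ r ∧ p w = v).card +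
      (Finset.univ.filter fun x => a x = v).card := by
    intro v
    have hsub : (Finset.univ.filter fun w => G.Adj v w) ⊆
        (Finset.univ.filter fun w => w ≠ r ∧ p w = v) ∪ if v = r then ∅ else {p v} := by
      intro w hw
      rw [Finset.mem_filter] at hw
      rw [Finset.mem_union, Finset.mem_filter]
      rcases hadj v w hw.2 with ⟨hv, rfl⟩ | h1
      · right; simp [hv]
      · exact Or.inl ⟨Finset.mem_univ w, h1⟩
    have h4 := (Finset.card_le_card hsub).trans (Finset.card_union_le _ _)
    have h5 := h3 v
    split_ifs at h4 h5
    · rw [Finset.card_empty] at h4; omega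
    · rw [Finset.card_singleton] at h4; omega
  -- The cluster of a vertex consists of the leaves that descend from it.
  set cl : V → Finset X := fun v => Finset.univ.filter fun x => Anc p v (a x) with hcl
  have mem_cl : ∀ {v x}, x ∈ cl v ↔ Anc p v (a x) := fun {v x} => by simp [hcl]
  have child_disj : ∀ {v w w' : V}, w ≠ r → w' ≠ r → p w = v → p w' = v → w ≠ w' → ∀ u,
      Anc p w u → Anc p w' u → False := by
    intro v w w' hw hw' e e' hne u h1 h1'
    rcases h1.total h1' with h2 | h2
    · have h3 := (h2.of_ne (Ne.symm hne)).dep_le hr hdep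
      have := hdep w hw
      rw [e', ← e] at h3; omega
    · have h3 := (h2.of_ne hne).dep_le hr hdep
      have := hdep w' hw'
      rw [e, ← e'] at h3; omega
  have leaf_disj : ∀ {v w : V}, w ≠ r → p w = v → ¬ Anc p w v := by
    intro v w hw e h1
    have h3 := h1.dep_le hr hdep
    have := hdep w hw
    rw [e] at this; omega
  -- Induction from the deepest vertices downwards: a vertex without a leaf of its own has a child.
  have cl_ne : ∀ v, (cl v).Nonempty := by
    obtain ⟨N, hN⟩ : ∃ N, ∀ v, dep v ≤ N := ⟨Finset.univ.sup dep, fun v =>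
      Finset.le_sup (Finset.mem_univ v)⟩
    intro v
    obtain ⟨n, hn⟩ : ∃ n, N - dep v = n := ⟨_, rfl⟩
    induction n using Nat.strong_induction_on generalizing v with
    | _ n ih =>
      rcases (Finset.univ.filter fun x => a x = v).eq_empty_or_nonempty with h0 | ⟨x, hx⟩
      · have h4 := h2 v
        rw [h0, Finset.card_empty, add_zero] at h4
        obtain ⟨w, hw⟩ : (Finset.univ.filter fun w => w ≠ r ∧ p w = v).Nonempty :=
          Finset.card_pos.1 (by omega)
        rw [Finset.mem_filter] at hw
        have h5 := hdep w hw.2.1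
        have h6 := hN w
        rw [hw.2.2] at h5
        obtain ⟨x, hx⟩ := ih (N - dep w) (by omega) w rfl
        refine ⟨x, mem_cl.2 (Anc.trans ?_ (mem_cl.1 hx))⟩
        rw [← hw.2.2]; exact Anc.parent w
      · rw [Finset.mem_filter] at hx
        exact ⟨x, mem_cl.2 (hx.2 ▸ Anc.refl _)⟩
  have child_sub : ∀ {w v x}, p w = v → x ∈ cl w → x ∈ cl v := fun {w v x} e hx =>
    mem_cl.2 (Anc.trans (e ▸ Anc.parent w) (mem_cl.1 hx))
  -- Stability gives at least two branches above `v`; one leaf from each yields a pair that no child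
  -- contains. Hence clusters grow strictly towards the root and distinguish the vertices.
  have cl_two : ∀ v, ∃ x ∈ cl v, ∃ y ∈ cl v, x ≠ y ∧
      ∀ w, w ≠ r → p w = v → ¬ (x ∈ cl w ∧ y ∈ cl w) := by
    intro v
    have h4 := h2 v
    rcases le_or_gt 2 (Finset.univ.filter fun w => w ≠ r ∧ p w = v).card with hc | hc
    · obtain ⟨w, hw, w', hw', hne⟩ := Finset.one_lt_card.1 hc
      rw [Finset.mem_filter] at hw hw'
      obtain ⟨x, hx⟩ := cl_ne w
      obtain ⟨y, hy⟩ := cl_ne w'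
      have hd := child_disj hw.2.1 hw'.2.1 hw.2.2 hw'.2.2 hne
      refine ⟨x, child_sub hw.2.2 hx, y, child_sub hw'.2.2 hy, ?_, ?_⟩
      · rintro rfl
        exact hd _ (mem_cl.1 hx) (mem_cl.1 hy)
      · rintro w'' hw'' e ⟨h5, h6⟩
        by_cases h7 : w'' = w
        · subst h7
          exact hd _ (mem_cl.1 h6) (mem_cl.1 hy)
        · exact child_disj hw''  hw.2.1 e hw.2.2 h7 _ (mem_cl.1 h5) (mem_cl.1 hx)
    · obtain ⟨x, hx⟩ : (Finset.univ.filter fun x => a x = v).Nonempty :=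
        Finset.card_pos.1 (by omega)
      rw [Finset.mem_filter] at hx
      have hxv : x ∈ cl v := mem_cl.2 (hx.2 ▸ Anc.refl _)
      have hxw : ∀ w, w ≠ r → p w = v → x ∉ cl w := fun w hw e h5 =>
        leaf_disj hw e (hx.2 ▸ mem_cl.1 h5)
      rcases le_or_gt 2 (Finset.univ.filter fun x => a x = v).card with hc' | hc'
      · obtain ⟨y, hy, y', hy', hne⟩ := Finset.one_lt_card.1 hc'
        rw [Finset.mem_filter] at hy hy'
        obtain ⟨z, hz, hzx⟩ : ∃ z, a z = v ∧ z ≠ x := by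
          by_cases h6 : y = x
          · exact ⟨y', hy'.2, fun h7 => hne (h6.trans h7.symm)⟩
          · exact ⟨y, hy.2, h6⟩
        exact ⟨x, hxv, z, mem_cl.2 (hz ▸ Anc.refl _), Ne.symm hzx,
          fun w hw e h5 => hxw w hw e h5.1⟩
      · obtain ⟨w, hw⟩ : (Finset.univ.filter fun w => w ≠ r ∧ p w = v).Nonempty :=
          Finset.card_pos.1 (by omega)
        rw [Finset.mem_filter] at hw
        obtain ⟨y, hy⟩ := cl_ne w
        refine ⟨x, hxv, y, child_sub hw.2.2 hy, ?_, fun w hw e h5 => hxw w hw e h5.1⟩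
        rintro rfl
        exact hxw w hw.2.1 hw.2.2 hy
  have cl_mono : ∀ {u v}, Anc p u v → cl v ⊆ cl u := fun h1 x hx =>
    mem_cl.2 (h1.trans (mem_cl.1 hx))
  have cl_ss : ∀ v, v ≠ r → cl v ⊂ cl (p v) := by
    intro v hv
    refine ⟨cl_mono (Anc.parent v), fun hs => ?_⟩
    obtain ⟨x, hx, y, hy, -, hxy⟩ := cl_two (p v)
    exact hxy v hv rfl ⟨hs hx, hs hy⟩
  have cl_le : ∀ {u v}, cl v ⊆ cl u ↔ Anc p u v := by
    intro u v
    refine ⟨fun hs => ?_, cl_mono⟩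
    obtain ⟨x, hx⟩ := cl_ne v
    rcases (mem_cl.1 (hs hx)).total (mem_cl.1 hx) with h1 | h1
    · exact h1
    · by_cases he : u = v
      · exact he ▸ Anc.refl _
      · exfalso
        have hu : u ≠ r := by
          rintro rfl
          exact he (h1.eq_root hr).symm
        exact (cl_ss u hu).2 ((cl_mono (h1.of_ne he)).trans hs)
  have cl_inj : Function.Injective cl := fun u v h1 =>
    Anc.antisymm hr hdep (cl_le.1 h1.subset) (cl_le.1 h1.symm.subset)
  have cl_root : cl r = Finset.univ :=
    Finset.eq_univ_iff_forall.2 fun x => mem_cl.2 (Anc.root hdep _)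
  have cl_card : ∀ v, 2 ≤ (cl v).card := fun v => by
    obtain ⟨x, hx, y, hy, hne, -⟩ := cl_two v
    exact Finset.one_lt_card.2 ⟨x, hx, y, hy, hne⟩
  set σ : Finset (Finset X) := (Finset.univ.filter fun v => v ≠ r).image cl with hσ
  have mem_σ : ∀ {v}, cl v ∈ σ ↔ v ≠ r := by
    intro v
    rw [hσ, Finset.mem_image]
    constructor
    · rintro ⟨w, hw, e⟩
      rw [← cl_inj e]
      exact (Finset.mem_filter.1 hw).2
    · exact fun hv => ⟨v, by simp [hv], rfl⟩
  have forall_σ : ∀ {P : Finset X → Prop}, (∀ C ∈ σ, P C) ↔ ∀ v, v ≠ r → P (cl v) := by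
    intro P
    simp [hσ]
  have hmem : ∀ v, cl v ∈ insert Finset.univ σ := fun v => by
    by_cases hv : v = r
    · rw [hv, cl_root]; exact Finset.mem_insert_self _ _
    · exact Finset.mem_insert_of_mem (mem_σ.2 hv)
  have hch : ∀ u v, cl u ∈ ch σ (cl v) ↔ u ≠ r ∧ p u = v := by
    intro u v
    rw [mem_ch, forall_σ]
    constructor
    · rintro ⟨hu, huv, hC⟩
      have hur : u ≠ r := by
        rintro rfl
        rw [cl_root] at huv
        exact huv.2 (Finset.subset_univ _)
      refine ⟨hur, Anc.antisymm hr hdep ?_ ?_⟩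
      · exact (cl_le.1 huv.1).of_ne fun e => by subst e; exact huv.2 subset_rfl
      · by_cases hp' : p u = r
        · rw [hp']; exact Anc.root hdep v
        · exact cl_le.1 (hC _ hp' (cl_ss u hur))
    · rintro ⟨hur, rfl⟩
      refine ⟨mem_nodes.2 (Or.inl (mem_σ.2 hur)), cl_ss u hur, fun w hw hs => ?_⟩
      exact cl_le.2 ((cl_le.1 hs.1).of_ne fun e => by subst e; exact hs.2 subset_rfl)
  have hss : ∀ x v, x ∈ cl v → {x} ⊂ cl v := fun x v hx =>
    (Finset.singleton_subset_iff.2 hx).ssubset_of_ne fun e => by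
      have := cl_card v
      rw [← e] at this
      simp at this
  refine ⟨σ, cl, ⟨?_, ?_⟩, cl_inj, hmem, ?_, cl_root, fun u v => ?_, fun x v => ?_⟩
  · rw [forall_σ]
    refine fun v hv => ⟨cl_card v, fun e => ?_⟩
    rw [← cl_root] at e
    exact hv (cl_inj e)
  · simp only [forall_σ]
    intro v hv w hw
    by_cases hd : Disjoint (cl v) (cl w)
    · exact Or.inr (Or.inr hd)
    · obtain ⟨x, hx, hx'⟩ := Finset.not_disjoint_iff.1 hd
      rcases (mem_cl.1 hx).total (mem_cl.1 hx') with h1 | h1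
      · exact Or.inr (Or.inl (cl_le.2 h1))
      · exact Or.inl (cl_le.2 h1)
  · intro A hA
    rcases Finset.mem_insert.1 hA with rfl | hA
    · exact ⟨r, cl_root⟩
    · obtain ⟨v, -, e⟩ := Finset.mem_image.1 hA
      exact ⟨v, e⟩
  · rw [hch, hch]
    constructor
    · exact hadj u v
    · rintro (⟨hu, rfl⟩ | ⟨hv, rfl⟩)
      · exact (hp u hu).1
      · exact (hp v hv).1.symm
  · rw [mem_ch, forall_σ]
    constructor
    · rintro rfl
      exact ⟨singleton_mem_nodes σ x, hss x _ (mem_cl.2 (Anc.refl _)),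
        fun w hw hs => cl_le.2 (mem_cl.1 (hs.1 (Finset.mem_singleton_self x)))⟩
    · rintro ⟨-, hxv, hC⟩
      have hxv' := mem_cl.1 (hxv.1 (Finset.mem_singleton_self x))
      by_cases hw : a x = r
      · rw [hw] at hxv' ⊢
        exact (hxv'.eq_root hr).symm
      · exact Anc.antisymm hr hdep hxv' (cl_le.1 (hC _ hw (hss x _ (mem_cl.2 (Anc.refl _)))))

end Tree

/-! ### The tree graph of a laminar family. -/

section TreeGraph

variable {X : Type*} [Fintype X] [DecidableEq X]

/-- The rooted tree which is described by the family `σ`. -/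
def treeGraph (σ : Finset (Finset X)) : SimpleGraph {A // A ∈ insert Finset.univ σ} where
  Adj A B := A.1 ∈ ch σ B.1 ∨ B.1 ∈ ch σ A.1
  symm := ⟨fun _ _ h => h.symm⟩
  loopless := ⟨fun A h => by
    rcases h with h | h <;> exact (mem_ch.1 h).2.1.2 subset_rfl⟩

/-- The root of the tree described by `σ`. -/
def treeRoot (σ : Finset (Finset X)) : {A // A ∈ insert Finset.univ σ} :=
  ⟨Finset.univ, Finset.mem_insert_self _ _⟩

open Classical in
/-- The vertex below the node `a`. -/
noncomputable def treeParent (σ : Finset (Finset X)) (a : Finset X) :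
    {A // A ∈ insert Finset.univ σ} :=
  if h : ∃ B : {A // A ∈ insert Finset.univ σ}, a ∈ ch σ B.1 then h.choose else treeRoot σ

variable [Nontrivial X] {σ : Finset (Finset X)} (h : IsHier σ)
include h

theorem mem_ch_treeParent {a : Finset X} (ha : a ∈ nodes σ) :
    a ∈ ch σ (treeParent σ a).1 := by
  obtain ⟨B, hB, haB⟩ := h.exists_parent ha
  have hex : ∃ B : {A // A ∈ insert Finset.univ σ}, a ∈ ch σ B.1 := ⟨⟨B, hB⟩, haB⟩
  rw [treeParent, dif_pos hex]
  exact hex.choose_spec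

theorem treeParent_eq_iff {a : Finset X} (ha : a ∈ nodes σ)
    (B : {A // A ∈ insert Finset.univ σ}) : treeParent σ a = B ↔ a ∈ ch σ B.1 := by
  constructor
  · rintro rfl
    exact mem_ch_treeParent h ha
  · exact fun hB => Subtype.ext (IsHier.parent_unique (treeParent σ a).2 B.2
      (mem_ch_treeParent h ha) hB)

/-- Every vertex reaches the root through its successive parents, and every edge is the edge below
some vertex other than the root. A connected graph with so few edges is a tree. -/
theorem treeGraph_isTree : (treeGraph σ).IsTree := by
  have hreach : ∀ A : {A // A ∈ insert Finset.univ σ}, (treeGraph σ).Reachable A (treeRoot σ) := by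
    intro A
    obtain ⟨n, hn⟩ : ∃ n, Fintype.card X - A.1.card = n := ⟨_, rfl⟩
    induction n using Nat.strong_induction_on generalizing A with
    | _ n ih =>
      by_cases hA : A = treeRoot σ
      · rw [hA]
      · have hAσ : A.1 ∈ σ := (Finset.mem_insert.1 A.2).resolve_left fun e => hA (Subtype.ext e)
        have hp := mem_ch_treeParent h (mem_nodes.2 (Or.inl hAσ))
        have hlt := Finset.card_lt_card (mem_ch.1 hp).2.1
        have hle := Finset.card_le_univ (treeParent σ A.1).1
        have hadj : (treeGraph σ).Adj A (treeParent σ A.1) := Or.inl hp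
        exact hadj.reachable.trans (ih _ (by omega) _ rfl)
  have hconn : (treeGraph σ).Connected := by
    have : Nonempty {A // A ∈ insert Finset.univ σ} := ⟨treeRoot σ⟩
    exact ⟨fun A B => (hreach A).trans (hreach B).symm⟩
  rw [SimpleGraph.isTree_iff_connected_and_card]
  refine ⟨hconn, le_antisymm ?_ hconn.card_vert_le_card_edgeSet_add_one⟩
  have h1 : Nat.card {A // A ∈ insert Finset.univ σ} = σ.card + 1 := by
    rw [Nat.card_eq_fintype_card, Fintype.card_coe, Finset.card_insert_of_notMem h.univ_notMem]
  have h2 : Nat.card (treeGraph σ).edgeSet ≤ Nat.card {A // A ∈ σ} := by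
    refine Nat.card_le_card_of_surjective (fun A => ⟨s(⟨A.1, Finset.mem_insert_of_mem A.2⟩,
      treeParent σ A.1), Or.inl (mem_ch_treeParent h (mem_nodes.2 (Or.inl A.2)))⟩) ?_
    have key : ∀ A B : {A // A ∈ insert Finset.univ σ}, A.1 ∈ ch σ B.1 →
        ∃ (hA : A.1 ∈ σ), treeParent σ A.1 = B := by
      intro A B hAB
      have hA : A.1 ∈ σ := (Finset.mem_insert.1 A.2).resolve_left
        (h.nodes_ne_univ (mem_ch.1 hAB).1)
      exact ⟨hA, (treeParent_eq_iff h (mem_ch.1 hAB).1 B).2 hAB⟩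
    rintro ⟨e, he⟩
    induction e using Sym2.ind with
    | _ A B =>
      rcases he with hAB | hBA
      · obtain ⟨hA, hp⟩ := key A B hAB
        exact ⟨⟨A.1, hA⟩, Subtype.ext (by simp [hp])⟩
      · obtain ⟨hB, hp⟩ := key B A hBA
        exact ⟨⟨B.1, hB⟩, Subtype.ext (by simp [hp, Sym2.eq_swap])⟩
  have h3 : Nat.card {A // A ∈ σ} = σ.card := by
    rw [Nat.card_eq_fintype_card, Fintype.card_coe]
  omega

theorem treeGraph_isClusterMap :
    IsClusterMap (treeGraph σ) (treeRoot σ) (fun x => treeParent σ {x}) σ Subtype.val where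
  inj := Subtype.val_injective
  mem A := A.2
  surj A hA := ⟨⟨A, hA⟩, rfl⟩
  root := rfl
  adj _ _ := Iff.rfl
  leaf x A := treeParent_eq_iff h (singleton_mem_nodes σ x) A

end TreeGraph

/-! ### From curves to combinatorial data. -/

section Rep

/-- A labelling of the ends and marked points of curves which are rooted at a marked point: `leaf`
sends `none` to the root and the elements of `X` to the other ends and marked points, `mark` sends
`none` to the root and the elements of `M` to the other marked points. -/
structure Labelling (X M δ ι : Type) where
  leaf : Option X ≃ δ ⊕ ι
  mark : Option M ≃ ι
  pt : M → X
  leaf_none : leaf none = Sum.inr (mark none)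
  leaf_pt : ∀ i, leaf (some (pt i)) = Sum.inr (mark (some i))

variable {δ ι X M : Type} [Fintype δ] [Fintype ι] [Fintype X] [DecidableEq X]
  {Δ : δ → ℤ × ℤ} (m : Labelling X M δ ι)

namespace Labelling

/-- The end or marked point with the label `x`. -/
def leafOf (x : X) : δ ⊕ ι := m.leaf (some x)

/-- The marked point at the root. -/
def root : ι := m.mark none

/-- The slopes of the leaves. -/
def leafSlope (Δ : δ → ℤ × ℤ) (x : X) : ℤ × ℤ := Sum.elim Δ (fun _ => 0) (m.leafOf x)

theorem leafSlope_pt (Δ : δ → ℤ × ℤ) (i : M) : m.leafSlope Δ (m.pt i) = 0 := by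
  rw [leafSlope, leafOf, leaf_pt, Sum.elim_inr]

theorem sum_ends {Γ : Type*} [AddCommMonoid Γ] (g : δ ⊕ ι → Γ) :
    ∑ z, g z = ∑ x, g (m.leafOf x) + g (Sum.inr m.root) := by
  rw [← Equiv.sum_comp m.leaf, Fintype.sum_option, leaf_none, add_comm]
  rfl

theorem sum_leafSlope (Δ : δ → ℤ × ℤ) : ∑ x, m.leafSlope Δ x = ∑ x, Δ x := by
  have := m.sum_ends (Sum.elim Δ fun _ => 0)
  rw [Fintype.sum_sum_type] at this
  simpa [leafSlope] using this.symm

open Classical in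
theorem card_ends {V : Type*} (a : δ ⊕ ι → V) (v : V) :
    (Finset.univ.filter fun z => a z = v).card =
      (Finset.univ.filter fun x => a (m.leafOf x) = v).card +
        if v = a (Sum.inr m.root) then 1 else 0 := by
  simp only [Finset.card_filter]
  rw [m.sum_ends]
  simp only [eq_comm (a := v)]

open Classical in
theorem sum_ends_at {V : Type*} (a : δ ⊕ ι → V) (v : V) :
    ∑ x with a (Sum.inl x) = v, Δ x = ∑ x with a (m.leafOf x) = v, m.leafSlope Δ x := by
  have h0 := m.sum_ends fun z => if a z = v then Sum.elim Δ (fun _ => 0) z else 0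
  rw [Fintype.sum_sum_type] at h0
  simp only [Sum.elim_inl, Sum.elim_inr, ite_self, Finset.sum_const_zero, add_zero] at h0
  rw [Finset.sum_filter, Finset.sum_filter, h0]
  rfl

end Labelling

/-- The curve `C`, rooted at the marked point `m.root`, has the combinatorial type `σ` and the edge
lengths `l`. -/
structure Rep (C : Curve ι Δ) (σ : Finset (Finset X)) (l : Finset X → ℝ)
    (f : C.V → Finset X) : Prop where
  hier : IsHier σ
  cluster : IsClusterMap C.graph (C.att (Sum.inr m.root)) (fun x => C.att (m.leafOf x)) σ f
  len : ∀ u v, f u ∈ ch σ (f v) → C.length s(u, v) = l (f u)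
  zero : ∀ A ∉ σ, l A = 0

theorem exists_rep (C : Curve ι Δ) : ∃ σ l f, Rep m C σ l f := by
  classical
  obtain ⟨σ, f, h, hf⟩ := exists_isClusterMap C.isTree (C.att (Sum.inr m.root))
    (fun x : X => C.att (m.leafOf x)) (fun v => by
      have := C.three_le v
      rw [m.card_ends] at this
      convert this using 1
      rw [add_assoc])
  -- Lengths are zero off `σ`, so that a curve has only one length function.
  refine ⟨σ, fun A => if h : ∃ u v, f u = A ∧ f u ∈ ch σ (f v) ∧ A ∈ σ then
    C.length s(h.choose, h.choose_spec.choose) else 0, f, h, hf, ?_, ?_⟩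
  · intro u v huv
    have hex : ∃ u' v', f u' = f u ∧ f u' ∈ ch σ (f v') ∧ f u ∈ σ := ⟨u, v, rfl, huv, by
      rcases Finset.mem_insert.1 (hf.mem u) with h1 | h1
      · rw [h1] at huv
        exact absurd (Finset.subset_univ _) (mem_ch.1 huv).2.1.2
      · exact h1⟩
    have key : ∀ u' v', f u' = f u → f u' ∈ ch σ (f v') →
        C.length s(u, v) = C.length s(u', v') := by
      intro u' v' h1 h2
      obtain rfl := hf.inj h1
      rw [hf.parent_unique h2 huv]
    rw [dif_pos hex]
    exact key _ _ hex.choose_spec.choose_spec.1 hex.choose_spec.choose_spec.2.1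
  · intro A hA
    rw [dif_neg]
    rintro ⟨u, v, -, -, h1⟩
    exact hA h1

namespace Rep

variable {m} {C : Curve ι Δ} {σ : Finset (Finset X)} {l : Finset X → ℝ}
  {f : C.V → Finset X}

theorem unique [Nontrivial X] (h : Rep m C σ l f) {σ' : Finset (Finset X)}
    {l' : Finset X → ℝ} {f' : C.V → Finset X} (h' : Rep m C σ' l' f') :
    σ = σ' ∧ l = l' := by
  obtain ⟨rfl, rfl⟩ := IsClusterMap.unique C.isTree h.hier h'.hier h.cluster h'.cluster
  refine ⟨rfl, funext fun A => ?_⟩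
  by_cases hA : A ∈ σ
  · obtain ⟨u, rfl⟩ := h.cluster.surj A (Finset.mem_insert_of_mem hA)
    obtain ⟨v, hv⟩ := h.cluster.exists_parent h.hier (v := u) (by
      rintro rfl
      exact (h.hier.1 _ hA).2 h.cluster.root)
    rw [← h.len u v hv, ← h'.len u v hv]
  · rw [h.zero A hA, h'.zero A hA]

theorem of_iso {C' : Curve ι Δ} {f' : C'.V → Finset X} (h : Rep m C' σ l f')
    (hC : C.Iso C') : (∃ f, Rep m C σ l f) ∧ ∀ i, C.ev i = C'.ev i := by
  obtain ⟨e, hadj, hatt, hlen, hpos⟩ := hC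
  refine ⟨⟨f' ∘ e, h.hier, ⟨h.cluster.inj.comp e.injective, fun v => h.cluster.mem _, ?_, ?_, ?_, ?_⟩,
    ?_, h.zero⟩, fun i => ?_⟩
  · intro A hA
    obtain ⟨v, rfl⟩ := h.cluster.surj A hA
    exact ⟨e.symm v, by simp⟩
  · rw [Function.comp_apply, ← hatt]; exact h.cluster.root
  · intro u v
    rw [← hadj]; exact h.cluster.adj _ _
  · intro x v
    rw [Function.comp_apply, ← h.cluster.leaf, hatt, e.injective.eq_iff]
  · intro u v huv
    rw [← hlen u v, h.len _ _ huv, Function.comp_apply]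
    exact (hadj u v).1 ((h.cluster.adj _ _).2 (Or.inl huv))
  · rw [Curve.ev, Curve.ev, hatt, hpos]

theorem length_pos [Nontrivial X] (h : Rep m C σ l f) {A : Finset X} (hA : A ∈ σ) :
    0 < l A := by
  obtain ⟨u, rfl⟩ := h.cluster.surj A (Finset.mem_insert_of_mem hA)
  obtain ⟨v, hv⟩ := h.cluster.exists_parent h.hier (v := u) (by
    rintro rfl
    exact (h.hier.1 _ hA).2 h.cluster.root)
  rw [← h.len u v hv]
  exact C.length_pos u v ((h.cluster.adj _ _).2 (Or.inl hv))

open Classical in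
theorem valency_eq [Nontrivial X] (h : Rep m C σ l f) (v : C.V) :
    C.valency v = (ch σ (f v)).card + 1 := by
  have h1 := h.cluster.card_adj h.hier v
  rw [Curve.valency, m.card_ends, ← add_assoc]
  split_ifs at h1 ⊢ <;> omega

/-- Balancing at `u` expresses the slope below it through those of its children, so induction on the
size of the cluster reduces to the leaves. The two orientations of an edge have opposite slopes
because its length is positive. -/
theorem slope_eq [Nontrivial X] (h : Rep m C σ l f) (u v : C.V)
    (huv : f u ∈ ch σ (f v)) :
    C.slope u v = -slopeOf (m.leafSlope Δ) (f u) ∧ C.slope v u = slopeOf (m.leafSlope Δ) (f u) := by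
  classical
  have anti : ∀ u v, f u ∈ ch σ (f v) → C.slope v u = - C.slope u v := by
    intro u v huv
    have hadj := (h.cluster.adj u v).2 (Or.inl huv)
    have h1 := C.affine u v hadj
    have h2 := C.affine v u hadj.symm
    have hpos := C.length_pos u v hadj
    rw [Sym2.eq_swap] at h2
    have h3 : C.length s(u, v) • (toReal (C.slope u v) + toReal (C.slope v u)) = 0 := by
      rw [smul_add, ← h1, ← h2]; abel
    have h4 := (smul_eq_zero.1 h3).resolve_left hpos.ne'
    have h5 := congrArg Prod.fst h4
    have h6 := congrArg Prod.snd h4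
    simp only [toReal, Prod.mk_add_mk, Prod.fst_zero, Prod.snd_zero] at h5 h6
    norm_cast at h5 h6
    ext
    · simp only [Prod.fst_neg]; omega
    · simp only [Prod.snd_neg]; omega
  suffices hs : C.slope u v = -slopeOf (m.leafSlope Δ) (f u) by
    exact ⟨hs, by rw [anti u v huv, hs, neg_neg]⟩
  obtain ⟨n, hn⟩ : ∃ n, (f u).card = n := ⟨_, rfl⟩
  induction n using Nat.strong_induction_on generalizing u v with
  | _ n ih =>
    have hb := C.balanced u
    have h1 := h.cluster.sum_adj (fun w => C.slope u w) huv
    have h2 := h.cluster.sum_children h.hier (slopeOf (m.leafSlope Δ)) u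
    have h3 := slopeOf_ch (m.leafSlope Δ) h.hier (h.cluster.mem u)
    have h4 : ∑ w with f w ∈ ch σ (f u), C.slope u w =
        ∑ w with f w ∈ ch σ (f u), slopeOf (m.leafSlope Δ) (f w) := by
      refine Finset.sum_congr rfl fun w hw => ?_
      have hw' := (Finset.mem_filter.1 hw).2
      rw [anti w u hw', ih _ (by
        have := Finset.card_lt_card (mem_ch.1 hw').2.1
        omega) w u hw' rfl, neg_neg]
    have h5 : ∑ x with C.att (m.leafOf x) = u, slopeOf (m.leafSlope Δ) {x} =
        ∑ x with C.att (Sum.inl x) = u, Δ x := by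
      have := m.sum_ends_at (Δ := Δ) C.att u
      simp only [slopeOf, Finset.sum_singleton]
      convert this.symm
    rw [h1, h4, add_assoc, ← h5, h2, h3] at hb
    exact eq_neg_of_add_eq_zero_left hb

theorem pos_eq [Nontrivial X] (h : Rep m C σ l f) (v : C.V) :
    C.pos v = vertexPos (m.leafSlope Δ) l (C.ev m.root) (f v) := by
  have h1 := h.cluster.eq_root_add_sum h.hier C.pos
    (fun A => l A • toReal (slopeOf (m.leafSlope Δ) A)) (fun u v huv => by
      have h2 := C.affine v u ((h.cluster.adj _ _).2 (Or.inr huv))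
      rw [Sym2.eq_swap, h.len u v huv, (h.slope_eq u v huv).2] at h2
      rw [← h2]; abel) v
  rw [h1, vertexPos, Curve.ev]
  congr 1
  refine Finset.sum_subset (fun A hA => by simp [(Finset.mem_filter.1 hA).2]) fun A hA hA' => ?_
  rw [h.zero A, zero_smul]
  intro hAσ
  exact hA' (Finset.mem_filter.2 ⟨hAσ, (Finset.mem_filter.1 hA).2⟩)

theorem ev_eq [Nontrivial X] (h : Rep m C σ l f) (i : M) :
    C.ev (m.mark (some i)) = startPos (m.leafSlope Δ) l (C.ev m.root) {m.pt i} := by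
  have h1 : C.ev (m.mark (some i)) = C.pos (C.att (m.leafOf (m.pt i))) := by
    rw [Labelling.leafOf, m.leaf_pt]; rfl
  rw [h1, h.pos_eq, startPos_of_mem_ch _ h.zero _ ((h.cluster.leaf _ _).1 rfl)]

/-- Vertices with equal clusters are matched; positions agree since they are determined by the type,
the lengths and the root. -/
theorem iso [Nontrivial X] (h : Rep m C σ l f) {C' : Curve ι Δ}
    {f' : C'.V → Finset X} (h' : Rep m C' σ l f')
    (hp : C.ev m.root = C'.ev (m.root)) : C.Iso C' := by
  choose g hg using fun v => h'.cluster.surj (f v) (h.cluster.mem v)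
  have hbij : Function.Bijective g := by
    constructor
    · intro u v huv
      refine h.cluster.inj ?_
      rw [← hg, ← hg, huv]
    · intro w
      obtain ⟨v, hv⟩ := h.cluster.surj (f' w) (h'.cluster.mem w)
      exact ⟨v, h'.cluster.inj (by rw [hg, hv])⟩
  refine ⟨Equiv.ofBijective g hbij, fun u v => ?_, fun z => ?_, fun u v huv => ?_, fun v => ?_⟩ <;>
    simp only [Equiv.ofBijective_apply]
  · rw [h'.cluster.adj, h.cluster.adj, hg, hg]
  · obtain ⟨_ | x, rfl⟩ := m.leaf.surjective z
    · rw [m.leaf_none]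
      refine h'.cluster.inj ?_
      rw [hg]
      exact h'.cluster.root.trans h.cluster.root.symm
    · change C'.att (m.leafOf x) = g (C.att (m.leafOf x))
      rw [h'.cluster.leaf, hg]
      exact (h.cluster.leaf _ _).1 rfl
  · rcases (h.cluster.adj u v).1 huv with h1 | h1
    · rw [h.len u v h1, h'.len _ _ (by rwa [hg, hg]), hg]
    · rw [Sym2.eq_swap, Sym2.eq_swap (a := u), h.len v u h1, h'.len _ _ (by rwa [hg, hg]), hg]
  · rw [h.pos_eq, h'.pos_eq, hg, hp]

end Rep

end Rep

/-! ### From combinatorial data to curves. -/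

section CurveOf

variable {δ ι X M : Type} [Fintype δ] [Fintype ι] [Fintype X] [DecidableEq X] [Nontrivial X]
  {Δ : δ → ℤ × ℤ} (m : Labelling X M δ ι)

open Classical in
/-- The vertex to which an end is attached, in the tree described by `σ`. -/
noncomputable def treeAtt (σ : Finset (Finset X)) (z : δ ⊕ ι) :
    {A // A ∈ insert Finset.univ σ} :=
  match m.leaf.symm z with
  | none => treeRoot σ
  | some x => treeParent σ {x}

theorem treeAtt_root (σ : Finset (Finset X)) : treeAtt m σ (Sum.inr m.root) = treeRoot σ := by
  rw [Labelling.root, ← m.leaf_none, treeAtt, Equiv.symm_apply_apply]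

theorem treeAtt_leafOf (σ : Finset (Finset X)) (x : X) :
    treeAtt m σ (m.leafOf x) = treeParent σ {x} := by
  rw [Labelling.leafOf, treeAtt, Equiv.symm_apply_apply]

variable {m}

theorem isClusterMap_treeAtt {σ : Finset (Finset X)} (h : IsHier σ) :
    IsClusterMap (treeGraph σ) (treeAtt m σ (Sum.inr m.root)) (fun x => treeAtt m σ (m.leafOf x)) σ
      Subtype.val := by
  simp only [treeAtt_root, treeAtt_leafOf]
  exact treeGraph_isClusterMap h

theorem vertexPos_of_mem_ch (Δ : X → ℤ × ℤ) {σ : Finset (Finset X)} {l : Finset X → ℝ}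
    (hl : ∀ A ∉ σ, l A = 0) (p : ℝ × ℝ) {a B : Finset X} (ha : a ∈ ch σ B) :
    vertexPos Δ l p a = vertexPos Δ l p B + l a • toReal (slopeOf Δ a) := by
  rw [vertexPos_eq, startPos_of_mem_ch Δ hl p ha]

variable (m) in
open Classical in
/-- The curve with combinatorial type `σ`, edge lengths `l` and root at the point `p`. -/
noncomputable def curveOf {σ : Finset (Finset X)} (h : IsHier σ) (l : Finset X → ℝ)
    (hpos : ∀ A ∈ σ, 0 < l A) (hl : ∀ A ∉ σ, l A = 0) (htot : ∑ x, Δ x = 0) (p : ℝ × ℝ) :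
    Curve ι Δ where
  V := {A // A ∈ insert Finset.univ σ}
  graph := treeGraph σ
  att := treeAtt m σ
  -- Adjacent clusters are nested, so the intersection is a symmetric name for the upper one, which
  -- labels the edge.
  length := Sym2.lift ⟨fun A B => l (A.1 ∩ B.1), fun A B => congrArg l (Finset.inter_comm _ _)⟩
  pos A := vertexPos (m.leafSlope Δ) l p A.1
  slope A B := if A.1 ∈ ch σ B.1 then -slopeOf (m.leafSlope Δ) A.1 else slopeOf (m.leafSlope Δ) B.1
  isTree := treeGraph_isTree h
  three_le v := by
    have h1 := (isClusterMap_treeAtt (m := m) h).card_adj h v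
    have h2 := h.two_le_card_ch v.2
    rw [m.card_ends, ← add_assoc]
    split_ifs at h1 ⊢ <;> omega
  length_pos A B hAB := by
    have key : ∀ A B : {A // A ∈ insert Finset.univ σ}, A.1 ∈ ch σ B.1 → 0 < l (A.1 ∩ B.1) := by
      intro A B hAB
      rw [Finset.inter_eq_left.2 (mem_ch.1 hAB).2.1.1]
      exact hpos _ ((Finset.mem_insert.1 A.2).resolve_left (h.nodes_ne_univ (mem_ch.1 hAB).1))
    rcases hAB with h1 | h1
    · exact key A B h1
    · rw [Sym2.eq_swap]; exact key B A h1
  affine A B hAB := by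
    rcases hAB with h1 | h1
    · rw [if_pos h1]
      change _ = l (A.1 ∩ B.1) • _
      rw [vertexPos_of_mem_ch _ hl p h1,
        Finset.inter_eq_left.2 (mem_ch.1 h1).2.1.1]
      ext <;> simp [toReal]
    · have h2 : A.1 ∉ ch σ B.1 := fun h2 => (mem_ch.1 h2).2.1.2 (mem_ch.1 h1).2.1.1
      rw [if_neg h2]
      change _ = l (A.1 ∩ B.1) • _
      rw [vertexPos_of_mem_ch _ hl p h1,
        Finset.inter_eq_right.2 (mem_ch.1 h1).2.1.1]
      simp
  balanced v := by
    have hc := isClusterMap_treeAtt (m := m) h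
    set s : {A // A ∈ insert Finset.univ σ} → {A // A ∈ insert Finset.univ σ} → ℤ × ℤ :=
      fun A B => if A.1 ∈ ch σ B.1 then -slopeOf (m.leafSlope Δ) A.1 else
        slopeOf (m.leafSlope Δ) B.1 with hs
    have h2 : ∑ w : {A // A ∈ insert Finset.univ σ} with w.1 ∈ ch σ v.1,
        slopeOf (m.leafSlope Δ) w.1 + ∑ x with treeAtt m σ (m.leafOf x) = v,
          slopeOf (m.leafSlope Δ) {x} = slopeOf (m.leafSlope Δ) v.1 := by
      rw [← slopeOf_ch (m.leafSlope Δ) h v.2]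
      convert hc.sum_children h (slopeOf (m.leafSlope Δ)) v
    have h4 : ∑ w : {A // A ∈ insert Finset.univ σ} with w.1 ∈ ch σ v.1, s v w =
        ∑ w : {A // A ∈ insert Finset.univ σ} with w.1 ∈ ch σ v.1, slopeOf (m.leafSlope Δ) w.1 := by
      refine Finset.sum_congr rfl fun w hw => ?_
      have hw' := (Finset.mem_filter.1 hw).2
      rw [hs]
      exact if_neg fun h2 => (mem_ch.1 h2).2.1.2 (mem_ch.1 hw').2.1.1
    have h5 : ∑ x with treeAtt m σ (m.leafOf x) = v, slopeOf (m.leafSlope Δ) {x} =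
        ∑ x with treeAtt m σ (Sum.inl x) = v, Δ x := by
      have := m.sum_ends_at (Δ := Δ) (treeAtt m σ) v
      simp only [slopeOf, Finset.sum_singleton]
      convert this.symm
    have h6 : ∑ w : {A // A ∈ insert Finset.univ σ} with (treeGraph σ).Adj v w, s v w =
        (if v = treeRoot σ then 0 else -slopeOf (m.leafSlope Δ) v.1) +
          ∑ w : {A // A ∈ insert Finset.univ σ} with w.1 ∈ ch σ v.1, s v w := by
      split_ifs with hv
      · have := hc.sum_adj_root h fun w => s v w
        rw [treeAtt_root] at this
        rw [hv] at this ⊢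
        rw [zero_add]
        convert this
      · obtain ⟨w, hw⟩ := hc.exists_parent h (v := v) (by rwa [treeAtt_root])
        have := hc.sum_adj (fun w => s v w) hw
        rw [show s v w = -slopeOf (m.leafSlope Δ) v.1 from if_pos hw] at this
        convert this
    have h7 : (if v = treeRoot σ then 0 else -slopeOf (m.leafSlope Δ) v.1) +
        slopeOf (m.leafSlope Δ) v.1 = 0 := by
      split_ifs with hv
      · rw [hv, zero_add]
        exact (m.sum_leafSlope Δ).trans htot
      · exact neg_add_cancel _
    have h8 : ∑ w : {A // A ∈ insert Finset.univ σ} with (treeGraph σ).Adj v w, s v w +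
        ∑ x with treeAtt m σ (Sum.inl x) = v, Δ x = 0 := by
      rw [h6, h4, add_assoc, ← h5, h2, h7]
    convert h8

theorem rep_curveOf {σ : Finset (Finset X)} (h : IsHier σ) (l : Finset X → ℝ)
    (hpos : ∀ A ∈ σ, 0 < l A) (hl : ∀ A ∉ σ, l A = 0) (htot : ∑ x, Δ x = 0) (p : ℝ × ℝ) :
    Rep m (curveOf m h l hpos hl htot p) σ l Subtype.val where
  hier := h
  cluster := isClusterMap_treeAtt h
  len u v huv := by
    change l (u.1 ∩ v.1) = l u.1
    rw [Finset.inter_eq_left.2 (mem_ch.1 huv).2.1.1]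
  zero := hl

theorem ev_root_curveOf {σ : Finset (Finset X)} (h : IsHier σ) (l : Finset X → ℝ)
    (hpos : ∀ A ∈ σ, 0 < l A) (hl : ∀ A ∉ σ, l A = 0) (htot : ∑ x, Δ x = 0) (p : ℝ × ℝ) :
    (curveOf m h l hpos hl htot p).ev m.root = p := by
  change vertexPos (m.leafSlope Δ) l p (treeAtt m σ (Sum.inr m.root)).1 = p
  rw [treeAtt_root, vertexPos, Finset.sum_eq_zero, add_zero]
  intro A hA
  have : A = Finset.univ := Finset.univ_subset_iff.1 (Finset.mem_filter.1 hA).2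
  rw [this, slopeOf, m.sum_leafSlope, htot]
  simp [toReal]

end CurveOf

/-! ### The `ψ`-conditions in terms of the combinatorial type. -/

section Psi

variable {δ ι X M : Type} [Fintype δ] [Fintype ι] [Fintype X] [DecidableEq X] [Nontrivial X]
  {Δ : δ → ℤ × ℤ} {m : Labelling X M δ ι} {C : Curve ι Δ} {σ : Finset (Finset X)}
  {l : Finset X → ℝ} {f : C.V → Finset X} {k : ι → ℕ}

open Classical in
theorem psiAt_eq (C : Curve ι Δ) {y : ι} (hk : ∀ i, i ≠ y → k i = 0) (v : C.V) :
    C.psiAt k v = if C.att (Sum.inr y) = v then k y else 0 := by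
  rw [Curve.psiAt, Finset.sum_filter, Finset.sum_eq_single y]
  · intro i _ hi
    rw [hk i hi, ite_self]
  · simp

/-- A vertex has one flag besides its children: the edge below it or, at the root, the marked point
of the root. Only the root vertex carries a `ψ`-power. -/
theorem Rep.inPsi_iff (h : Rep m C σ l f) (hk : ∀ i, i ≠ m.root → k i = 0) :
    C.InPsi k ↔ IsType (k m.root) σ := by
  simp only [Curve.InPsi, psiAt_eq C hk, h.valency_eq]
  constructor
  · intro H
    refine ⟨h.hier, fun B hB => ?_, ?_⟩
    · obtain ⟨v, rfl⟩ := h.cluster.surj B (Finset.mem_insert_of_mem hB)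
      have h1 := H v
      rw [if_neg] at h1
      · omega
      · rintro rfl
        exact (h.hier.1 _ hB).2 h.cluster.root
    · have h1 := H (C.att (Sum.inr m.root))
      rw [if_pos rfl, h.cluster.root] at h1
      omega
  · rintro ⟨-, h2, h3⟩ v
    split_ifs with hv
    · rw [← hv, h.cluster.root, h3]; omega
    · rw [h2 _ (h.cluster.mem_of_ne (Ne.symm hv))]

/-- With a single `ψ`-power the weight is `k! / k!`. -/
theorem psiWeight_eq_one (C : Curve ι Δ) {y : ι} (hk : ∀ i, i ≠ y → k i = 0) :
    C.psiWeight k = 1 := by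
  classical
  rw [Curve.psiWeight, Finset.prod_eq_single (C.att (Sum.inr y)), Finset.prod_eq_single y,
    psiAt_eq C hk, if_pos rfl, div_self (by exact_mod_cast (k y).factorial_ne_zero)]
  · intro i _ hi
    simp [hk i hi]
  · simp
  · intro v _ hv
    simp [psiAt_eq C hk, Ne.symm hv]
  · simp

end Psi

/-! ### The evaluation lattice modulo translations. -/

section EvLattice

variable {δ ι X M : Type} [Fintype δ] [Fintype ι] [Fintype X] [DecidableEq X] [Nontrivial X]
  {Δ : δ → ℤ × ℤ} (m : Labelling X M δ ι)

/-- The motion of the marked points, relative to the root, which is caused by a unit stretching of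
the edge below the vertex `A`. -/
def Labelling.vec (Δ : δ → ℤ × ℤ) (A : Finset X) (i : M) : ℤ × ℤ :=
  if m.pt i ∈ A then slopeOf (m.leafSlope Δ) A else 0

/-- The positions of the other marked points relative to the one at the root. -/
def Labelling.relPos : (ι → ℤ × ℤ) →+ (M → ℤ × ℤ) where
  toFun a i := a (m.mark (some i)) - a m.root
  map_zero' := by ext <;> simp
  map_add' a b := by
    funext i
    simp only [Pi.add_apply]
    abel

/-- The constant tuples. -/
def constHom (M : Type*) : (ℤ × ℤ) →+ (M → ℤ × ℤ) where
  toFun a _ := a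
  map_zero' := rfl
  map_add' _ _ := rfl

theorem Labelling.relPos_surjective : Function.Surjective m.relPos := by
  intro b
  refine ⟨fun i => match m.mark.symm i with
    | none => 0
    | some j => b j, funext fun i => ?_⟩
  simp [relPos, root]

variable {m} {C : Curve ι Δ} {σ : Finset (Finset X)} {l : Finset X → ℝ} {f : C.V → Finset X}

theorem ch_subset_iff {a B A : Finset X} (ha : a ∈ ch σ B) (hA : A ∈ σ) : a ⊂ A ↔ B ⊆ A :=
  ⟨(mem_ch.1 ha).2.2 A hA, fun h => (mem_ch.1 ha).2.1.trans_subset h⟩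

theorem IsHier.singleton_ssubset_iff (h : IsHier σ) {x : X} {A : Finset X} (hA : A ∈ σ) :
    {x} ⊂ A ↔ x ∈ A := by
  refine ⟨fun h' => h'.1 (Finset.mem_singleton_self x), fun hx => ?_⟩
  rw [Finset.ssubset_iff_subset_ne]
  exact ⟨by simpa using hx, fun e => h.singleton_notMem x (e ▸ hA)⟩

theorem Rep.subset_iff_pt_mem (h : Rep m C σ l f) (i : M) {A : Finset X} (hA : A ∈ σ) :
    f (C.att (Sum.inr (m.mark (some i)))) ⊆ A ↔ m.pt i ∈ A := by
  have h1 : {m.pt i} ∈ ch σ (f (C.att (Sum.inr (m.mark (some i))))) := by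
    rw [← m.leaf_pt]
    exact (h.cluster.leaf _ _).1 rfl
  rw [← ch_subset_iff h1 hA, h.hier.singleton_ssubset_iff hA]

theorem Rep.mem_coneLattice_iff (h : Rep m C σ l f) (a : C.V → ℤ × ℤ) :
    a ∈ C.coneLattice ↔ ∀ u v, f u ∈ ch σ (f v) →
      a u - a v ∈ AddSubgroup.zmultiples (slopeOf (m.leafSlope Δ) (f u)) := by
  constructor
  · intro H u v huv
    rw [← (h.slope_eq u v huv).2]
    exact H v u ((h.cluster.adj _ _).2 (Or.inr huv))
  · intro H u v huv
    rcases (h.cluster.adj _ _).1 huv with h1 | h1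
    · rw [(h.slope_eq u v h1).1, AddSubgroup.zmultiples_neg, ← neg_mem_iff, neg_sub]
      exact H u v h1
    · rw [(h.slope_eq v u h1).2]
      exact H v u h1

/-- An integral deformation of the curve is a translation together with an integral stretching of
each bounded edge; relative to the root only the stretchings are visible. -/
theorem Rep.map_evLattice (h : Rep m C σ l f) :
    C.evLattice.map m.relPos = AddSubgroup.closure (m.vec Δ '' σ) := by
  apply le_antisymm
  · rintro _ ⟨_, ⟨a, ha, rfl⟩, rfl⟩
    replace ha := (h.mem_coneLattice_iff a).1 ha
    have hex : ∀ A : Finset X, ∃ c : ℤ, ∀ u v, f u = A → f u ∈ ch σ (f v) →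
        a u = a v + c • slopeOf (m.leafSlope Δ) A := by
      intro A
      by_cases hA : ∃ u v, f u = A ∧ f u ∈ ch σ (f v)
      · obtain ⟨u, v, rfl, huv⟩ := hA
        obtain ⟨c, hc⟩ := AddSubgroup.mem_zmultiples_iff.1 (ha u v huv)
        refine ⟨c, fun u' v' h1 h2 => ?_⟩
        obtain rfl := h.cluster.inj h1
        obtain rfl := h.cluster.parent_unique h2 huv
        rw [hc]; abel
      · exact ⟨0, fun u v h1 h2 => absurd ⟨u, v, h1, h2⟩ hA⟩
    choose c hc using hex
    have h1 := h.cluster.eq_root_add_sum h.hier a (fun A => c A • slopeOf (m.leafSlope Δ) A)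
      fun u v huv => hc _ u v rfl huv
    have h2 : m.relPos (AddMonoidHom.pi (fun i => Pi.evalAddMonoidHom (fun _ : C.V => ℤ × ℤ)
        (C.att (Sum.inr i))) a) = ∑ A ∈ σ, c A • m.vec Δ A := by
      funext i
      simp only [Labelling.relPos, AddMonoidHom.coe_mk, ZeroHom.coe_mk, AddMonoidHom.pi_apply,
        Pi.evalAddMonoidHom_apply, Finset.sum_apply, Pi.smul_apply]
      rw [h1, add_sub_cancel_left, Finset.sum_filter]
      refine Finset.sum_congr rfl fun A hA => ?_
      simp only [h.subset_iff_pt_mem i hA, Labelling.vec]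
      split_ifs <;> simp
    rw [h2]
    exact sum_mem fun A hA =>
      zsmul_mem (AddSubgroup.subset_closure (Set.mem_image_of_mem _ hA)) _
  · rw [AddSubgroup.closure_le]
    rintro _ ⟨A, hA, rfl⟩
    have ha : (fun v => if f v ⊆ A then slopeOf (m.leafSlope Δ) A else 0) ∈ C.coneLattice := by
      refine (h.mem_coneLattice_iff _).2 fun u v huv => ?_
      by_cases h1 : f v ⊆ A
      · simp [h1, (mem_ch.1 huv).2.1.1.trans h1]
      · by_cases h2 : f u ⊆ A
        · have h3 : f u = A := by
            by_contra h3
            exact h1 ((ch_subset_iff huv hA).1 (Finset.ssubset_iff_subset_ne.2 ⟨h2, h3⟩))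
          simp [h1, h3]
        · simp [h1, h2]
    refine ⟨_, AddSubgroup.mem_map_of_mem _ ha, funext fun i => ?_⟩
    · have h1 : ¬ f (C.att (Sum.inr m.root)) ⊆ A := by
        rw [h.cluster.root, Finset.univ_subset_iff]
        exact (h.hier.1 A hA).2
      simp [Labelling.relPos, Labelling.vec, h1, h.subset_iff_pt_mem i hA]

/-- A motion of the root along its constraint shifts all relative positions by the same vector,
hence the constant tuples. -/
theorem Labelling.map_relPos_pi (T : ι → AddSubgroup (ℤ × ℤ)) :
    (AddSubgroup.pi Set.univ T).map m.relPos =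
      (T m.root).map (constHom M) ⊔ AddSubgroup.pi Set.univ fun i => T (m.mark (some i)) := by
  classical
  apply le_antisymm
  · rintro _ ⟨t, ht, rfl⟩
    have e : m.relPos t = constHom M (-t m.root) + fun i => t (m.mark (some i)) := by
      funext i
      simp [relPos, constHom, sub_eq_neg_add]
    rw [e]
    exact AddSubgroup.add_mem_sup ⟨_, neg_mem (ht m.root trivial), rfl⟩
      fun i _ => ht (m.mark (some i)) trivial
  · refine sup_le ?_ ?_
    · rintro _ ⟨u, hu, rfl⟩
      refine ⟨Pi.single m.root (-u), fun i _ => ?_, funext fun i => ?_⟩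
      · by_cases hi : i = m.root
        · subst hi; simpa using hu
        · simp [hi, zero_mem]
      · simp [relPos, constHom, root]
    · intro b hb
      refine ⟨fun i => match m.mark.symm i with
        | none => 0
        | some j => b j, fun i _ => ?_, funext fun i => by simp [relPos, root]⟩
      obtain ⟨_ | j, rfl⟩ := m.mark.surjective i
      · simp [zero_mem]
      · simpa using hb j trivial

/-- The kernel of `relPos` consists of the constant tuples, which come from translating the curve
and so lie in the evaluation lattice. Passing to the quotient preserves the index. -/
theorem Rep.index_evLattice_sup (h : Rep m C σ l f) (T : ι → AddSubgroup (ℤ × ℤ)) :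
    (C.evLattice ⊔ AddSubgroup.pi Set.univ T).index =
      (AddSubgroup.closure (m.vec Δ '' σ) ⊔ ((T m.root).map (constHom M) ⊔
        AddSubgroup.pi Set.univ fun i => T (m.mark (some i)))).index := by
  rw [← h.map_evLattice, ← Labelling.map_relPos_pi, ← AddSubgroup.map_sup,
    AddSubgroup.index_map_eq _ m.relPos_surjective]
  refine le_trans (fun a ha => ?_) le_sup_left
  refine ⟨fun _ => a m.root, fun u v _ => by simp [zero_mem], funext fun i => ?_⟩
  obtain ⟨_ | j, rfl⟩ := m.mark.surjective i
  · rfl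
  · exact (sub_eq_zero.1 (congrFun ha j)).symm

end EvLattice

/-! ### Solutions and multiplicities as combinatorial data. -/

section Solutions

variable {ι X M : Type} [Fintype ι] [Fintype X] [DecidableEq X] [Nontrivial X] {d : ℕ}
  (m : Labelling X M (Fin 3 × Fin d) ι) (ins : ι → Insertion) (Ξ : ι → ℝ × ℝ)

/-- The slopes of the leaves of a curve of degree `d`. -/
abbrev Labelling.slopes (x : X) : ℤ × ℤ := m.leafSlope (degreeEnds d) x

/-- The combinatorial type, the edge lengths and the position of the root of a solution. -/
structure IsSolData (z : Finset (Finset X) × (Finset X → ℝ) × (ℝ × ℝ)) : Prop where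
  type : IsType (ins m.root).psi z.1
  pos : ∀ A ∈ z.1, 0 < z.2.1 A
  zero : ∀ A ∉ z.1, z.2.1 A = 0
  root_mem : z.2.2 ∈ (ins m.root).kind.cycle (Ξ m.root)
  pt_mem : ∀ i, startPos m.slopes z.2.1 z.2.2 {m.pt i} ∈
    (ins (m.mark (some i))).kind.cycle (Ξ (m.mark (some i)))

/-- The multiplicity of a solution in terms of its combinatorial data. -/
noncomputable def solMult (z : Finset (Finset X) × (Finset X → ℝ) × (ℝ × ℝ)) : ℕ :=
  (AddSubgroup.closure (m.vec (degreeEnds d) '' z.1) ⊔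
    (((ins m.root).kind.tangent (Ξ m.root) z.2.2).map (constHom M) ⊔
      AddSubgroup.pi Set.univ fun i => (ins (m.mark (some i))).kind.tangent (Ξ (m.mark (some i)))
        (startPos m.slopes z.2.1 z.2.2 {m.pt i}))).index

variable {m ins Ξ}

theorem sum_degreeEnds (d : ℕ) : ∑ e, degreeEnds d e = 0 := by
  rw [Fintype.sum_prod_type]
  simp only [degreeEnds, Finset.sum_const, Fin.sum_univ_three, dir]
  ext <;> simp

variable {C : Curve ι (degreeEnds d)} {σ : Finset (Finset X)} {l : Finset X → ℝ} {f : C.V → Finset X}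

theorem Rep.isSolution_iff (h : Rep m C σ l f) (hk : ∀ i, i ≠ m.root → (ins i).psi = 0) :
    IsSolution ins Ξ C ↔ IsSolData m ins Ξ (σ, l, C.ev m.root) := by
  rw [IsSolution, h.inPsi_iff hk]
  constructor
  · rintro ⟨h1, h2⟩
    refine ⟨h1, fun A hA => h.length_pos hA, h.zero, h2 _, fun i => ?_⟩
    simp only
    rw [← h.ev_eq]
    exact h2 _
  · rintro ⟨h1, -, -, h2, h3⟩
    refine ⟨h1, fun i => ?_⟩
    obtain ⟨_ | j, rfl⟩ := m.mark.surjective i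
    · exact h2
    · rw [h.ev_eq]
      exact h3 j

theorem Rep.curveMultiplicity_eq (h : Rep m C σ l f) (hk : ∀ i, i ≠ m.root → (ins i).psi = 0) :
    curveMultiplicity ins Ξ C = solMult m ins Ξ (σ, l, C.ev m.root) := by
  rw [curveMultiplicity, psiWeight_eq_one C hk, one_mul, h.index_evLattice_sup, solMult]
  simp only [h.ev_eq]

open Classical in
/-- The count of solutions in terms of combinatorial data. -/
theorem hasCount_iff (hk : ∀ i, i ≠ m.root → (ins i).psi = 0) (N : ℚ) :
    HasCount d ins Ξ N ↔ ∃ S : Finset (Finset (Finset X) × (Finset X → ℝ) × (ℝ × ℝ)),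
      (∀ z, z ∈ S ↔ IsSolData m ins Ξ z) ∧
      N = (∑ z ∈ S, (solMult m ins Ξ z : ℚ)) / ((d.factorial : ℚ) ^ 3) := by
  constructor
  · rintro ⟨r, c, h1, h2, h3, rfl⟩
    choose σ l f hrep using fun a => exists_rep m (c a)
    have hinj : Function.Injective fun a => (σ a, l a, (c a).ev m.root) := by
      intro a b hab
      simp only [Prod.mk.injEq] at hab
      refine h2 a b ((hrep a).iso (f' := f b) ?_ hab.2.2)
      rw [hab.1, hab.2.1]; exact hrep b
    refine ⟨Finset.univ.image fun a => (σ a, l a, (c a).ev m.root), fun z => ?_, ?_⟩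
    · rw [Finset.mem_image]
      constructor
      · rintro ⟨a, -, rfl⟩
        exact ((hrep a).isSolution_iff hk).1 (h1 a)
      · intro hz
        have hrz := rep_curveOf (m := m) hz.type.1 z.2.1 hz.pos hz.zero (sum_degreeEnds d) z.2.2
        have hev := ev_root_curveOf (m := m) hz.type.1 z.2.1 hz.pos hz.zero (sum_degreeEnds d) z.2.2
        obtain ⟨a, ha⟩ := h3 _ ((hrz.isSolution_iff hk).2 (by rwa [hev]))
        obtain ⟨⟨g, hg⟩, he⟩ := (hrep a).of_iso ha
        obtain ⟨e1, e2⟩ := hrz.unique hg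
        refine ⟨a, Finset.mem_univ _, ?_⟩
        rw [← e1, ← e2, ← he, hev]
    · rw [Finset.sum_image fun a _ b _ h => hinj h]
      congr 1
      exact Finset.sum_congr rfl fun a _ => (hrep a).curveMultiplicity_eq hk
  · rintro ⟨S, hS, rfl⟩
    have hz : ∀ a, IsSolData m ins Ξ (S.equivFin.symm a).1 := fun a =>
      (hS _).1 (S.equivFin.symm a).2
    set c : Fin S.card → Curve ι (degreeEnds d) := fun a =>
      curveOf m (hz a).type.1 _ (hz a).pos (hz a).zero (sum_degreeEnds d)
        (S.equivFin.symm a).1.2.2 with hc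
    have hrep : ∀ a, Rep m (c a) (S.equivFin.symm a).1.1 (S.equivFin.symm a).1.2.1 Subtype.val :=
      fun a => rep_curveOf _ _ _ _ _ _
    have hev : ∀ a, (c a).ev m.root = (S.equivFin.symm a).1.2.2 :=
      fun a => ev_root_curveOf _ _ _ _ _ _
    refine ⟨S.card, c, fun a => ((hrep a).isSolution_iff hk).2 (by rw [hev]; exact hz a),
      fun a b hab => ?_, fun C hC => ?_, ?_⟩
    · obtain ⟨⟨g, hg⟩, he⟩ := (hrep b).of_iso hab
      obtain ⟨e1, e2⟩ := (hrep a).unique hg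
      have e3 := he m.root
      rw [hev, hev] at e3
      exact S.equivFin.symm.injective (Subtype.ext (Prod.ext e1 (Prod.ext e2 e3)))
    · obtain ⟨σ, l, f, h⟩ := exists_rep m C
      have hzC := (h.isSolution_iff hk).1 hC
      have hrC := hrep (S.equivFin ⟨_, (hS _).2 hzC⟩)
      have heC := hev (S.equivFin ⟨_, (hS _).2 hzC⟩)
      refine ⟨S.equivFin ⟨_, (hS _).2 hzC⟩, h.iso (f' := Subtype.val) ?_ ?_⟩
      · simp only [Equiv.symm_apply_apply] at hrC
        exact hrC
      · rw [heC]; simp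
    · congr 1
      rw [← Finset.sum_coe_sort, ← Equiv.sum_comp S.equivFin.symm]
      refine Finset.sum_congr rfl fun a _ => ?_
      rw [(hrep a).curveMultiplicity_eq hk, hev]

theorem HasCount.unique (m : Labelling X M (Fin 3 × Fin d) ι)
    (hk : ∀ i, i ≠ m.root → (ins i).psi = 0) {N N' : ℚ}
    (h : HasCount d ins Ξ N) (h' : HasCount d ins Ξ N') : N = N' := by
  obtain ⟨S, hS, rfl⟩ := (hasCount_iff (m := m) hk N).1 h
  obtain ⟨S', hS', rfl⟩ := (hasCount_iff (m := m) hk N').1 h'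
  rw [Finset.ext fun z => (hS z).trans (hS' z).symm]

end Solutions

/-! ### Counting cones of integral vectors at a generic point. -/

section Cells

variable {M : Type*} [Fintype M] [DecidableEq M] {Q : Type*} [Fintype Q] [DecidableEq Q]

/-- The real vectors which are given by the integral vectors `u`. -/
def realVec (u : Q → M → ℤ × ℤ) (q : Q) : M → ℝ × ℝ := castVec (u q)

theorem ConeCoord.unique {E : Type*} [AddCommGroup E] [Module ℝ E] {u : Q → E} {c : Finset Q}
    {x : E} {w w' : Q → ℝ} (hli : LinearIndependent ℝ fun q : c => u q) (h : ConeCoord u c x w)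
    (h' : ConeCoord u c x w') : w = w' := by
  have h1 : ∑ q : c, (w q - w' q) • u q = 0 := by
    rw [Finset.sum_coe_sort c fun q => (w q - w' q) • u q]
    simp only [sub_smul, Finset.sum_sub_distrib, ← h.sum_eq, ← h'.sum_eq, sub_self]
  funext q
  by_cases hq : q ∈ c
  · exact sub_eq_zero.1 (Fintype.linearIndependent_iff.1 hli _ h1 ⟨q, hq⟩)
  · rw [h.2.1 q hq, h'.2.1 q hq]

open Classical in
/-- The fan theorem for cones spanned by integral vectors, weighted by lattice indices. -/
theorem exists_generic_sum_index_eq (u : Q → M → ℤ × ℤ) (T : Finset (Finset Q))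
    (hcard : ∀ c ∈ T, c.card = 2 * Fintype.card M)
    (hbal : ∀ (τ : Finset Q) (D : Module.Dual ℝ (M → ℝ × ℝ)), (∀ q ∈ τ, D (realVec u q) = 0) →
      ∑ q with q ∉ τ ∧ insert q τ ∈ T, D (realVec u q) = 0) :
    ∃ N : ℕ, Generic (M → ℝ × ℝ) fun x =>
      ∑ c ∈ T, (if InCone (realVec u) c x then (AddSubgroup.closure (u '' c)).index else 0) = N := by
  choose D hD0 hD using exists_dual_abs_eq_index u
  obtain ⟨N, hN⟩ := exists_generic_sum_inCone_eq (u := realVec u) T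
    (fun c => ((AddSubgroup.closure (u '' c)).index : ℝ)) D
    (fun c hc => (hcard c hc).trans finrank_plane_pi.symm) hD0 (fun c hc q hq => by
      have hpos : 0 < c.card := Finset.card_pos.2 ⟨q, hq⟩
      have h1 := hD (c.erase q) (by
        rw [Finset.card_erase_of_mem hq, hcard c hc]
        have := hcard c hc
        omega) q
      rw [Finset.insert_erase hq] at h1
      exact h1) fun τ => hbal τ _ (hD0 τ)
  have hcast : ∀ x, ((∑ c ∈ T, (if InCone (realVec u) c x then
      (AddSubgroup.closure (u '' c)).index else 0) : ℕ) : ℝ) =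
      ∑ c ∈ T, (if InCone (realVec u) c x then
        ((AddSubgroup.closure (u '' c)).index : ℝ) else 0) := fun x => by
    push_cast
    rfl
  obtain ⟨x₀, hx₀⟩ := hN.exists
  refine ⟨∑ c ∈ T, (if InCone (realVec u) c x₀ then (AddSubgroup.closure (u '' c)).index else 0),
    hN.mono fun x hx => ?_⟩
  have h1 := (hcast x).trans (hx.trans (hx₀.symm.trans (hcast x₀).symm))
  exact_mod_cast h1

/-- The generators of a cone of full dimension with a generic point are linearly independent. -/
theorem generic_linearIndependent {E : Type*} [AddCommGroup E] [Module ℝ E] [FiniteDimensional ℝ E]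
    (u : Q → E) : Generic E fun x => ∀ c : Finset Q, c.card = Module.finrank ℝ E →
      InCone u c x → LinearIndependent ℝ fun q : c => u q := by
  refine Generic.all fun c => Generic.imp fun hc => ?_
  by_cases hli : LinearIndependent ℝ fun q : c => u q
  · exact Generic.of_forall fun _ _ => hli
  · have hne : Submodule.span ℝ (Set.range fun q : c => u q) ≠ ⊤ := fun h =>
      hli (linearIndependent_of_top_le_span_of_card_eq_finrank h.ge (by simpa using hc))
    refine (Generic.notMem hne).mono fun x hx ⟨w, hw⟩ => absurd ?_ hx
    rw [hw.sum_eq]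
    exact sum_mem fun q hq => Submodule.smul_mem _ _ (Submodule.subset_span ⟨⟨q, hq⟩, rfl⟩)

/-- A generic point does not lie on a cone of smaller dimension. -/
theorem generic_not_inCone {E : Type*} [AddCommGroup E] [Module ℝ E] [FiniteDimensional ℝ E]
    (u : Q → E) : Generic E fun x => ∀ c : Finset Q, c.card < Module.finrank ℝ E →
      ¬ InCone u c x := by
  refine Generic.all fun c => Generic.imp fun hc => ?_
  have hne : Submodule.span ℝ (Set.range fun q : c => u q) ≠ ⊤ := fun h => by
    have := finrank_range_le_card (R := ℝ) fun q : c => u q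
    rw [Set.finrank, h, finrank_top, Fintype.card_coe] at this
    omega
  refine (Generic.notMem hne).mono fun x hx ⟨w, hw⟩ => absurd ?_ hx
  rw [hw.sum_eq]
  exact sum_mem fun q hq => Submodule.smul_mem _ _ (Submodule.subset_span ⟨⟨q, hq⟩, rfl⟩)

open Classical in
/-- If the objects `P` correspond to the cones in `T` which contain `x`, then their number, counted
with multiplicity, is a sum over `T`. -/
theorem exists_finset_sum_eq_of_cells {E : Type*} [AddCommGroup E] [Module ℝ E] (u : Q → E)
    (T : Finset (Finset Q)) (x : E)
    (hli : ∀ c ∈ T, InCone u c x → LinearIndependent ℝ fun q : c => u q)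
    {Z : Type*} (P : Z → Prop) (mult : Z → ℕ) (μ : Finset Q → ℕ) (G : Finset Q → (Q → ℝ) → Z)
    (h1 : ∀ c ∈ T, ∀ w, ConeCoord u c x w → P (G c w) ∧ mult (G c w) = μ c)
    (h2 : ∀ z, P z → ∃ c ∈ T, ∃ w, ConeCoord u c x w ∧ G c w = z)
    (h3 : ∀ c ∈ T, ∀ c' ∈ T, ∀ w w', ConeCoord u c x w → ConeCoord u c' x w' →
      G c w = G c' w' → c = c') :
    ∃ S : Finset Z, (∀ z, z ∈ S ↔ P z) ∧
      ∑ z ∈ S, mult z = ∑ c ∈ T, if InCone u c x then μ c else 0 := by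
  have hex : ∀ c : Finset Q, ∃ w, InCone u c x → ConeCoord u c x w := fun c => by
    by_cases h : InCone u c x
    · exact ⟨h.choose, fun _ => h.choose_spec⟩
    · exact ⟨0, fun h' => absurd h' h⟩
  choose w hw using hex
  refine ⟨(T.filter fun c => InCone u c x).image fun c => G c (w c), fun z => ?_, ?_⟩
  · simp only [Finset.mem_image, Finset.mem_filter]
    constructor
    · rintro ⟨c, ⟨hc, hcx⟩, rfl⟩
      exact (h1 c hc _ (hw c hcx)).1
    · intro hz
      obtain ⟨c, hc, w', hw', rfl⟩ := h2 z hz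
      exact ⟨c, ⟨hc, ⟨w', hw'⟩⟩, by
        rw [(hw c ⟨w', hw'⟩).unique (hli c hc ⟨w', hw'⟩) hw']⟩
  · rw [Finset.sum_image, Finset.sum_filter]
    · refine Finset.sum_congr rfl fun c hc => ?_
      split_ifs with hcx
      · exact (h1 c hc _ (hw c hcx)).2
      · rfl
    · intro c hc c' hc' he
      rw [Finset.mem_coe, Finset.mem_filter] at hc hc'
      exact h3 c hc.1 c' hc'.1 _ _ (hw c hc.2) (hw c' hc'.2) he

end Cells

/-! ### Directions and tangent lattices of a tropical line. -/

section Plane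

theorem dir_ne_zero (j : Fin 3) : dir j ≠ 0 := by
  fin_cases j <;> simp [dir]

theorem sum_dir : ∑ j, dir j = 0 := by
  simp [Fin.sum_univ_three, dir]

theorem toReal_zero : toReal 0 = 0 := by simp [toReal]

theorem smul_dir_injective {s t : ℝ} {i j : Fin 3} (hs : 0 < s) (ht : 0 < t)
    (h : s • toReal (dir i) = t • toReal (dir j)) : i = j ∧ s = t := by
  fin_cases i <;> fin_cases j <;> simp [toReal, dir] at h <;>
    first
      | exact ⟨rfl, by linarith⟩
      | (exfalso; linarith [h.1, h.2])

/-- The tangent lattice of a tropical line in the interior of a ray. -/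
theorem tangent_line {q : ℝ × ℝ} {t : ℝ} (ht : 0 < t) (j : Fin 3) :
    Kind.line.tangent q (q + t • toReal (dir j)) = AddSubgroup.closure {dir j} := by
  rw [Kind.tangent]
  congr 1
  ext u
  simp only [Set.mem_ofPred_eq, Set.mem_singleton_iff]
  constructor
  · rintro ⟨i, rfl, s, hs, h⟩
    rw [(smul_dir_injective ht hs (add_left_cancel h)).1]
  · rintro rfl
    exact ⟨j, rfl, t, ht, rfl⟩

end Plane

/-! ### Invariance of the counts with one special insertion. -/

section OneInsertion

variable {ι X M : Type} [Fintype ι] [Fintype X] [DecidableEq X] [Nontrivial X] [Fintype M]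
  [DecidableEq M] {d : ℕ} (m : Labelling X M (Fin 3 × Fin d) ι)

/-- The motions of the marked points for the curves of degree `d`. -/
abbrev Labelling.vecs (A : Finset X) : M → ℤ × ℤ := m.vec (degreeEnds d) A

/-- The positions of the other constraints relative to the one at the root. -/
def Labelling.relReal : (ι → ℝ × ℝ) →ₗ[ℝ] (M → ℝ × ℝ) where
  toFun a i := a (m.mark (some i)) - a m.root
  map_add' a b := by
    funext i
    simp only [Pi.add_apply]
    abel
  map_smul' c a := by
    funext i
    simp [smul_sub]

theorem Labelling.relReal_apply (a : ι → ℝ × ℝ) (i : M) :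
    m.relReal a i = a (m.mark (some i)) - a m.root := rfl

theorem Labelling.relReal_surjective : Function.Surjective m.relReal := by
  intro b
  refine ⟨fun i => match m.mark.symm i with
    | none => 0
    | some j => b j, funext fun i => ?_⟩
  simp [relReal, root]

variable {m}

/-- The path from the root to the marked point `i` runs through the edges below the vertices `A`
that contain it, so relative positions are linear in the lengths. -/
theorem startPos_pt {σ : Finset (Finset X)} (h : IsHier σ) {l : Finset X → ℝ}
    (hl : ∀ A ∉ σ, l A = 0) (p : ℝ × ℝ) (i : M) :
    startPos m.slopes l p {m.pt i} = p + (∑ A, l A • realVec m.vecs A) i := by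
  rw [startPos, Finset.sum_apply, Finset.sum_filter]
  congr 1
  refine Finset.sum_congr rfl fun A _ => ?_
  by_cases hA : A ∈ σ
  · simp only [h.singleton_ssubset_iff hA, Pi.smul_apply, realVec, castVec_apply, Labelling.vecs,
      Labelling.vec]
    split_ifs
    · rfl
    · rw [toReal_zero, smul_zero]
  · simp [hl A hA]

open Classical in
-- Let `β x y` be `D` of the slope of `x`, placed at the marked points labelled `y`; then `D` of the
-- vector of `A` is the sum of `β` over `A × A`. The diagonal vanishes because marked points have
-- slope zero, the total because all slopes sum to zero.
theorem sum_dual_vecs_eq_zero (k : ℕ) (D : Module.Dual ℝ (M → ℝ × ℝ)) (τ : Finset (Finset X))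
    (hτ : ∀ A ∈ τ, D (realVec m.vecs A) = 0) :
    ∑ A with A ∉ τ ∧ IsType k (insert A τ), D (realVec m.vecs A) = 0 := by
  set β : X → X → ℝ := fun x y => D (castVec fun i => if m.pt i = y then m.slopes x else 0) with hβ
  have hD : ∀ A : Finset X, D (realVec m.vecs A) = ∑ x ∈ A, ∑ y ∈ A, β x y := by
    intro A
    simp only [hβ]
    rw [realVec]
    simp only [← map_sum]
    congr 2
    funext i
    simp only [Finset.sum_apply, Finset.sum_ite_eq, Labelling.vecs, Labelling.vec]
    split_ifs
    · rfl
    · simp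
  simp only [hD] at hτ ⊢
  refine sum_resolutions_eq_zero k β (fun x => ?_) ?_ τ hτ _ fun A => by simp
  · have : (fun i => if m.pt i = x then m.slopes x else 0) = (0 : M → ℤ × ℤ) := by
      funext i
      split_ifs with hi
      · rw [← hi]; exact m.leafSlope_pt _ i
      · rfl
    simp only [hβ, this, map_zero]
  · rw [← hD]
    have : m.vecs Finset.univ = 0 := by
      funext i
      simp only [Labelling.vecs, Labelling.vec, slopeOf, m.sum_leafSlope, sum_degreeEnds, ite_self]
      rfl
    rw [realVec, this, map_zero, map_zero]

variable {ins : ι → Insertion}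

/-- The count of curves through points, with a power of `ψ` at one of them, is the same for all
generic points. -/
theorem exists_generic_hasCount_point (hk : ∀ i, i ≠ m.root → (ins i).psi = 0)
    (hins : ∀ i, (ins i).kind = Kind.point)
    (hcard : Fintype.card X = 2 * Fintype.card M + (ins m.root).psi + 2) :
    ∃ N : ℚ, Generic (ι → ℝ × ℝ) fun Ξ => HasCount d ins Ξ N := by
  classical
  set T : Finset (Finset (Finset X)) :=
    Finset.univ.filter fun σ => IsType (ins m.root).psi σ with hT
  -- The dimension condition: as many bounded edges as coordinates of relative positions.
  have hTc : ∀ c ∈ T, c.card = 2 * Fintype.card M := by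
    intro c hc
    have := (Finset.mem_filter.1 hc).2.card_eq
    omega
  obtain ⟨N, hN⟩ := exists_generic_sum_index_eq m.vecs T hTc fun τ D hD => by
    simp only [hT, Finset.mem_filter, Finset.mem_univ, true_and]
    exact sum_dual_vecs_eq_zero _ D τ hD
  refine ⟨N / ((d.factorial : ℚ) ^ 3), ((hN.and (generic_linearIndependent (realVec m.vecs))).comap
    m.relReal m.relReal_surjective).mono fun Ξ ⟨h1, h2⟩ => (hasCount_iff (m := m) hk _).2 ?_⟩
  refine (exists_finset_sum_eq_of_cells (realVec m.vecs) T (m.relReal Ξ)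
    (fun c hc hx => h2 c ((hTc c hc).trans finrank_plane_pi.symm) hx) (IsSolData m ins Ξ)
    (solMult m ins Ξ) (fun c => (AddSubgroup.closure (m.vecs '' c)).index)
    (fun c w => (c, w, Ξ m.root)) ?_ ?_ ?_).imp fun S hS => ⟨hS.1, ?_⟩
  · intro c hc w hw
    have hct := (Finset.mem_filter.1 hc).2
    refine ⟨⟨hct, hw.1, hw.2.1, ?_, fun i => ?_⟩, ?_⟩
    · rw [hins]; rfl
    · rw [hins]
      change startPos m.slopes w (Ξ m.root) {m.pt i} = Ξ _
      rw [startPos_pt hct.1 hw.2.1, ← hw.2.2, m.relReal_apply, add_sub_cancel]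
    · simp only [solMult, hins, Kind.tangent, AddSubgroup.map_bot, AddSubgroup.pi_bot, sup_bot_eq]
  · rintro ⟨σ, l, p⟩ ⟨h3, h4, h5, h6, h7⟩
    simp only [hins] at h3 h4 h5 h6 h7
    have hp : p = Ξ m.root := h6
    subst hp
    refine ⟨σ, Finset.mem_filter.2 ⟨Finset.mem_univ _, h3⟩, l, ⟨h4, h5, funext fun i => ?_⟩, rfl⟩
    have h8 : startPos m.slopes l (Ξ m.root) {m.pt i} = Ξ (m.mark (some i)) := h7 i
    rw [m.relReal_apply, ← h8, startPos_pt h3.1 h5, add_sub_cancel_left]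
  · intro c _ c' _ w w' _ _ he
    exact congrArg Prod.fst he
  · rw [← h1, ← hS.2, Nat.cast_sum]

variable (m) in
/-- The directions of the cones for curves with a line constraint at the root. -/
def Labelling.vecsLine : Finset X ⊕ Fin 3 → M → ℤ × ℤ := Sum.elim m.vecs fun j _ => dir j

theorem sum_realVec_vecsLine (w : Finset X ⊕ Fin 3 → ℝ) (i : M) :
    (∑ q, w q • realVec (m.vecsLine) q) i =
      (∑ A, w (Sum.inl A) • realVec m.vecs A) i + ∑ j, w (Sum.inr j) • toReal (dir j) := by
  rw [Fintype.sum_sum_type, Pi.add_apply, Finset.sum_apply _ _ fun j : Fin 3 => _]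
  rfl

open Classical in
-- The fan is the product of the fan of trees with the tropical line. A wall lacks either an edge,
-- and balancing of trees applies, or the ray of the line, and the three directions sum to zero.
theorem sum_dual_vecsLine_eq_zero (k : ℕ) (D : Module.Dual ℝ (M → ℝ × ℝ))
    (τ : Finset (Finset X ⊕ Fin 3)) (hτ : ∀ q ∈ τ, D (realVec m.vecsLine q) = 0) :
    ∑ q with q ∉ τ ∧ IsType k (insert q τ).toLeft ∧ (insert q τ).toRight.card = 1,
      D (realVec m.vecsLine q) = 0 := by
  rw [Finset.sum_filter, Fintype.sum_sum_type]
  simp only [Finset.toLeft_insert_inl, Finset.toLeft_insert_inr, Finset.toRight_insert_inl,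
    Finset.toRight_insert_inr]
  have h1 : ∑ A : Finset X, (if Sum.inl A ∉ τ ∧ IsType k (insert A τ.toLeft) ∧ τ.toRight.card = 1
      then D (realVec m.vecsLine (Sum.inl A)) else 0) = 0 := by
    by_cases hc : τ.toRight.card = 1
    · refine Eq.trans ?_ (sum_dual_vecs_eq_zero (m := m) k D τ.toLeft fun A hA =>
        hτ (Sum.inl A) (Finset.mem_toLeft.1 hA))
      rw [Finset.sum_filter]
      simp only [hc, and_true, Finset.mem_toLeft]
      rfl
    · simp [hc]
  rw [h1, zero_add]
  by_cases hc : τ.toRight = ∅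
  · have h2 : ∀ j, Sum.inr j ∉ τ := fun j hj => by
      have := Finset.mem_toRight.2 hj
      simp [hc] at this
    by_cases ht : IsType k τ.toLeft
    · simp only [h2, not_false_eq_true, ht, hc, insert_empty_eq, Finset.card_singleton, and_self,
        if_true, ← map_sum]
      have : ∑ j, realVec m.vecsLine (Sum.inr j) = 0 := by
        simp only [realVec, ← map_sum]
        rw [show ∑ j, m.vecsLine (Sum.inr j) = 0 by
          funext i
          rw [Finset.sum_apply]
          exact sum_dir, map_zero]
      rw [this, map_zero]
    · simp [ht]
  · refine Finset.sum_eq_zero fun j _ => if_neg ?_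
    rintro ⟨h2, -, h3⟩
    rw [Finset.card_insert_of_notMem fun h => h2 (Finset.mem_toRight.1 h)] at h3
    exact hc (Finset.card_eq_zero.1 (by omega))

theorem closure_vecsLine (c : Finset (Finset X ⊕ Fin 3)) {j : Fin 3} (hj : c.toRight = {j}) :
    AddSubgroup.closure (m.vecsLine '' c) = AddSubgroup.closure (m.vecs '' c.toLeft) ⊔
      (AddSubgroup.closure {dir j}).map (constHom M) := by
  rw [AddMonoidHom.map_closure, ← AddSubgroup.closure_union, Set.image_singleton]
  congr 1
  ext a
  simp only [Set.mem_image, Set.mem_union, Finset.mem_coe, Sum.exists, Set.mem_singleton_iff,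
    Finset.mem_toLeft]
  refine or_congr Iff.rfl ?_
  constructor
  · rintro ⟨i, hi, rfl⟩
    rw [← Finset.mem_toRight, hj, Finset.mem_singleton] at hi
    rw [hi]; rfl
  · rintro rfl
    exact ⟨j, by rw [← Finset.mem_toRight, hj, Finset.mem_singleton], rfl⟩

section

variable {Ξ : ι → ℝ × ℝ} {σ : Finset (Finset X)} {l : Finset X → ℝ} {p : ℝ × ℝ} {j : Fin 3} {t : ℝ}

theorem IsSolData.exists_line (h : IsSolData m ins Ξ (σ, l, p))
    (hroot : (ins m.root).kind = Kind.line) :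
    ∃ (j : Fin 3) (t : ℝ), 0 ≤ t ∧ p = Ξ m.root + t • toReal (dir j) := by
  have := h.root_mem
  rw [hroot] at this
  obtain ⟨j, t, ht, hp⟩ := this
  exact ⟨j, t, ht, hp⟩

theorem sum_single_smul_dir (j : Fin 3) (t : ℝ) :
    ∑ i, (Pi.single j t : Fin 3 → ℝ) i • toReal (dir i) = t • toReal (dir j) := by
  rw [Finset.sum_eq_single j (fun i _ hi => by rw [Pi.single_eq_of_ne hi, zero_smul]) (by simp),
    Pi.single_eq_same]

theorem IsSolData.relReal_eq (h : IsSolData m ins Ξ (σ, l, p))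
    (hins : ∀ i, (ins (m.mark (some i))).kind = Kind.point)
    (hp : p = Ξ m.root + t • toReal (dir j)) :
    m.relReal Ξ = ∑ q, (Sum.elim l (Pi.single j t) : Finset X ⊕ Fin 3 → ℝ) q •
      realVec m.vecsLine q := by
  funext i
  have h7 := h.pt_mem i
  rw [hins] at h7
  have h8 : startPos m.slopes l p {m.pt i} = Ξ (m.mark (some i)) := h7
  rw [m.relReal_apply, ← h8, startPos_pt h.type.1 h.zero, sum_realVec_vecsLine]
  simp only [Sum.elim_inl, Sum.elim_inr, sum_single_smul_dir, hp]
  abel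

theorem IsSolData.coneCoord (h : IsSolData m ins Ξ (σ, l, p))
    (hins : ∀ i, (ins (m.mark (some i))).kind = Kind.point)
    (hp : p = Ξ m.root + t • toReal (dir j)) (ht : 0 < t) :
    ConeCoord (realVec m.vecsLine) (σ.disjSum {j}) (m.relReal Ξ) (Sum.elim l (Pi.single j t)) := by
  refine ⟨fun q hq => ?_, fun q hq => ?_, h.relReal_eq hins hp⟩
  · rcases q with A | i
    · exact h.pos A (by simpa using hq)
    · have : i = j := by simpa using hq
      subst this
      simpa using ht
  · rcases q with A | i
    · exact h.zero A (by simpa using hq)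
    · have : i ≠ j := by simpa using hq
      simp [this]

/-- With the root at the vertex of its line, the relative positions would lie in a cone with only
`σ.card = 2 * card M - 1` generators. -/
theorem IsSolData.pos_of_generic (h : IsSolData m ins Ξ (σ, l, p))
    (hins : ∀ i, (ins (m.mark (some i))).kind = Kind.point)
    (hcard : Fintype.card X = 2 * Fintype.card M + (ins m.root).psi + 1)
    (h0 : ∀ c : Finset (Finset X ⊕ Fin 3), c.card < Module.finrank ℝ (M → ℝ × ℝ) →
      ¬ InCone (realVec m.vecsLine) c (m.relReal Ξ))
    (hp : p = Ξ m.root + t • toReal (dir j)) (ht : 0 ≤ t) : 0 < t := by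
  refine ht.lt_of_ne fun ht0 => ?_
  refine h0 (σ.disjSum ∅) ?_ ⟨_, fun q hq => ?_, fun q hq => ?_, h.relReal_eq hins hp⟩
  · rw [Finset.card_disjSum, Finset.card_empty, finrank_plane_pi]
    have := h.type.card_eq
    simp only at this
    omega
  · rcases q with A | i
    · exact h.pos A (by simpa using hq)
    · simp at hq
  · rcases q with A | i
    · exact h.zero A (by simpa using hq)
    · simp [← ht0]

end

/-- The count of curves through points, with a line constraint and a power of `ψ` at another marked
point, is the same for all generic constraints. -/
theorem exists_generic_hasCount_line (hk : ∀ i, i ≠ m.root → (ins i).psi = 0)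
    (hroot : (ins m.root).kind = Kind.line)
    (hins : ∀ i, (ins (m.mark (some i))).kind = Kind.point)
    (hcard : Fintype.card X = 2 * Fintype.card M + (ins m.root).psi + 1) :
    ∃ N : ℚ, Generic (ι → ℝ × ℝ) fun Ξ => HasCount d ins Ξ N := by
  classical
  set T : Finset (Finset (Finset X ⊕ Fin 3)) :=
    Finset.univ.filter fun c => IsType (ins m.root).psi c.toLeft ∧ c.toRight.card = 1 with hT
  have hTc : ∀ c ∈ T, c.card = 2 * Fintype.card M := by
    intro c hc
    have h1 := (Finset.mem_filter.1 hc).2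
    have h2 := h1.1.card_eq
    rw [← Finset.card_toLeft_add_card_toRight, h1.2]
    omega
  obtain ⟨N, hN⟩ := exists_generic_sum_index_eq m.vecsLine T hTc fun τ D hD => by
    simp only [hT, Finset.mem_filter, Finset.mem_univ, true_and]
    exact sum_dual_vecsLine_eq_zero _ D τ hD
  refine ⟨N / ((d.factorial : ℚ) ^ 3), ((hN.and ((generic_linearIndependent
    (realVec m.vecsLine)).and (generic_not_inCone (realVec m.vecsLine)))).comap
    m.relReal m.relReal_surjective).mono fun Ξ ⟨h1, h2, h0⟩ => (hasCount_iff (m := m) hk _).2 ?_⟩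
  have hsum1 : ∀ (w : Finset X ⊕ Fin 3 → ℝ) (j : Fin 3), (∀ i, i ≠ j → w (Sum.inr i) = 0) →
      ∑ i, w (Sum.inr i) • toReal (dir i) = w (Sum.inr j) • toReal (dir j) := fun w j hw =>
    Finset.sum_eq_single j (fun i _ hi => by rw [hw i hi, zero_smul]) (by simp)
  have hcell : ∀ c ∈ T, ∀ w, ConeCoord (realVec m.vecsLine) c (m.relReal Ξ) w →
      ∃ j, c.toRight = {j} ∧ 0 < w (Sum.inr j) ∧
        ∑ i, w (Sum.inr i) • toReal (dir i) = w (Sum.inr j) • toReal (dir j) := by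
    intro c hc w hw
    obtain ⟨j, hj⟩ := Finset.card_eq_one.1 (Finset.mem_filter.1 hc).2.2
    refine ⟨j, hj, hw.1 _ ?_, hsum1 w j fun i hi => hw.2.1 _ ?_⟩
    · rw [← Finset.mem_toRight, hj, Finset.mem_singleton]
    · rwa [← Finset.mem_toRight, hj, Finset.mem_singleton]
  refine (exists_finset_sum_eq_of_cells (realVec m.vecsLine) T (m.relReal Ξ)
    (fun c hc hx => h2 c ((hTc c hc).trans finrank_plane_pi.symm) hx) (IsSolData m ins Ξ)
    (solMult m ins Ξ) (fun c => (AddSubgroup.closure (m.vecsLine '' c)).index)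
    (fun c w => (c.toLeft, fun A => w (Sum.inl A),
      Ξ m.root + ∑ j, w (Sum.inr j) • toReal (dir j))) ?_ ?_ ?_).imp
    fun S hS => ⟨hS.1, ?_⟩
  · intro c hc w hw
    have hct := (Finset.mem_filter.1 hc).2.1
    have hl : ∀ A ∉ c.toLeft, w (Sum.inl A) = 0 := fun A hA =>
      hw.2.1 _ fun h => hA (Finset.mem_toLeft.2 h)
    obtain ⟨j, hj, hjpos, hjsum⟩ := hcell c hc w hw
    refine ⟨⟨hct, fun A hA => hw.1 _ (Finset.mem_toLeft.1 hA), hl, ?_, fun i => ?_⟩, ?_⟩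
    · rw [hroot]
      exact ⟨j, _, hjpos.le, by rw [hjsum]⟩
    · rw [hins]
      change startPos m.slopes _ _ {m.pt i} = Ξ _
      have h3 := congrFun hw.2.2 i
      rw [sum_realVec_vecsLine, m.relReal_apply, sub_eq_iff_eq_add] at h3
      rw [startPos_pt hct.1 hl, h3]
      ring
    · simp only [solMult, hins, hroot, Kind.tangent, AddSubgroup.pi_bot, sup_bot_eq]
      rw [hjsum]
      have := tangent_line (q := Ξ m.root) hjpos j
      rw [Kind.tangent] at this
      rw [this, closure_vecsLine c hj]
  · rintro ⟨σ, l, p⟩ hz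
    obtain ⟨j, t, ht, hp⟩ := hz.exists_line hroot
    subst hp
    have ht' := hz.pos_of_generic (j := j) (t := t) hins hcard h0 rfl ht
    refine ⟨σ.disjSum {j}, Finset.mem_filter.2 ⟨Finset.mem_univ _, by simpa using hz.type⟩,
      _, hz.coneCoord (j := j) (t := t) hins rfl ht', ?_⟩
    rw [hsum1 _ j fun i hi => by simp [hi]]
    simp
  · intro c hc c' hc' w w' hw hw' he
    obtain ⟨j, hj, hjpos, hjsum⟩ := hcell c hc w hw
    obtain ⟨j', hj', hjpos', hjsum'⟩ := hcell c' hc' w' hw'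
    simp only [Prod.mk.injEq] at he
    rw [hjsum, hjsum'] at he
    have h3 := (smul_dir_injective hjpos hjpos' (add_left_cancel he.2.2)).1
    rw [← Finset.toLeft_disjSum_toRight (u := c), ← Finset.toLeft_disjSum_toRight (u := c'), he.1,
      hj, hj', h3]
  · rw [← h1, ← hS.2, Nat.cast_sum]

end OneInsertion

/-! ### Edge lengths under an injective relabelling. -/

section PushLength

variable {X : Type*} [Fintype X] [DecidableEq X]

/-- The lengths of the edges `g A`, `A ∈ σ`, which are given by `c`. -/
noncomputable def pushLen {Y : Type*} [DecidableEq Y] (g : X → Y) (σ : Finset X) (c : X → ℝ)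
    (y : Y) : ℝ := ∑ A ∈ σ with g A = y, c A

variable {Y : Type*} [DecidableEq Y] {g : X → Y} {σ : Finset X} {c : X → ℝ}

theorem pushLen_apply (hg : Function.Injective g) {A : X} (hA : A ∈ σ) :
    pushLen g σ c (g A) = c A := by
  rw [pushLen, Finset.sum_filter, Finset.sum_eq_single A]
  · simp
  · intro B _ hB
    rw [if_neg fun h => hB (hg h)]
  · exact fun h => absurd hA h

theorem pushLen_of_notMem {y : Y} (hy : y ∉ σ.image g) : pushLen g σ c y = 0 := by
  rw [pushLen, Finset.filter_false_of_mem, Finset.sum_empty]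
  rintro A hA rfl
  exact hy (Finset.mem_image_of_mem _ hA)

theorem sum_pushLen_smul [Fintype Y] {E : Type*} [AddCommGroup E] [Module ℝ E] (v : Y → E) :
    ∑ y, pushLen g σ c y • v y = ∑ A ∈ σ, c A • v (g A) := by
  simp only [pushLen, Finset.sum_filter, Finset.sum_smul, ite_smul, zero_smul]
  rw [Finset.sum_comm]
  simp

theorem eq_pushLen (hg : Function.Injective g) {l : Y → ℝ} (hl : ∀ y ∉ σ.image g, l y = 0) :
    l = pushLen g σ fun A => l (g A) := by
  funext y
  by_cases hy : y ∈ σ.image g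
  · obtain ⟨A, hA, rfl⟩ := Finset.mem_image.1 hy
    rw [pushLen_apply hg hA]
  · rw [hl y hy, pushLen_of_notMem hy]

end PushLength

/-! ### Edge lengths and positions after adding a leaf. -/

section Forget

variable {X : Type} [Fintype X] [DecidableEq X] {s : X → ℤ × ℤ} {s' : Option X → ℤ × ℤ}

theorem slopeOf_insertNone (h0 : s' none = 0) (hs : ∀ x, s' (some x) = s x) (A : Finset X) :
    slopeOf s' (Finset.insertNone A) = slopeOf s A := by
  simp [slopeOf, h0, hs, Finset.sum_insertNone]

theorem slopeOf_plus (h0 : s' none = 0) (hs : ∀ x, s' (some x) = s x) (P A : Finset X) :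
    slopeOf s' (plus P A) = slopeOf s A := by
  rw [plus]
  split_ifs
  · exact slopeOf_insertNone h0 hs A
  · simp [slopeOf, hs]

theorem singleton_none_ssubset_insertNone {A : Finset X} (hA : A.Nonempty) :
    {none} ⊂ Finset.insertNone A := by
  obtain ⟨x, hx⟩ := hA
  rw [Finset.ssubset_iff_of_subset (by simp)]
  exact ⟨some x, by simpa using hx, by simp⟩

theorem singleton_some_ssubset_insertNone {A : Finset X} {x : X} :
    {some x} ⊂ Finset.insertNone A ↔ x ∈ A := by
  constructor
  · intro h
    simpa using h.1 (Finset.mem_singleton_self (some x))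
  · intro hx
    rw [Finset.ssubset_iff_of_subset (by simpa using hx)]
    exact ⟨none, by simp, by simp⟩

theorem singleton_some_ssubset_plus {P A : Finset X} (hA : 2 ≤ A.card) {x : X} :
    {some x} ⊂ plus P A ↔ x ∈ A := by
  constructor
  · intro h
    exact some_mem_plus.1 (h.1 (Finset.mem_singleton_self (some x)))
  · intro hx
    rw [Finset.ssubset_iff_of_subset (by simpa using some_mem_plus.2 hx)]
    obtain ⟨y, hy, hyx⟩ := Finset.exists_mem_ne hA x
    exact ⟨some y, some_mem_plus.2 hy, by simpa using hyx⟩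

theorem startPos_eq_sum (l : Finset X → ℝ) (p : ℝ × ℝ) (B : Finset X) :
    startPos s l p B = p + ∑ A, l A • (if B ⊂ A then toReal (slopeOf s A) else 0) := by
  simp only [startPos, Finset.sum_filter, smul_ite, smul_zero]

theorem startPos_eq_sum_mem {σ : Finset (Finset X)} {l : Finset X → ℝ} (hl : ∀ A ∉ σ, l A = 0)
    (p : ℝ × ℝ) (B : Finset X) :
    startPos s l p B = p + ∑ A ∈ σ, l A • (if B ⊂ A then toReal (slopeOf s A) else 0) := by
  rw [startPos_eq_sum]
  congr 1
  exact (Finset.sum_subset (Finset.subset_univ σ) fun A _ hA => by simp [hl A hA]).symm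

variable [Nontrivial X] {σ : Finset (Finset X)} {l : Finset X → ℝ}

theorem startPos_att_none (hσ : IsHier σ) (l : Finset X → ℝ) (p : ℝ × ℝ) :
    startPos s' (pushLen (plus Finset.univ) σ l) p {none} = p := by
  rw [startPos_eq_sum, sum_pushLen_smul, Finset.sum_eq_zero, add_zero]
  intro A hA
  rw [if_neg, smul_zero]
  intro h
  have h1 := none_mem_plus.1 (h.1 (Finset.mem_singleton_self none))
  exact (hσ.1 A hA).2 (Finset.univ_subset_iff.1 h1)

theorem startPos_att_some (h0 : s' none = 0) (hs : ∀ x, s' (some x) = s x) (hσ : IsHier σ)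
    (hl : ∀ A ∉ σ, l A = 0) (P : Finset X) (p : ℝ × ℝ) (x : X) :
    startPos s' (pushLen (plus P) σ l) p {some x} = startPos s l p {x} := by
  rw [startPos_eq_sum, sum_pushLen_smul, startPos_eq_sum_mem hl]
  congr 1
  refine Finset.sum_congr rfl fun A hA => ?_
  rw [slopeOf_plus h0 hs]
  simp only [singleton_some_ssubset_plus (hσ.1 A hA).1, hσ.singleton_ssubset_iff hA]

open Classical in
/-- The lengths of the edges after attaching a leaf at distance `t` from the lower end of the edge
below `B`, which is adjacent to the vertex `P`. -/
noncomputable def graftLen (σ : Finset (Finset X)) (P B : Finset X) (l : Finset X → ℝ) (t : ℝ)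
    (A : Finset (Option X)) : ℝ :=
  -- A bounded edge below `B` is cut into a lower piece `insertNone B` of length `t` and an upper
  -- piece `plus P B` of length `l B - t`. If `B` is a leaf, no upper length is recorded.
  (if A = Finset.insertNone B then t else 0) +
    pushLen (plus P) σ (fun A => l A - if A = B then t else 0) A

theorem sum_graftLen_smul {E : Type*} [AddCommGroup E] [Module ℝ E] (P B : Finset X)
    (t : ℝ) (v : Finset (Option X) → E) :
    ∑ A, graftLen σ P B l t A • v A = t • v (Finset.insertNone B) +
      (∑ A ∈ σ, l A • v (plus P A) - if B ∈ σ then t • v (plus P B) else 0) := by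
  simp only [graftLen, add_smul, Finset.sum_add_distrib, sum_pushLen_smul, sub_smul,
    Finset.sum_sub_distrib, ite_smul, zero_smul, Finset.sum_ite_eq', Finset.mem_univ, if_true]

variable {P B : Finset X}

theorem graftLen_insertNone (hσ : IsHier σ) (hP : P ∈ insert Finset.univ σ) (hB : B ∈ ch σ P)
    (t : ℝ) : graftLen σ P B l t (Finset.insertNone B) = t := by
  rw [graftLen, if_pos rfl, pushLen_of_notMem, add_zero]
  exact insertNone_notMem_att hσ hP hB

theorem graftLen_plus (hσ : IsHier σ) (hP : P ∈ insert Finset.univ σ) (hB : B ∈ ch σ P)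
    (t : ℝ) {A : Finset X} (hA : A ∈ σ) :
    graftLen σ P B l t (plus P A) = l A - if A = B then t else 0 := by
  rw [graftLen, if_neg, zero_add, pushLen_apply (plus_injective P) hA]
  intro h
  exact insertNone_notMem_att hσ hP hB (h ▸ Finset.mem_image_of_mem _ hA)

theorem graftLen_of_notMem (hB : B ∈ ch σ P) (t : ℝ) {A : Finset (Option X)}
    (hA : A ∉ graft σ B) : graftLen σ P B l t A = 0 := by
  rw [graft_eq hB, plus_union_none hB, Finset.mem_insert, not_or] at hA
  rw [graftLen, if_neg hA.1, pushLen_of_notMem hA.2, add_zero]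

theorem mem_graft (hB : B ∈ ch σ P) {A : Finset (Option X)} :
    A ∈ graft σ B ↔ A = Finset.insertNone B ∨ ∃ A₀ ∈ σ, plus P A₀ = A := by
  rw [graft_eq hB, plus_union_none hB, Finset.mem_insert, att, Finset.mem_image]

/-- All families of lengths on a tree with a further leaf are obtained by grafting. -/
theorem eq_graftLen (hσ : IsHier σ) (hP : P ∈ insert Finset.univ σ) (hB : B ∈ ch σ P)
    {l' : Finset (Option X) → ℝ} (hl' : ∀ A ∉ graft σ B, l' A = 0) :
    ∃ l : Finset X → ℝ, (∀ A ∉ σ, l A = 0) ∧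
      l' = graftLen σ P B l (l' (Finset.insertNone B)) := by
  -- The two pieces of the cut edge are merged again.
  refine ⟨fun A => if A ∈ σ then l' (plus P A) +
    (if A = B then l' (Finset.insertNone B) else 0) else 0, fun A hA => if_neg hA, ?_⟩
  funext A'
  by_cases hA' : A' ∈ graft σ B
  · rcases (mem_graft hB).1 hA' with rfl | ⟨A, hA, rfl⟩
    · rw [graftLen_insertNone hσ hP hB]
    · rw [graftLen_plus hσ hP hB _ hA, if_pos hA, add_sub_cancel_right]
  · rw [hl' _ hA', graftLen_of_notMem hB _ hA']

theorem startPos_graft_none (h0 : s' none = 0) (hs : ∀ x, s' (some x) = s x) (hσ : IsHier σ)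
    (hl : ∀ A ∉ σ, l A = 0) (hB : B ∈ ch σ P) (p : ℝ × ℝ) (t : ℝ) :
    startPos s' (graftLen σ P B l t) p {none} =
      startPos s l p B + t • toReal (slopeOf s B) := by
  rw [startPos_eq_sum, sum_graftLen_smul, startPos_eq_sum_mem hl,
    if_pos (singleton_none_ssubset_insertNone (hσ.nodes_nonempty (mem_ch.1 hB).1)),
    slopeOf_insertNone h0 hs]
  have h1 : ¬ {none} ⊂ plus P B := fun h =>
    (mem_ch.1 hB).2.1.2 (none_mem_plus.1 (h.1 (Finset.mem_singleton_self none)))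
  rw [if_neg h1, smul_zero, ite_self, sub_zero]
  have h2 : ∀ A ∈ σ, l A • (if {none} ⊂ plus P A then toReal (slopeOf s' (plus P A)) else 0) =
      l A • (if B ⊂ A then toReal (slopeOf s A) else 0) := by
    intro A hA
    have : {none} ⊂ plus P A ↔ B ⊂ A := by
      rw [ch_subset_iff hB hA]
      constructor
      · exact fun h => none_mem_plus.1 (h.1 (Finset.mem_singleton_self none))
      · intro h
        rw [plus, if_pos h]
        exact singleton_none_ssubset_insertNone (hσ.nodes_nonempty (mem_nodes.2 (Or.inl hA)))
    simp only [this, slopeOf_plus h0 hs]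
  rw [Finset.sum_congr rfl h2]
  ring

/-- For a bounded edge the cut preserves the total length above it. If the graft is on the leaf `x`
itself, it moves by `t` times its slope, which is why `s x = 0` is required. -/
theorem startPos_graft_some (h0 : s' none = 0) (hs : ∀ x, s' (some x) = s x) (hσ : IsHier σ)
    (hl : ∀ A ∉ σ, l A = 0) (hB : B ∈ ch σ P) (p : ℝ × ℝ) (t : ℝ) {x : X} (hx : s x = 0) :
    startPos s' (graftLen σ P B l t) p {some x} = startPos s l p {x} := by
  rw [startPos_eq_sum, sum_graftLen_smul, startPos_eq_sum_mem hl, slopeOf_insertNone h0 hs,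
    slopeOf_plus h0 hs]
  have h2 : ∀ A ∈ σ, l A • (if {some x} ⊂ plus P A then toReal (slopeOf s' (plus P A)) else 0) =
      l A • (if {x} ⊂ A then toReal (slopeOf s A) else 0) := by
    intro A hA
    rw [slopeOf_plus h0 hs]
    simp only [singleton_some_ssubset_plus (hσ.1 A hA).1, hσ.singleton_ssubset_iff hA]
  rw [Finset.sum_congr rfl h2]
  simp only [singleton_some_ssubset_insertNone]
  by_cases hBσ : B ∈ σ
  · simp only [singleton_some_ssubset_plus (hσ.1 B hBσ).1, hBσ, if_true]
    ring
  · obtain ⟨y, rfl⟩ := (mem_nodes.1 (mem_ch.1 hB).1).resolve_left hBσ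
    have : t • (if x ∈ ({y} : Finset X) then toReal (slopeOf s {y}) else 0) = 0 := by
      split_ifs with hxy
      · rw [Finset.mem_singleton] at hxy
        rw [slopeOf, Finset.sum_singleton, ← hxy, hx, toReal_zero, smul_zero]
      · rw [smul_zero]
    rw [this, if_neg hBσ, sub_zero, zero_add]

end Forget

/-! ### Lattice indices with one more marked point. -/

section Index

/-- The index of `H` is the product of the index of `H ⊔ ker f` in `G` and the relative index of `H`
in `ker f`. -/
theorem _root_.AddSubgroup.index_eq_mul_of_exact {A G B : Type*} [AddCommGroup A] [AddCommGroup G]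
    [AddCommGroup B] (g : A →+ G) (f : G →+ B) (hf : Function.Surjective f)
    (hfg : g.range = f.ker) (H : AddSubgroup G) :
    H.index = (H.comap g).index * (H.map f).index := by
  rw [AddSubgroup.index_comap, hfg, AddSubgroup.index_map, AddMonoidHom.range_eq_top.2 hf,
    AddSubgroup.index_top, mul_one, ← AddSubgroup.relIndex_sup_left,
    AddSubgroup.relIndex_mul_index le_sup_left]

theorem index_closure_pair (v w : ℤ × ℤ) :
    (AddSubgroup.closure {v, w}).index = (idet v w).natAbs := by
  have h := index_closure_range_rows !![v.1, v.2; w.1, w.2]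
  rw [← AddSubgroup.index_map_equiv _ (LinearEquiv.finTwoArrow ℤ ℤ).toAddEquiv,
    AddMonoidHom.map_closure, ← Set.range_comp] at h
  rw [Matrix.det_fin_two_of] at h
  rw [idet, ← h]
  congr 2
  ext u
  simp only [Set.mem_insert_iff, Set.mem_singleton_iff, Set.mem_range, Fin.exists_fin_two]
  constructor
  · rintro (rfl | rfl)
    · exact Or.inl rfl
    · exact Or.inr rfl
  · rintro (rfl | rfl)
    · exact Or.inl rfl
    · exact Or.inr rfl

theorem mem_closure_image_finset {α G : Type*} [AddCommGroup G] {s : Finset α} {v : α → G} {x : G}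
    (h : x ∈ AddSubgroup.closure (v '' s)) : ∃ c : α → ℤ, ∑ a ∈ s, c a • v a = x := by
  classical
  rw [← Submodule.span_int_eq_addSubgroupClosure, Submodule.mem_toAddSubgroup] at h
  obtain ⟨c, hc⟩ := (Submodule.mem_span_image_finset_iff_exists_fun ℤ).1 h
  refine ⟨fun a => if h : a ∈ s then c ⟨a, h⟩ else 0, ?_⟩
  rw [← Finset.sum_coe_sort]
  simpa using hc

variable {M : Type} {α : Type*}

/-- The restriction of a tuple to the old indices. -/
def restrictHom (M : Type) : (Option M → ℤ × ℤ) →+ (M → ℤ × ℤ) where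
  toFun a i := a (some i)
  map_zero' := rfl
  map_add' _ _ := rfl

/-- The extension of a tuple by zero. -/
def extendHom (M : Type) : (M → ℤ × ℤ) →+ (Option M → ℤ × ℤ) where
  toFun a i := i.elim 0 a
  map_zero' := by funext i; cases i <;> rfl
  map_add' a b := by funext i; cases i <;> simp

/-- The tuples which are concentrated at the new index. -/
def newHom (M : Type) : (ℤ × ℤ) →+ (Option M → ℤ × ℤ) where
  toFun u i := i.elim u fun _ => 0
  map_zero' := by funext i; cases i <;> rfl
  map_add' a b := by funext i; cases i <;> simp

/-- The entry at the new index. -/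
def evalNewHom (M : Type) : (Option M → ℤ × ℤ) →+ (ℤ × ℤ) where
  toFun a := a none
  map_zero' := rfl
  map_add' _ _ := rfl

/-- Project to the old marked points. Independence of the old generators leaves only `C` in the
kernel, so the index splits. For a graft, `C` is spanned by the slope of the edge and the direction
of the new line. -/
theorem index_sup_of_independent {s : Finset α} {v : α → M → ℤ × ℤ} {v' : α → Option M → ℤ × ℤ}
    (hv : ∀ a ∈ s, restrictHom M (v' a) = v a) (u : ℤ × ℤ) (C : AddSubgroup (ℤ × ℤ))
    (hli : ∀ (c : α → ℤ) (b : ℤ), ∑ a ∈ s, c a • v a + b • constHom M u = 0 →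
      (∀ a ∈ s, c a = 0) ∧ b = 0) :
    (AddSubgroup.closure (v' '' s) ⊔ ((AddSubgroup.closure {u}).map (constHom (Option M)) ⊔
      C.map (newHom M))).index = C.index *
      (AddSubgroup.closure (v '' s) ⊔ (AddSubgroup.closure {u}).map (constHom M)).index := by
  have hf : Function.Surjective (restrictHom M) := fun b => ⟨extendHom M b, rfl⟩
  have hker : (newHom M).range = (restrictHom M).ker := by
    ext a
    constructor
    · rintro ⟨w, rfl⟩; rfl
    · intro ha
      refine ⟨a none, funext fun i => ?_⟩
      cases i with
      | none => rfl
      | some i => exact (congrFun ha i).symm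
  rw [AddSubgroup.index_eq_mul_of_exact (newHom M) (restrictHom M) hf hker]
  congr 2
  · apply le_antisymm
    · intro w hw
      obtain ⟨x, hx, y, hy, hxy⟩ := AddSubgroup.mem_sup.1 hw
      obtain ⟨y, ⟨z, hz, rfl⟩, _, ⟨w', hw', rfl⟩, rfl⟩ := AddSubgroup.mem_sup.1 hy
      obtain ⟨c, rfl⟩ := mem_closure_image_finset hx
      obtain ⟨b, rfl⟩ := AddSubgroup.mem_closure_singleton.1 hz
      have h1 := congrArg (restrictHom M) hxy
      have h2 : ∑ a ∈ s, c a • v a + b • constHom M u = 0 := by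
        rw [map_add, map_add, map_sum] at h1
        rw [Finset.sum_congr rfl fun a ha => by rw [map_zsmul, hv a ha]] at h1
        refine Eq.trans ?_ h1
        congr 1
        rw [← map_zsmul]
        exact (add_zero _).symm
      obtain ⟨h3, rfl⟩ := hli c b h2
      rw [Finset.sum_eq_zero fun a ha => by rw [h3 a ha, zero_smul], zero_smul, map_zero, zero_add,
        zero_add] at hxy
      have := congrFun hxy none
      exact (show w' = w from this) ▸ hw'
    · intro w hw
      exact AddSubgroup.mem_sup_right (AddSubgroup.mem_sup_right ⟨w, hw, rfl⟩)
  · rw [AddSubgroup.map_sup, AddSubgroup.map_sup, AddMonoidHom.map_closure, AddSubgroup.map_map,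
      AddSubgroup.map_map]
    have h1 : (restrictHom M) '' (v' '' s) = v '' s := by
      rw [Set.image_image]
      exact Set.image_congr hv
    have h2 : C.map ((restrictHom M).comp (newHom M)) = ⊥ := by
      rw [show (restrictHom M).comp (newHom M) = 0 from rfl]
      exact AddSubgroup.map_zero_eq_bot _
    rw [h1, h2, sup_bot_eq]
    rfl

/-- Project to the new marked point instead. The generators `v'` do not move it, and `u`, `w` are
independent there, so only the old generators remain in the kernel. This is the situation of a new
point at the root, on two transversal lines. -/
theorem index_sup_of_extend {s : Finset α} {v : α → M → ℤ × ℤ} {v' : α → Option M → ℤ × ℤ}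
    (hv : ∀ a ∈ s, v' a = extendHom M (v a)) {u w : ℤ × ℤ} (huw : idet u w ≠ 0) :
    (AddSubgroup.closure (v' '' s) ⊔ ((AddSubgroup.closure {u}).map (constHom (Option M)) ⊔
      (AddSubgroup.closure {w}).map (newHom M))).index =
      (AddSubgroup.closure (v '' s)).index * (idet u w).natAbs := by
  have hf : Function.Surjective (evalNewHom M) := fun b => ⟨newHom M b, rfl⟩
  have hinj : Function.Injective (extendHom M) := fun a b h => funext fun i => congrFun h (some i)
  have hker : (extendHom M).range = (evalNewHom M).ker := by
    ext a
    constructor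
    · rintro ⟨w, rfl⟩; rfl
    · intro ha
      refine ⟨fun i => a (some i), funext fun i => ?_⟩
      cases i with
      | none => exact Eq.symm ha
      | some i => rfl
  have himg : v' '' s = extendHom M '' (v '' s) := by
    rw [Set.image_image]
    exact Set.image_congr hv
  rw [AddSubgroup.index_eq_mul_of_exact (extendHom M) (evalNewHom M) hf hker, himg,
    ← AddMonoidHom.map_closure]
  congr 1
  · congr 1
    apply le_antisymm
    · intro a ha
      obtain ⟨x, ⟨x, hx, rfl⟩, y, hy, hxy⟩ := AddSubgroup.mem_sup.1 ha
      obtain ⟨y, ⟨z, hz, rfl⟩, _, ⟨w', hw', rfl⟩, rfl⟩ := AddSubgroup.mem_sup.1 hy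
      obtain ⟨b, rfl⟩ := AddSubgroup.mem_closure_singleton.1 hz
      obtain ⟨e, rfl⟩ := AddSubgroup.mem_closure_singleton.1 hw'
      have h1 : b • u + e • w = 0 := (zero_add _).symm.trans (congrFun hxy none)
      have h2 := congrArg Prod.fst h1
      have h3 := congrArg Prod.snd h1
      simp only [Prod.fst_add, Prod.smul_fst, smul_eq_mul, Prod.fst_zero, Prod.snd_add,
        Prod.smul_snd, Prod.snd_zero] at h2 h3
      have hb : b = 0 := by
        refine (mul_eq_zero.1 (?_ : b * idet u w = 0)).resolve_right huw
        rw [idet]; linear_combination w.2 * h2 - w.1 * h3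
      have he : e = 0 := by
        refine (mul_eq_zero.1 (?_ : e * idet u w = 0)).resolve_right huw
        rw [idet]; linear_combination u.1 * h3 - u.2 * h2
      rw [hb, he, zero_smul, zero_smul, map_zero, map_zero, add_zero, add_zero] at hxy
      exact hinj hxy ▸ hx
    · intro a ha
      exact AddSubgroup.mem_sup_left ⟨a, ha, rfl⟩
  · rw [← index_closure_pair, AddSubgroup.map_sup, AddSubgroup.map_sup, AddSubgroup.map_map,
      AddSubgroup.map_map, AddSubgroup.map_map]
    have h1 : (AddSubgroup.closure (v '' s)).map ((evalNewHom M).comp (extendHom M)) = ⊥ := by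
      rw [show (evalNewHom M).comp (extendHom M) = 0 from rfl]
      exact AddSubgroup.map_zero_eq_bot _
    rw [h1, bot_sup_eq, show (evalNewHom M).comp (constHom (Option M)) = AddMonoidHom.id _ from rfl,
      show (evalNewHom M).comp (newHom M) = AddMonoidHom.id _ from rfl, AddSubgroup.map_id,
      AddSubgroup.map_id, ← AddSubgroup.closure_union]
    rfl

end Index

/-! ### Solutions with one more marked point, and their multiplicities. -/

section Extension

variable {ι ι' X M : Type} [Fintype ι] [Fintype ι'] [Fintype X] [DecidableEq X] [Nontrivial X]
  [Fintype M] [DecidableEq M] {d : ℕ}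

/-- The labelling `m'` has one more marked point than `m`. -/
structure IsExtension (m' : Labelling (Option X) (Option M) (Fin 3 × Fin d) ι')
    (m : Labelling X M (Fin 3 × Fin d) ι) (r : ι → ι') : Prop where
  root : m'.root = r m.root
  mark : ∀ i, m'.mark (some (some i)) = r (m.mark (some i))
  pt_none : m'.pt none = none
  pt_some : ∀ i, m'.pt (some i) = some (m.pt i)
  slope : ∀ x, m'.slopes (some x) = m.slopes x

variable {m' : Labelling (Option X) (Option M) (Fin 3 × Fin d) ι'}
  {m : Labelling X M (Fin 3 × Fin d) ι} {r : ι → ι'} (hE : IsExtension m' m r)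
include hE

namespace IsExtension

theorem slope_none : m'.slopes none = 0 := by
  rw [← hE.pt_none]
  exact m'.leafSlope_pt _ none

theorem restrict_vecs_plus (P A : Finset X) : restrictHom M (m'.vecs (plus P A)) = m.vecs A := by
  funext i
  change m'.vec _ _ (some i) = m.vec _ _ i
  simp only [Labelling.vec, hE.pt_some, some_mem_plus]
  rw [slopeOf_plus hE.slope_none hE.slope]

theorem vecs_plus_none (P A : Finset X) :
    m'.vecs (plus P A) none = if P ⊆ A then slopeOf m.slopes A else 0 := by
  simp only [Labelling.vecs, Labelling.vec, hE.pt_none, none_mem_plus]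
  rw [slopeOf_plus hE.slope_none hE.slope]

theorem restrict_vecs_insertNone (A : Finset X) :
    restrictHom M (m'.vecs (Finset.insertNone A)) = m.vecs A := by
  funext i
  change m'.vec _ _ (some i) = m.vec _ _ i
  simp only [Labelling.vec, hE.pt_some, Finset.some_mem_insertNone]
  rw [slopeOf_insertNone hE.slope_none hE.slope]

theorem vecs_insertNone_none (A : Finset X) :
    m'.vecs (Finset.insertNone A) none = slopeOf m.slopes A := by
  simp only [Labelling.vecs, Labelling.vec, hE.pt_none, Finset.none_mem_insertNone, if_true]
  exact slopeOf_insertNone hE.slope_none hE.slope A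

omit hE in
theorem vecs_singleton (x : X) : m.vecs {x} = 0 := by
  funext i
  simp only [Labelling.vecs, Labelling.vec, Finset.mem_singleton, slopeOf, Finset.sum_singleton]
  split_ifs with h
  · rw [← h]; exact m.leafSlope_pt _ i
  · rfl

end IsExtension

variable {ins : ι → Insertion} {ins' : ι' → Insertion} {Ξ' : ι' → ℝ × ℝ}
  {σ : Finset (Finset X)} {l : Finset X → ℝ} {p : ℝ × ℝ}

/-- Grafting leaves the old marked points where they are and puts the new one at distance parameter
`s` on the edge; the new condition is that this point lies on the new line. -/
theorem isSolData_graft_iff (hins : ∀ i, ins' (r i) = ins i)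
    (hx : (ins' (m'.mark (some none))).kind = Kind.line) (hσ : IsType (ins m.root).psi σ)
    {P B : Finset X} (hP : P ∈ insert Finset.univ σ) (hB : B ∈ ch σ P) (hl : ∀ A ∉ σ, l A = 0)
    (s : ℝ) :
    IsSolData m' ins' Ξ' (graft σ B, graftLen σ P B l s, p) ↔
      IsSolData m ins (Ξ' ∘ r) (σ, l, p) ∧ 0 < s ∧ (B ∈ σ → s < l B) ∧
        ∃ (j : Fin 3) (t : ℝ), 0 ≤ t ∧ startPos m.slopes l p B + s • toReal (slopeOf m.slopes B) =
          Ξ' (m'.mark (some none)) + t • toReal (dir j) := by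
  have hpt : ∀ i, startPos m'.slopes (graftLen σ P B l s) p {m'.pt (some i)} =
      startPos m.slopes l p {m.pt i} := fun i => by
    rw [hE.pt_some]
    exact startPos_graft_some hE.slope_none hE.slope hσ.1 hl hB p s (m.leafSlope_pt _ i)
  have hnone : startPos m'.slopes (graftLen σ P B l s) p {m'.pt none} =
      startPos m.slopes l p B + s • toReal (slopeOf m.slopes B) := by
    rw [hE.pt_none]
    exact startPos_graft_none hE.slope_none hE.slope hσ.1 hl hB p s
  constructor
  · rintro ⟨h1, h2, h3, h4, h5⟩
    simp only at h1 h2 h3 h4 h5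
    have hs : 0 < s := by
      have := h2 _ ((mem_graft hB).2 (Or.inl rfl))
      rwa [graftLen_insertNone hσ.1 hP hB] at this
    have hA : ∀ A ∈ σ, 0 < l A - if A = B then s else 0 := fun A hA => by
      have := h2 _ ((mem_graft hB).2 (Or.inr ⟨A, hA, rfl⟩))
      rwa [graftLen_plus hσ.1 hP hB s hA] at this
    refine ⟨⟨hσ, fun A hAσ => ?_, hl, ?_, fun i => ?_⟩, hs, fun hBσ => ?_, ?_⟩
    · have := hA A hAσ
      simp only
      split_ifs at this <;> linarith
    · rw [hE.root, hins] at h4; exact h4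
    · have := h5 (some i)
      rw [hpt, hE.mark, hins] at this
      exact this
    · have := hA B hBσ
      rw [if_pos rfl] at this
      linarith
    · have := h5 none
      rw [hnone, hx] at this
      obtain ⟨j, t, ht, h⟩ := this
      exact ⟨j, t, ht, h⟩
  · rintro ⟨⟨h1, h2, h3, h4, h5⟩, hs, hsB, j, t, ht, h6⟩
    refine ⟨?_, fun A hA => ?_, fun A hA => graftLen_of_notMem hB s hA, ?_, fun i => ?_⟩
    · rw [hE.root, hins]
      exact hσ.graft (mem_ch.1 hB).1
    · rcases (mem_graft hB).1 hA with rfl | ⟨A, hA₀, rfl⟩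
      · simp only
        rwa [graftLen_insertNone hσ.1 hP hB]
      · simp only
        rw [graftLen_plus hσ.1 hP hB s hA₀]
        split_ifs with hAB
        · subst hAB; linarith [hsB hA₀]
        · rw [sub_zero]; exact h2 A hA₀
    · rw [hE.root, hins]; exact h4
    · cases i with
      | none =>
        rw [hnone, hx]
        exact ⟨j, t, ht, h6⟩
      | some i =>
        rw [hpt, hE.mark, hins]
        exact h5 i

/-- A new point at the root vertex is mapped to the same place as the root. Both line constraints
thus fall on one point, which acts as a point constraint for the smaller curve. -/
theorem isSolData_att_iff [DecidableEq ι] (hk : (ins' m'.root).psi = (ins m.root).psi + 1)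
    (hroot' : (ins' m'.root).kind = Kind.line) (hroot : (ins m.root).kind = Kind.point)
    (hins : ∀ i, ins' (r (m.mark (some i))) = ins (m.mark (some i)))
    (hx : (ins' (m'.mark (some none))).kind = Kind.line) (hσ : IsHier σ)
    (hl : ∀ A ∉ σ, l A = 0) :
    IsSolData m' ins' Ξ' (att σ Finset.univ, pushLen (plus Finset.univ) σ l, p) ↔
      IsSolData m ins (Function.update (Ξ' ∘ r) m.root p) (σ, l, p) ∧
        p ∈ Kind.line.cycle (Ξ' m'.root) ∧ p ∈ Kind.line.cycle (Ξ' (m'.mark (some none))) := by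
  have hpt : ∀ i, startPos m'.slopes (pushLen (plus Finset.univ) σ l) p {m'.pt (some i)} =
      startPos m.slopes l p {m.pt i} := fun i => by
    rw [hE.pt_some]
    exact startPos_att_some hE.slope_none hE.slope hσ hl _ p _
  have hnone : startPos m'.slopes (pushLen (plus Finset.univ) σ l) p {m'.pt none} = p := by
    rw [hE.pt_none]
    exact startPos_att_none hσ l p
  have hne : ∀ i, m.mark (some i) ≠ m.root := fun i h => by
    simpa using m.mark.injective h
  constructor
  · rintro ⟨h1, h2, h3, h4, h5⟩
    simp only at h1 h2 h3 h4 h5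
    refine ⟨⟨?_, fun A hA => ?_, hl, ?_, fun i => ?_⟩, ?_, ?_⟩
    · rw [hk] at h1
      exact (isType_att_univ hσ).1 h1
    · have := h2 _ (Finset.mem_image_of_mem _ hA)
      rwa [pushLen_apply (plus_injective _) hA] at this
    · rw [hroot, Function.update_self]; rfl
    · have := h5 (some i)
      rw [hpt, hE.mark, hins] at this
      rw [Function.update_of_ne (hne i)]
      exact this
    · rwa [hroot'] at h4
    · have := h5 none
      rwa [hnone, hx] at this
  · rintro ⟨⟨h1, h2, h3, h4, h5⟩, h6, h7⟩
    refine ⟨?_, fun A hA => ?_, fun A hA => pushLen_of_notMem hA, ?_, fun i => ?_⟩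
    · rw [hk]
      exact (isType_att_univ hσ).2 h1
    · obtain ⟨A, hA₀, rfl⟩ := Finset.mem_image.1 hA
      simp only
      rw [pushLen_apply (plus_injective _) hA₀]
      exact h2 A hA₀
    · rwa [hroot']
    · cases i with
      | none => rwa [hnone, hx]
      | some i =>
        have := h5 i
        rw [Function.update_of_ne (hne i)] at this
        rw [hpt, hE.mark, hins]
        exact this

omit hE in
theorem pi_option (C : AddSubgroup (ℤ × ℤ)) (T : Option M → AddSubgroup (ℤ × ℤ)) (h0 : T none = C)
    (hT : ∀ i, T (some i) = ⊥) : AddSubgroup.pi Set.univ T = C.map (newHom M) := by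
  ext a
  constructor
  · intro ha
    have ha' : ∀ i, a i ∈ T i := fun i => ha i trivial
    refine ⟨a none, h0 ▸ ha' none, funext fun i => ?_⟩
    cases i with
    | none => rfl
    | some i =>
      have := ha' (some i)
      rw [hT] at this
      exact (AddSubgroup.mem_bot.1 this).symm
  · rintro ⟨w, hw, rfl⟩ i -
    cases i with
    | none =>
      change w ∈ T none
      rw [h0]; exact hw
    | some i => exact zero_mem (T (some i))

/-- The graft adds the freedom to slide the new point along its edge, which meets the direction of
the new line with the stated determinant. The independence `hli` of the generators at the old points
is what splits the index. -/
theorem solMult_graft (hins : ∀ i, ins' (r i) = ins i)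
    (hroot : (ins m.root).kind = Kind.line)
    (hpts : ∀ i, (ins (m.mark (some i))).kind = Kind.point)
    (hx : (ins' (m'.mark (some none))).kind = Kind.line) (hσ : IsHier σ)
    {P B : Finset X} (hB : B ∈ ch σ P) (hl : ∀ A ∉ σ, l A = 0)
    {s t t' : ℝ} {j j' : Fin 3} (ht : 0 < t) (ht' : 0 < t')
    (hp : p = Ξ' m'.root + t • toReal (dir j))
    (hp' : startPos m.slopes l p B + s • toReal (slopeOf m.slopes B) =
      Ξ' (m'.mark (some none)) + t' • toReal (dir j'))
    (hli : LinearIndependent ℝ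
      fun q : ((σ.disjSum {j} : Finset (Finset X ⊕ Fin 3))) => realVec m.vecsLine q) :
    solMult m' ins' Ξ' (graft σ B, graftLen σ P B l s, p) =
      solMult m ins (Ξ' ∘ r) (σ, l, p) * (idet (slopeOf m.slopes B) (dir j')).natAbs := by
  have hnone : startPos m'.slopes (graftLen σ P B l s) p {m'.pt none} =
      Ξ' (m'.mark (some none)) + t' • toReal (dir j') := by
    rw [hE.pt_none, ← hp']
    exact startPos_graft_none hE.slope_none hE.slope hσ hl hB p s
  have e1 : (ins' m'.root).kind.tangent (Ξ' m'.root) p = AddSubgroup.closure {dir j} := by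
    rw [hE.root, hins, hroot, ← hE.root, hp]
    exact tangent_line ht j
  have e2 : solMult m ins (Ξ' ∘ r) (σ, l, p) = (AddSubgroup.closure (m.vecs '' σ) ⊔
      (AddSubgroup.closure {dir j}).map (constHom M)).index := by
    rw [solMult]
    simp only [hpts, hroot]
    have h1 : Kind.line.tangent ((Ξ' ∘ r) m.root) p = AddSubgroup.closure {dir j} := by
      rw [Function.comp_apply, ← hE.root, hp]
      exact tangent_line ht j
    rw [h1]
    have h2 : AddSubgroup.pi Set.univ (fun i => Kind.point.tangent
        ((Ξ' ∘ r) (m.mark (some i))) (startPos m.slopes l p {m.pt i})) = ⊥ := AddSubgroup.pi_bot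
    rw [h2, sup_bot_eq]
  set C := AddSubgroup.closure {slopeOf m.slopes B, dir j'} with hC
  have e3 : solMult m' ins' Ξ' (graft σ B, graftLen σ P B l s, p) =
      (AddSubgroup.closure ((fun A => m'.vecs (plus P A)) '' σ) ⊔
        ((AddSubgroup.closure {dir j}).map (constHom (Option M)) ⊔ C.map (newHom M))).index := by
    rw [solMult]
    simp only [e1]
    rw [pi_option (AddSubgroup.closure {dir j'}) _ (by
      rw [hx, hnone]
      exact tangent_line ht' j') (fun i => by rw [hE.mark, hins, hpts]; rfl)]
    congr 1
    -- Stretching the lower piece of the cut edge is stretching the upper piece together with moving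
    -- the new point alone. Hence the lattice has the generators of the old edges and one generator
    -- concentrated at the new point.
    have hvB : (newHom M) (slopeOf m.slopes B) + (if B ∈ σ then m'.vecs (plus P B) else 0) =
        m'.vecs (Finset.insertNone B) := by
      funext i
      cases i with
      | none =>
        rw [hE.vecs_insertNone_none, Pi.add_apply]
        have : (if B ∈ σ then m'.vecs (plus P B) else 0) none = 0 := by
          split_ifs
          · rw [hE.vecs_plus_none, if_neg (mem_ch.1 hB).2.1.2]
          · rfl
        rw [this, add_zero]
        rfl
      | some i =>
        have h1 := congrFun (hE.restrict_vecs_insertNone B) i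
        have h2 := congrFun (hE.restrict_vecs_plus P B) i
        change m'.vecs _ (some i) = _ at h1 h2
        rw [h1, Pi.add_apply]
        refine (zero_add _).trans ?_
        split_ifs with hBσ
        · exact h2
        · obtain ⟨y, rfl⟩ := (mem_nodes.1 (mem_ch.1 hB).1).resolve_left hBσ
          rw [IsExtension.vecs_singleton]
          rfl
    have hplus : ∀ A ∈ σ, m'.vecs (plus P A) ∈
        AddSubgroup.closure ((fun A => m'.vecs (plus P A)) '' σ) := fun A hA =>
      AddSubgroup.subset_closure ⟨A, hA, rfl⟩
    have hplus' : ∀ A ∈ σ, m'.vecs (plus P A) ∈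
        AddSubgroup.closure (m'.vecs '' (graft σ B)) := fun A hA =>
      AddSubgroup.subset_closure ⟨plus P A, (mem_graft hB).2 (Or.inr ⟨A, hA, rfl⟩), rfl⟩
    apply le_antisymm
    · refine sup_le ?_ (sup_le (le_sup_left.trans le_sup_right) (le_trans ?_
        (le_sup_right.trans le_sup_right)))
      · rw [AddSubgroup.closure_le]
        rintro _ ⟨A, hA, rfl⟩
        rcases (mem_graft hB).1 hA with rfl | ⟨A, hA₀, rfl⟩
        · change m'.vecs (Finset.insertNone B) ∈ _
          rw [← hvB, add_comm]
          refine AddSubgroup.add_mem_sup ?_ (AddSubgroup.mem_sup_right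
            ⟨_, AddSubgroup.subset_closure (by simp), rfl⟩)
          split_ifs with hBσ
          · exact hplus B hBσ
          · exact zero_mem _
        · exact AddSubgroup.mem_sup_left (hplus A hA₀)
      · exact AddSubgroup.map_mono (AddSubgroup.closure_mono (by simp))
    · refine sup_le ?_ (sup_le (le_sup_left.trans le_sup_right) ?_)
      · rw [AddSubgroup.closure_le]
        rintro _ ⟨A, hA, rfl⟩
        exact AddSubgroup.mem_sup_left (hplus' A hA)
      · rw [hC, AddMonoidHom.map_closure, AddSubgroup.closure_le]
        rintro _ ⟨w, hw, rfl⟩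
        rcases hw with rfl | hw
        · rw [← eq_sub_iff_add_eq] at hvB
          rw [hvB]
          refine AddSubgroup.mem_sup_left (sub_mem (AddSubgroup.subset_closure
            ⟨_, (mem_graft hB).2 (Or.inl rfl), rfl⟩) ?_)
          split_ifs with hBσ
          · exact hplus' B hBσ
          · exact zero_mem _
        · rw [Set.mem_singleton_iff] at hw
          subst hw
          exact AddSubgroup.mem_sup_right (AddSubgroup.mem_sup_right
            ⟨_, AddSubgroup.subset_closure rfl, rfl⟩)
  rw [e3, e2, index_sup_of_independent (v := m.vecs) (fun A _ => hE.restrict_vecs_plus P A), hC,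
    index_closure_pair, mul_comm]
  intro c b hcb
  have h1 := congrArg (castVec : (M → ℤ × ℤ) →+ (M → ℝ × ℝ)) hcb
  have h2 : ∑ q ∈ (σ.disjSum {j} : Finset (Finset X ⊕ Fin 3)),
      ((Sum.elim c (fun _ => b) q : ℤ) : ℝ) • realVec m.vecsLine q = 0 := by
    rw [Finset.sum_disjSum, Finset.sum_singleton]
    rw [map_add, map_sum, map_zero] at h1
    simp only [map_zsmul] at h1
    simp only [Sum.elim_inl, Sum.elim_inr, Int.cast_smul_eq_zsmul]
    exact h1
  rw [← Finset.sum_coe_sort] at h2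
  have h3 := Fintype.linearIndependent_iff.1 hli _ h2
  refine ⟨fun A hA => ?_, ?_⟩
  · exact_mod_cast h3 ⟨Sum.inl A, by simpa using hA⟩
  · exact_mod_cast h3 ⟨Sum.inr j, by simp⟩

/-- The root is at the crossing of two rays with different directions. These form a basis of `ℤ ×
ℤ`, so the two lines together impose a point condition with index one. -/
theorem solMult_att [DecidableEq ι]
    (hroot' : (ins' m'.root).kind = Kind.line) (hroot : (ins m.root).kind = Kind.point)
    (hins : ∀ i, ins' (r (m.mark (some i))) = ins (m.mark (some i)))
    (hpts : ∀ i, (ins (m.mark (some i))).kind = Kind.point)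
    (hx : (ins' (m'.mark (some none))).kind = Kind.line) (hσ : IsHier σ)
    {t t' : ℝ} {j j' : Fin 3} (ht : 0 < t) (ht' : 0 < t')
    (hp : p = Ξ' m'.root + t • toReal (dir j))
    (hp' : p = Ξ' (m'.mark (some none)) + t' • toReal (dir j')) (hjj' : j ≠ j') (Ξ : ι → ℝ × ℝ) :
    solMult m' ins' Ξ' (att σ Finset.univ, pushLen (plus Finset.univ) σ l, p) =
      solMult m ins Ξ (σ, l, p) := by
  have hdet : (idet (dir j) (dir j')).natAbs = 1 := by
    fin_cases j <;> fin_cases j' <;> simp [idet, dir] at hjj' ⊢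
  have hnone : startPos m'.slopes (pushLen (plus Finset.univ) σ l) p {m'.pt none} = p := by
    rw [hE.pt_none]
    exact startPos_att_none hσ l p
  have e2 : solMult m ins Ξ (σ, l, p) = (AddSubgroup.closure (m.vecs '' σ)).index := by
    simp only [solMult, hroot, hpts, Kind.tangent, AddSubgroup.map_bot, AddSubgroup.pi_bot,
      sup_bot_eq]
  have e1 : (ins' m'.root).kind.tangent (Ξ' m'.root) p = AddSubgroup.closure {dir j} := by
    rw [hroot', hp]
    exact tangent_line ht j
  have e3 := index_sup_of_extend (s := σ) (v := m.vecs)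
    (v' := fun A => m'.vecs (plus Finset.univ A)) (fun A hA => funext fun i => by
      cases i with
      | none =>
        rw [hE.vecs_plus_none, if_neg fun h => (hσ.1 A hA).2 (Finset.univ_subset_iff.1 h)]
        rfl
      | some i => exact congrFun (hE.restrict_vecs_plus Finset.univ A) i)
    (u := dir j) (w := dir j') (by intro h; rw [h] at hdet; simp at hdet)
  rw [hdet, mul_one] at e3
  rw [e2, ← e3, solMult]
  simp only [e1]
  rw [pi_option (AddSubgroup.closure {dir j'}) _ (by
    rw [hx, hnone, hp']
    exact tangent_line ht' j') (fun i => by rw [hE.mark, hins, hpts]; rfl), att,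
    Finset.coe_image, Set.image_image]

end Extension

/-! ### The intersection point of two tropical lines. -/

section TwoLines

/-- The explicit form of the intersection of two tropical lines. -/
theorem line_inter_aux {v : ℝ × ℝ} (hv : OffLine v) {t t' : ℝ} {j j' : Fin 3} (ht : 0 ≤ t)
    (ht' : 0 ≤ t') (h : t • toReal (dir j) - t' • toReal (dir j') = v) :
    (j ≠ j' ∧ 0 < t ∧ 0 < t') ∧ ((0 < v.1 → v.2 < 0 → t • toReal (dir j) = (0, v.2)) ∧
      (v.1 < 0 → 0 < v.2 → t • toReal (dir j) = (v.1, 0)) ∧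
      (v.1 < 0 → v.2 < v.1 → t • toReal (dir j) = (0, v.2 - v.1)) ∧
      (0 < v.1 → v.1 < v.2 → t • toReal (dir j) = (v.1, v.1)) ∧
      (v.2 < 0 → v.1 < v.2 → t • toReal (dir j) = (v.1 - v.2, 0)) ∧
      (0 < v.2 → v.2 < v.1 → t • toReal (dir j) = (v.2, v.2))) := by
  obtain ⟨a, b⟩ := v
  obtain ⟨h1, h2, h3⟩ := hv
  have hpos : ∀ x : ℝ, 0 ≤ x → x ≠ 0 → 0 < x := fun x hx hx' => hx.lt_of_ne hx'.symm
  fin_cases j <;> fin_cases j' <;>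
    simp only [toReal, dir, Prod.ext_iff, Fin.zero_eta, Fin.mk_one, Fin.reduceFinMk,
      Matrix.cons_val, Prod.smul_mk, smul_eq_mul, Prod.mk_sub_mk, Int.cast_zero, Int.cast_one,
      Int.cast_neg, mul_zero, mul_one, mul_neg, sub_zero, zero_sub, sub_neg_eq_add,
      zero_add, Int.reduceNeg] at h h1 h2 h3 ⊢ <;>
    obtain ⟨ha, hb⟩ := h <;>
    first
      | exact absurd (by linarith) h1
      | exact absurd (by linarith) h2
      | exact absurd (by linarith) h3
      | (refine ⟨⟨by decide, hpos _ ht fun h => ?_, hpos _ ht' fun h => ?_⟩, ?_⟩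
         · first
            | exact h1 (by linarith)
            | exact h2 (by linarith)
            | exact h3 (by linarith)
         · first
            | exact h1 (by linarith)
            | exact h2 (by linarith)
            | exact h3 (by linarith)
         · refine ⟨?_, ?_, ?_, ?_, ?_, ?_⟩ <;> intro h4 h5 <;> constructor <;>
            first | linarith | simp)

theorem OffLine.cases {v : ℝ × ℝ} (hv : OffLine v) :
    (0 < v.1 ∧ v.2 < 0) ∨ (v.1 < 0 ∧ 0 < v.2) ∨ (v.1 < 0 ∧ v.2 < v.1) ∨ (0 < v.1 ∧ v.1 < v.2) ∨
      (v.2 < 0 ∧ v.1 < v.2) ∨ (0 < v.2 ∧ v.2 < v.1) := by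
  obtain ⟨h1, h2, h3⟩ := hv
  rcases lt_or_gt_of_ne h1 with h1 | h1 <;> rcases lt_or_gt_of_ne h2 with h2 | h2 <;>
    rcases lt_or_gt_of_ne h3 with h3 | h3 <;> simp [h1, h2, h3]

variable {q q' : ℝ × ℝ}

theorem line_inter_pos (hq : OffLine (q' - q)) {t t' : ℝ} {j j' : Fin 3} (ht : 0 ≤ t)
    (ht' : 0 ≤ t') (h : q + t • toReal (dir j) = q' + t' • toReal (dir j')) :
    j ≠ j' ∧ 0 < t ∧ 0 < t' :=
  (line_inter_aux hq ht ht' (by rw [sub_eq_sub_iff_add_eq_add, add_comm, h])).1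

theorem mem_line_iff {p : ℝ × ℝ} : p ∈ Kind.line.cycle q ↔
    ∃ (j : Fin 3) (t : ℝ), 0 ≤ t ∧ p = q + t • toReal (dir j) := by
  constructor
  · rintro ⟨j, t, ht, h⟩; exact ⟨j, t, ht, h⟩
  · rintro ⟨j, t, ht, h⟩; exact ⟨j, t, ht, h⟩

/-- The position of `q'` relative to `q` lies in one of six open sectors, and in each of them the
intersection point is given explicitly. -/
theorem line_inter_unique (hq : OffLine (q' - q)) {p p₁ : ℝ × ℝ} (hp : p ∈ Kind.line.cycle q)
    (hp' : p ∈ Kind.line.cycle q') (hp₁ : p₁ ∈ Kind.line.cycle q)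
    (hp₁' : p₁ ∈ Kind.line.cycle q') : p = p₁ := by
  obtain ⟨j, t, ht, rfl⟩ := mem_line_iff.1 hp
  obtain ⟨j', t', ht', h⟩ := mem_line_iff.1 hp'
  obtain ⟨i, s, hs, rfl⟩ := mem_line_iff.1 hp₁
  obtain ⟨i', s', hs', h'⟩ := mem_line_iff.1 hp₁'
  obtain ⟨-, a1, a2, a3, a4, a5, a6⟩ :=
    line_inter_aux hq ht ht' (by rw [sub_eq_sub_iff_add_eq_add, add_comm, h])
  obtain ⟨-, b1, b2, b3, b4, b5, b6⟩ :=
    line_inter_aux hq hs hs' (by rw [sub_eq_sub_iff_add_eq_add, add_comm, h'])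
  congr 1
  rcases hq.cases with ⟨h1, h2⟩ | ⟨h1, h2⟩ | ⟨h1, h2⟩ | ⟨h1, h2⟩ | ⟨h1, h2⟩ | ⟨h1, h2⟩
  · rw [a1 h1 h2, b1 h1 h2]
  · rw [a2 h1 h2, b2 h1 h2]
  · rw [a3 h1 h2, b3 h1 h2]
  · rw [a4 h1 h2, b4 h1 h2]
  · rw [a5 h1 h2, b5 h1 h2]
  · rw [a6 h1 h2, b6 h1 h2]

theorem exists_line_inter (hq : OffLine (q' - q)) :
    ∃ p, p ∈ Kind.line.cycle q ∧ p ∈ Kind.line.cycle q' := by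
  have key : ∀ (j j' : Fin 3) (t t' : ℝ), 0 < t → 0 < t' →
      t • toReal (dir j) - t' • toReal (dir j') = q' - q →
      ∃ p, p ∈ Kind.line.cycle q ∧ p ∈ Kind.line.cycle q' := by
    intro j j' t t' ht ht' h
    refine ⟨q + t • toReal (dir j), mem_line_iff.2 ⟨j, t, ht.le, rfl⟩,
      mem_line_iff.2 ⟨j', t', ht'.le, ?_⟩⟩
    rw [sub_eq_sub_iff_add_eq_add] at h
    rw [add_comm, h]
  rcases hq.cases with ⟨h1, h2⟩ | ⟨h1, h2⟩ | ⟨h1, h2⟩ | ⟨h1, h2⟩ | ⟨h1, h2⟩ | ⟨h1, h2⟩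
  · refine key 0 1 (-(q' - q).2) (q' - q).1 (by linarith) h1 ?_
    ext <;> simp [toReal, dir]
  · refine key 1 0 (-(q' - q).1) (q' - q).2 (by linarith) h2 ?_
    ext <;> simp [toReal, dir]
  · refine key 0 2 ((q' - q).1 - (q' - q).2) (-(q' - q).1) (by linarith) (by linarith) ?_
    ext <;> simp [toReal, dir]
    ring
  · refine key 2 0 (q' - q).1 ((q' - q).2 - (q' - q).1) h1 (by linarith) ?_
    ext <;> simp [toReal, dir]
  · refine key 1 2 ((q' - q).2 - (q' - q).1) (-(q' - q).2) (by linarith) (by linarith) ?_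
    ext <;> simp [toReal, dir]
    ring
  · refine key 2 1 (q' - q).2 ((q' - q).1 - (q' - q).2) h1 (by linarith) ?_
    ext <;> simp [toReal, dir]

/-- The coordinate along `dir j` of the intersection point of two tropical lines. -/
noncomputable def interCoord (j j' : Fin 3) : (ℝ × ℝ) →ₗ[ℝ] ℝ :=
  ((idet (dir j) (dir j') : ℤ) : ℝ)⁻¹ • ((dir j').2 • LinearMap.fst ℝ ℝ ℝ -
    (dir j').1 • LinearMap.snd ℝ ℝ ℝ)

theorem idet_dir_ne_zero {j j' : Fin 3} (h : j ≠ j') : idet (dir j) (dir j') ≠ 0 := by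
  fin_cases j <;> fin_cases j' <;> simp [idet, dir] at h ⊢

theorem interCoord_eq {j j' : Fin 3} (hj : j ≠ j') {t t' : ℝ}
    (h : q + t • toReal (dir j) = q' + t' • toReal (dir j')) :
    t = interCoord j j' (q' - q) := by
  have h0 : ((idet (dir j) (dir j') : ℤ) : ℝ) ≠ 0 := by exact_mod_cast idet_dir_ne_zero hj
  have h1 := congrArg Prod.fst h
  have h2 := congrArg Prod.snd h
  simp only [toReal, Prod.fst_add, Prod.smul_fst, smul_eq_mul, Prod.snd_add, Prod.smul_snd]
    at h1 h2
  simp only [interCoord, LinearMap.smul_apply, LinearMap.sub_apply, LinearMap.fst_apply,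
    LinearMap.snd_apply, smul_eq_mul, Prod.fst_sub, Prod.snd_sub, zsmul_eq_mul]
  rw [eq_inv_mul_iff_mul_eq₀ h0, idet]
  push_cast
  linear_combination (dir j').2 * h1 - (dir j').1 * h2

end TwoLines

/-! ### Generic vectors avoid low-dimensional spans. -/

section GenericCombination

/-- A generic vector is not a combination of fewer vectors than the dimension. -/
theorem generic_ne_combination {E α : Type*} [AddCommGroup E] [Module ℝ E] [FiniteDimensional ℝ E]
    (s : Finset α) (a : α → E) (b c : E) (h : s.card + 2 < Module.finrank ℝ E) :
    Generic E fun x => ∀ (l : α → ℝ) (t t' : ℝ), x ≠ ∑ A ∈ s, l A • a A + t • b + t' • c := by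
  classical
  set u : Option (Option s) → E := fun i => i.elim c fun i => i.elim b fun A => a A with hu
  have hne : Submodule.span ℝ (Set.range u) ≠ ⊤ := fun ht => by
    have := finrank_range_le_card (R := ℝ) u
    rw [Set.finrank, ht, finrank_top, Fintype.card_option, Fintype.card_option,
      Fintype.card_coe] at this
    omega
  refine (Generic.notMem hne).mono fun x hx l t t' he => hx ?_
  rw [he]
  refine add_mem (add_mem (sum_mem fun A hA => ?_) ?_) ?_
  · exact Submodule.smul_mem _ _ (Submodule.subset_span ⟨some (some ⟨A, hA⟩), rfl⟩)
  · exact Submodule.smul_mem _ _ (Submodule.subset_span ⟨some none, rfl⟩)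
  · exact Submodule.smul_mem _ _ (Submodule.subset_span ⟨none, rfl⟩)

end GenericCombination

/-! ### Genericity conditions for the forgetful step. -/

section ExtensionGeneric

variable {ι ι' X M : Type} [Fintype ι] [Fintype ι'] [Fintype X] [DecidableEq X] [Nontrivial X]
  [Fintype M] [DecidableEq M] {d : ℕ}
  {m' : Labelling (Option X) (Option M) (Fin 3 × Fin d) ι'}
  {m : Labelling X M (Fin 3 × Fin d) ι} {r : ι → ι'} (hE : IsExtension m' m r)
  {ins : ι → Insertion} {ins' : ι' → Insertion}
include hE

theorem IsExtension.injective : Function.Injective r := by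
  have h : r ∘ m.mark = m'.mark ∘ Option.map some := by
    funext i
    cases i with
    | none => exact hE.root.symm
    | some i => exact (hE.mark i).symm
  have h2 : Function.Injective (r ∘ m.mark) := by
    rw [h]
    exact m'.mark.injective.comp (Option.map_injective (Option.some_injective _))
  intro a b hab
  obtain ⟨a, rfl⟩ := m.mark.surjective a
  obtain ⟨b, rfl⟩ := m.mark.surjective b
  rw [h2 hab]

theorem IsExtension.generic_comp {p : (ι → ℝ × ℝ) → Prop} (hp : Generic (ι → ℝ × ℝ) p) :
    Generic (ι' → ℝ × ℝ) fun Ξ' => p (Ξ' ∘ r) :=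
  hp.comap (LinearMap.funLeft ℝ (ℝ × ℝ) r)
    (LinearMap.funLeft_surjective_of_injective ℝ (ℝ × ℝ) r hE.injective)

omit hE in
theorem finrank_plane_option : Module.finrank ℝ (Option M → ℝ × ℝ) = 2 * Fintype.card M + 2 := by
  rw [finrank_plane_pi, Fintype.card_option]; ring

/-- The generic new line meets the rays spanned by a vertex and a given direction only in their
interior, and its vertex does not lie on the lines spanned by the edges. -/
theorem generic_ne_vertexPos (hroot : (ins m.root).kind = Kind.line)
    (hpts : ∀ i, (ins (m.mark (some i))).kind = Kind.point)
    (hcard : Fintype.card X = 2 * Fintype.card M + (ins m.root).psi + 1) :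
    Generic (ι' → ℝ × ℝ) fun Ξ' => ∀ z, IsSolData m ins (Ξ' ∘ r) z →
      ∀ (B : Finset X) (w : Fin 3 ⊕ Finset X) (s : ℝ), Ξ' (m'.mark (some none)) ≠
        vertexPos m.slopes z.2.1 z.2.2 B + s • toReal (Sum.elim dir (slopeOf m.slopes) w) := by
  -- The parameters are the edge lengths, the position of the root on its line and the displacement
  -- `s`. Their number is `σ.card + 2 = 2 * card M + 1`, one less than the dimension.
  have h0 : Generic (Option M → ℝ × ℝ) fun x => ∀ (σ : Finset (Finset X)) (j : Fin 3)
      (B : Finset X) (w : Fin 3 ⊕ Finset X), σ.card + 2 < Module.finrank ℝ (Option M → ℝ × ℝ) →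
      ∀ (l : Finset X → ℝ) (t t' : ℝ), x ≠ ∑ A ∈ σ, l A • (fun i : Option M => i.elim
        (if B ⊆ A then toReal (slopeOf m.slopes A) else 0) (realVec m.vecs A)) +
        t • (fun _ => toReal (dir j)) + t' • (fun i : Option M => i.elim
          (toReal (Sum.elim dir (slopeOf m.slopes) w)) fun _ => 0) :=
    Generic.all fun σ => Generic.all fun j => Generic.all fun B => Generic.all fun w =>
      Generic.imp fun h => generic_ne_combination σ _ _ _ h
  refine (h0.comap m'.relReal m'.relReal_surjective).mono ?_
  rintro Ξ' hΞ ⟨σ, l, p⟩ hz B w s he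
  obtain ⟨j, t, -, hp⟩ := hz.exists_line hroot
  refine hΞ σ j B w ?_ l t s (funext fun i => ?_)
  · have := hz.type.card_eq
    simp only at this
    rw [finrank_plane_option]
    omega
  · rw [m'.relReal_apply, hE.root]
    have hsum : ∀ (f : Finset X → ℝ × ℝ), ∑ A ∈ σ, l A • f A = ∑ A, l A • f A := fun f =>
      Finset.sum_subset (Finset.subset_univ σ) fun A _ hA => by
        rw [show l A = 0 from hz.zero A hA, zero_smul]
    rw [Pi.add_apply, Pi.add_apply, Finset.sum_apply]
    simp only [Pi.smul_apply]
    rw [hsum fun A => _]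
    cases i with
    | none =>
      rw [he, vertexPos]
      simp only [Option.elim_none, smul_ite, smul_zero]
      rw [← Finset.sum_filter, hp, Function.comp_apply]
      abel
    | some i =>
      have h7 := hz.pt_mem i
      rw [hpts] at h7
      have h8 : startPos m.slopes l p {m.pt i} = Ξ' (r (m.mark (some i))) := h7
      rw [hE.mark, ← h8, startPos_pt hz.type.1 hz.zero, Finset.sum_apply, hp]
      simp only [Option.elim_some, smul_zero, add_zero, Pi.smul_apply, Function.comp_apply]
      abel

/-- For generic constraints, there are no solutions such that the new leaf is adjacent to the
root vertex, with just one further edge there. -/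
theorem generic_map_some_notMem (hroot' : (ins' m'.root).kind = Kind.line)
    (hpts' : ∀ i, (ins' (m'.mark (some (some i)))).kind = Kind.point)
    (hx : (ins' (m'.mark (some none))).kind = Kind.line)
    (hcard : Fintype.card X = 2 * Fintype.card M + (ins' m'.root).psi + 1) :
    Generic (ι' → ℝ × ℝ) fun Ξ' => ∀ z, IsSolData m' ins' Ξ' z →
      Finset.univ.map Function.Embedding.some ∉ z.1 := by
  have h0 : Generic (Option M → ℝ × ℝ) fun x => ∀ (σ : Finset (Finset (Option X))) (j j' : Fin 3),
      σ.card + 2 < Module.finrank ℝ (Option M → ℝ × ℝ) →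
      ∀ (l : Finset (Option X) → ℝ) (t t' : ℝ), x ≠ ∑ A ∈ σ, l A • realVec m'.vecs A +
        t • (fun _ => toReal (dir j)) + t' • (fun i : Option M => i.elim
          (toReal (dir j')) fun _ => 0) :=
    Generic.all fun σ => Generic.all fun j => Generic.all fun j' =>
      Generic.imp fun h => generic_ne_combination σ _ _ _ h
  refine (h0.comap m'.relReal m'.relReal_surjective).mono ?_
  rintro Ξ' hΞ ⟨σ, l, p⟩ hz hC
  set C : Finset (Option X) := Finset.univ.map Function.Embedding.some with hCdef
  obtain ⟨j, t, -, hp⟩ := hz.exists_line hroot'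
  have hxm := hz.pt_mem none
  rw [hx] at hxm
  obtain ⟨j', t', -, hp'⟩ := mem_line_iff.1 hxm
  simp only at hp' hC
  refine hΞ (σ.erase C) j j' ?_ l t (-t') (funext fun i => ?_)
  · have h1 := hz.type.card_eq
    have h2 := Finset.card_erase_add_one hC
    simp only [Fintype.card_option] at h1
    rw [finrank_plane_option]
    omega
  · have hslope : slopeOf m'.slopes C = 0 := by
      rw [slopeOf, hCdef, Finset.sum_map]
      simp only [Function.Embedding.some_apply, hE.slope]
      exact (m.sum_leafSlope _).trans (sum_degreeEnds d)
    have hvC : realVec m'.vecs C = 0 := by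
      have : m'.vecs C = 0 := by
        funext i
        change (if _ then slopeOf m'.slopes C else 0) = _
        rw [hslope, ite_self]
        rfl
      rw [realVec, this, map_zero]
    have hsum : ∑ A ∈ σ.erase C, l A • realVec m'.vecs A = ∑ A, l A • realVec m'.vecs A := by
      refine Finset.sum_subset (Finset.subset_univ _) fun A _ hA => ?_
      by_cases hAC : A = C
      · rw [hAC, hvC, smul_zero]
      · rw [show l A = 0 from hz.zero A fun h => hA (Finset.mem_erase.2 ⟨hAC, h⟩), zero_smul]
    rw [hsum, m'.relReal_apply, Pi.add_apply, Pi.add_apply, Pi.smul_apply, Pi.smul_apply]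
    cases i with
    | none =>
      rw [startPos_pt hz.type.1 hz.zero, ← sub_eq_iff_eq_add] at hp'
      rw [← hp', hp]
      simp only [Option.elim_none, neg_smul]
      abel
    | some i =>
      have h7 := hz.pt_mem (some i)
      rw [hpts'] at h7
      have h8 : startPos m'.slopes l p {m'.pt (some i)} = Ξ' (m'.mark (some (some i))) := h7
      rw [← h8, startPos_pt hz.type.1 hz.zero, hp]
      simp only [Option.elim_some, smul_zero, add_zero]
      abel

omit hE in
theorem generic_offLine :
    Generic (ι' → ℝ × ℝ) fun Ξ' => OffLine (Ξ' (m'.mark (some none)) - Ξ' m'.root) := by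
  have key : ∀ φ : Module.Dual ℝ (ℝ × ℝ), φ ≠ 0 →
      Generic (Option M → ℝ × ℝ) fun x => φ (x none) ≠ 0 := by
    intro φ hφ
    refine (Generic.dual_ne_zero hφ).comap (LinearMap.proj none) fun v => ⟨fun _ => v, rfl⟩
  have h1 := key (LinearMap.fst ℝ ℝ ℝ) fun h => by
    simpa using congrArg (fun f : Module.Dual ℝ (ℝ × ℝ) => f (1, 0)) h
  have h2 := key (LinearMap.snd ℝ ℝ ℝ) fun h => by
    simpa using congrArg (fun f : Module.Dual ℝ (ℝ × ℝ) => f (0, 1)) h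
  have h3 := key (LinearMap.fst ℝ ℝ ℝ - LinearMap.snd ℝ ℝ ℝ) fun h => by
    simpa using congrArg (fun f : Module.Dual ℝ (ℝ × ℝ) => f (1, 0)) h
  refine ((h1.and (h2.and h3)).comap m'.relReal m'.relReal_surjective).mono
    fun Ξ' ⟨g1, g2, g3⟩ => ⟨g1, g2, fun h => g3 ?_⟩
  rw [LinearMap.sub_apply]
  exact sub_eq_zero.2 h

/-- A property of point configurations which holds generically also holds if the point at the root
is the intersection point of two generic lines. -/
theorem generic_update_inter [DecidableEq ι] {g : (ι → ℝ × ℝ) → Prop}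
    (hg : Generic (ι → ℝ × ℝ) g) :
    Generic (ι' → ℝ × ℝ) fun Ξ' => ∀ p, p ∈ Kind.line.cycle (Ξ' m'.root) →
      p ∈ Kind.line.cycle (Ξ' (m'.mark (some none))) → g (Function.update (Ξ' ∘ r) m.root p) := by
  -- If the lines meet in the rays `j` and `j'`, the modified configuration depends linearly on the
  -- constraints; `F j j'` is this linear map.
  set F : Fin 3 → Fin 3 → (ι' → ℝ × ℝ) →ₗ[ℝ] (ι → ℝ × ℝ) := fun j j' =>
    LinearMap.funLeft ℝ (ℝ × ℝ) r + (LinearMap.single ℝ (fun _ : ι => ℝ × ℝ) m.root) ∘ₗ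
      ((interCoord j j' ∘ₗ ((LinearMap.proj (m'.mark (some none)) : (ι' → ℝ × ℝ) →ₗ[ℝ] ℝ × ℝ) -
        LinearMap.proj m'.root)).smulRight
        (toReal (dir j))) with hF
  have hFapp : ∀ j j' Ξ', F j j' Ξ' = Function.update (Ξ' ∘ r) m.root (Ξ' m'.root +
      interCoord j j' (Ξ' (m'.mark (some none)) - Ξ' m'.root) • toReal (dir j)) := by
    intro j j' Ξ'
    funext i
    by_cases hi : i = m.root
    · subst hi
      simp [hF, LinearMap.funLeft, hE.root]
    · simp [hF, LinearMap.funLeft, hi]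
  -- If the new line has the same vertex as the line at the root, the coordinate of the intersection
  -- vanishes and the configuration is unchanged. So every configuration is attained.
  have hsurj : ∀ j j', Function.Surjective (F j j') := by
    intro j j' Ξ
    obtain ⟨Ξ', hΞ'⟩ := LinearMap.funLeft_surjective_of_injective ℝ (ℝ × ℝ) r hE.injective Ξ
    have hΞr : Ξ' ∘ r = Ξ := hΞ'
    have hxr : ∀ i, r i ≠ m'.mark (some none) := by
      intro i
      obtain ⟨_ | i, rfl⟩ := m.mark.surjective i
      · intro h
        have := hE.root.trans h
        simpa using m'.mark.injective this
      · rw [← hE.mark]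
        intro h
        simpa using m'.mark.injective h
    classical
    refine ⟨Function.update Ξ' (m'.mark (some none)) (Ξ' m'.root), ?_⟩
    have h1 : m'.root ≠ m'.mark (some none) := by rw [hE.root]; exact hxr _
    have h2 : Function.update Ξ' (m'.mark (some none)) (Ξ' m'.root) ∘ r = Ξ := by
      rw [← hΞr]
      funext i
      simp [hxr i]
    rw [hFapp, h2, Function.update_self, Function.update_of_ne h1, sub_self, map_zero, zero_smul,
      add_zero, hE.root, ← hΞr]
    exact Function.update_eq_self _ _
  have h1 : Generic (ι' → ℝ × ℝ) fun Ξ' => ∀ j j', g (F j j' Ξ') :=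
    Generic.all fun j => Generic.all fun j' => hg.comap _ (hsurj j j')
  refine (h1.and (generic_offLine (m' := m'))).mono fun Ξ' ⟨hgF, hoff⟩ p hp hp' => ?_
  obtain ⟨j, t, ht, rfl⟩ := mem_line_iff.1 hp
  obtain ⟨j', t', ht', h⟩ := mem_line_iff.1 hp'
  have := hgF j j'
  rwa [hFapp, ← interCoord_eq (line_inter_pos hoff ht ht' h).1 h] at this

end ExtensionGeneric

/-! ### Edges in general position to a line. -/

section OffLine

theorem not_offLine_smul_dir (c : ℝ) (j : Fin 3) : ¬ OffLine (c • toReal (dir j)) := by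
  rintro ⟨h1, h2, h3⟩
  fin_cases j <;> simp [toReal, dir] at h1 h2 h3

theorem offLine_of_ne {v q : ℝ × ℝ} (h : ∀ (j : Fin 3) (s : ℝ), q ≠ v + s • toReal (dir j)) :
    OffLine (v - q) := by
  refine ⟨fun h1 => h 0 (v.2 - q.2) ?_, fun h1 => h 1 (v.1 - q.1) ?_,
    fun h1 => h 2 (q.1 - v.1) ?_⟩ <;>
    simp only [Prod.fst_sub, Prod.snd_sub] at h1 <;>
    ext <;> simp [toReal, dir] <;> linarith

theorem det_ne_zero_of_ne {v q : ℝ × ℝ} {w : ℤ × ℤ} (hw : w ≠ 0)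
    (h : ∀ s : ℝ, q ≠ v + s • toReal w) : (v - q).1 * w.2 - (v - q).2 * w.1 ≠ 0 := by
  intro h0
  simp only [Prod.fst_sub, Prod.snd_sub] at h0
  by_cases h1 : w.1 = 0
  · have h2 : (w.2 : ℝ) ≠ 0 := by
      intro h2
      exact hw (Prod.ext h1 (by exact_mod_cast h2))
    refine h ((q.2 - v.2) / w.2) ?_
    have h3 : v.1 - q.1 = 0 := by
      rw [h1, Int.cast_zero, mul_zero, sub_zero] at h0
      exact (mul_eq_zero.1 h0).resolve_right h2
    ext
    · simp [toReal, h1]; linarith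
    · simp [toReal, div_mul_cancel₀ _ h2]
  · have h2 : (w.1 : ℝ) ≠ 0 := by exact_mod_cast h1
    refine h ((q.1 - v.1) / w.1) ?_
    ext
    · simp [toReal, div_mul_cancel₀ _ h2]
    · simp only [toReal, Prod.snd_add, Prod.smul_snd, smul_eq_mul]
      field_simp
      linarith

/-- Two different parameters would make `w` parallel to the ray and put `a` on the line spanned by
it. -/
theorem cross_unique {a q : ℝ × ℝ} (ha : OffLine (a - q)) {w : ℝ × ℝ} {j : Fin 3} {s t s₁ t₁ : ℝ}
    (h : a + s • w = q + t • toReal (dir j)) (h₁ : a + s₁ • w = q + t₁ • toReal (dir j)) :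
    s = s₁ := by
  by_contra hs
  have hs' : s - s₁ ≠ 0 := sub_ne_zero.2 hs
  have h2 : (s - s₁) • w = (t - t₁) • toReal (dir j) := by
    rw [sub_smul, sub_smul]
    linear_combination h - h₁
  have h3 : w = ((s - s₁)⁻¹ * (t - t₁)) • toReal (dir j) := by
    rw [mul_smul, ← h2, smul_smul, inv_mul_cancel₀ hs', one_smul]
  refine not_offLine_smul_dir (t - s * ((s - s₁)⁻¹ * (t - t₁))) j ?_
  have h4 : a - q = (t - s * ((s - s₁)⁻¹ * (t - t₁))) • toReal (dir j) := by
    rw [sub_smul, mul_smul, ← h3]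
    linear_combination h
  rwa [← h4]

end OffLine

/-! ### Slopes of the ends in degree `d`. -/

section Degree

variable {ι X M : Type} [Fintype ι] [Fintype X] [DecidableEq X] {d : ℕ}
  (m : Labelling X M (Fin 3 × Fin d) ι)

theorem Labelling.slopes_cases (x : X) : m.slopes x = 0 ∨ ∃ j, m.slopes x = dir j := by
  rw [slopes, leafSlope]
  rcases m.leafOf x with e | i
  · exact Or.inr ⟨e.1, rfl⟩
  · exact Or.inl rfl

theorem dir_injective : Function.Injective dir := by
  intro i j h
  fin_cases i <;> fin_cases j <;> simp [dir] at h ⊢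

theorem Labelling.card_slopes_eq (j : Fin 3) :
    (Finset.univ.filter fun x => m.slopes x = dir j).card = d := by
  have h := m.sum_ends fun z => if Sum.elim (degreeEnds d) (fun _ => 0) z = dir j then 1 else 0
  rw [Fintype.sum_sum_type, Fintype.sum_prod_type] at h
  simp only [Sum.elim_inl, Sum.elim_inr, (dir_ne_zero j).symm, if_false, Finset.sum_const_zero,
    add_zero, degreeEnds, dir_injective.eq_iff, Finset.sum_const, Finset.card_univ,
    Fintype.card_fin, smul_eq_mul, mul_ite, mul_one, mul_zero, Finset.sum_ite_eq',
    Finset.mem_univ, if_true] at h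
  rw [Finset.card_filter]
  exact h.symm

end Degree

/-! ### The divisor equation for fixed generic constraints. -/

section HasCount

variable {ι ι' X M : Type} [Fintype ι] [Fintype ι'] [Fintype X] [DecidableEq X] [Nontrivial X]
  [Fintype M] [DecidableEq M] [DecidableEq ι] {d : ℕ}
  {m' : Labelling (Option X) (Option M) (Fin 3 × Fin d) ι'}
  {m : Labelling X M (Fin 3 × Fin d) ι} {r : ι → ι'} (hE : IsExtension m' m r)
  {insL insP : ι → Insertion} {ins' : ι' → Insertion}
include hE

open Classical in
/-- The divisor equation for fixed generic constraints: forgetting the first line constraint. -/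
theorem generic_hasCount_extension (hkL : ∀ i, i ≠ m.root → (insL i).psi = 0)
    (hkP : ∀ i, i ≠ m.root → (insP i).psi = 0) (hk' : ∀ i, i ≠ m'.root → (ins' i).psi = 0)
    (hins : ∀ i, ins' (r i) = insL i) (hroot : (insL m.root).kind = Kind.line)
    (hpts : ∀ i, (insL (m.mark (some i))).kind = Kind.point)
    (hx : (ins' (m'.mark (some none))).kind = Kind.line)
    (hinsP : ∀ i, insP (m.mark (some i)) = insL (m.mark (some i)))
    (hrootP : (insP m.root).kind = Kind.point)
    (hpsiP : (insL m.root).psi ≠ 0 → (insL m.root).psi = (insP m.root).psi + 1)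
    (hcard : Fintype.card X = 2 * Fintype.card M + (insL m.root).psi + 1) :
    Generic (ι' → ℝ × ℝ) fun Ξ' => ∀ NL NP : ℚ, HasCount d insL (Ξ' ∘ r) NL →
      ((insL m.root).psi ≠ 0 → ∀ p, p ∈ Kind.line.cycle (Ξ' m'.root) →
        p ∈ Kind.line.cycle (Ξ' (m'.mark (some none))) →
        HasCount d insP (Function.update (Ξ' ∘ r) m.root p) NP) →
      HasCount d ins' Ξ' (d * NL + if (insL m.root).psi = 0 then 0 else NP) := by
  have hroot' : (ins' m'.root).kind = Kind.line := by rw [hE.root, hins, hroot]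
  have hpsi' : (ins' m'.root).psi = (insL m.root).psi := by rw [hE.root, hins]
  have hpts' : ∀ i, (ins' (m'.mark (some (some i)))).kind = Kind.point := fun i => by
    rw [hE.mark, hins, hpts]
  have G1 := hE.generic_comp ((generic_linearIndependent (realVec m.vecsLine)).comap m.relReal
    m.relReal_surjective)
  have G2 := hE.generic_comp ((generic_not_inCone (realVec m.vecsLine)).comap m.relReal
    m.relReal_surjective)
  have G3 := generic_ne_vertexPos (ins := insL) hE hroot hpts hcard
  have G4 := generic_map_some_notMem (ins' := ins') hE hroot' hpts' hx (by rw [hpsi', hcard])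
  have G5 := generic_offLine (m' := m')
  refine (G1.and (G2.and (G3.and (G4.and G5)))).mono ?_
  rintro Ξ' ⟨g1, g2, g3, g4, g5⟩ NL NP hNL hNP
  obtain ⟨SL, hSL, rfl⟩ := (hasCount_iff (m := m) hkL NL).1 hNL
  obtain ⟨p₀, hp₀, hp₀'⟩ := exists_line_inter g5
  -- For `k = 0` the set is empty, so both cases are treated together below.
  obtain ⟨SP, hSP, hNP'⟩ : ∃ SP : Finset (Finset (Finset X) × (Finset X → ℝ) × (ℝ × ℝ)),
      (∀ z, z ∈ SP ↔ (insL m.root).psi ≠ 0 ∧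
        IsSolData m insP (Function.update (Ξ' ∘ r) m.root p₀) z) ∧
      (if (insL m.root).psi = 0 then 0 else NP) = (∑ z ∈ SP, (solMult m insP
        (Function.update (Ξ' ∘ r) m.root p₀) z : ℚ)) / ((d.factorial : ℚ) ^ 3) := by
    by_cases hk0 : (insL m.root).psi = 0
    · exact ⟨∅, by simp [hk0], by simp [hk0]⟩
    · obtain ⟨SP, hSP, h⟩ := (hasCount_iff (m := m) hkP NP).1 (hNP hk0 p₀ hp₀ hp₀')
      exact ⟨SP, by simpa [hk0] using hSP, by simpa [hk0] using h⟩
  have hoff : ∀ z, IsSolData m insL (Ξ' ∘ r) z → ∀ B,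
      OffLine (vertexPos m.slopes z.2.1 z.2.2 B - Ξ' (m'.mark (some none))) := fun z hz B =>
    offLine_of_ne fun j s => g3 z hz B (Sum.inl j) s
  have hstart : ∀ z, IsSolData m insL (Ξ' ∘ r) z → ∀ B ∈ nodes z.1,
      startPos m.slopes z.2.1 z.2.2 B =
        vertexPos m.slopes z.2.1 z.2.2 (treeParent z.1 B).1 := fun z hz B hB =>
    startPos_of_mem_ch _ hz.zero _ (mem_ch_treeParent hz.type.1 hB)
  -- the crossings of the first line with the solutions without it
  set IG : Finset ((Finset (Finset X) × (Finset X → ℝ) × (ℝ × ℝ)) × Finset X × Fin 3) :=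
    (SL ×ˢ (Finset.univ ×ˢ Finset.univ)).filter fun w => w.2.1 ∈ nodes w.1.1 ∧
      Cross m.slopes w.1.1 w.1.2.1 w.1.2.2 (Ξ' (m'.mark (some none))) w.2.1 w.2.2 with hIG
  have hIGmem : ∀ w, w ∈ IG ↔ IsSolData m insL (Ξ' ∘ r) w.1 ∧ w.2.1 ∈ nodes w.1.1 ∧
      Cross m.slopes w.1.1 w.1.2.1 w.1.2.2 (Ξ' (m'.mark (some none))) w.2.1 w.2.2 := fun w => by
    simp only [hIG, Finset.mem_filter, Finset.mem_product, Finset.mem_univ, and_true, hSL]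
  have hex : ∀ w, ∃ s : ℝ, w ∈ IG → ∃ t : ℝ, 0 < s ∧ (w.2.1 ∈ w.1.1 → s < w.1.2.1 w.2.1) ∧ 0 < t ∧
      startPos m.slopes w.1.2.1 w.1.2.2 w.2.1 + s • toReal (slopeOf m.slopes w.2.1) =
        Ξ' (m'.mark (some none)) + t • toReal (dir w.2.2) := fun w => by
    by_cases hw : w ∈ IG
    · obtain ⟨s, t, h⟩ := ((hIGmem w).1 hw).2.2
      exact ⟨s, fun _ => ⟨t, h⟩⟩
    · exact ⟨0, fun h => absurd h hw⟩
  choose s hs using hex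
  -- `FG` grafts the new marked point at a crossing; `FA` attaches it at the root. Together they are
  -- shown to reach every solution exactly once.
  set FG : ((Finset (Finset X) × (Finset X → ℝ) × (ℝ × ℝ)) × Finset X × Fin 3) →
      Finset (Finset (Option X)) × (Finset (Option X) → ℝ) × (ℝ × ℝ) := fun w =>
    (graft w.1.1 w.2.1, graftLen w.1.1 (treeParent w.1.1 w.2.1).1 w.2.1 w.1.2.1 (s w), w.1.2.2)
    with hFG
  set FA : (Finset (Finset X) × (Finset X → ℝ) × (ℝ × ℝ)) →
      Finset (Finset (Option X)) × (Finset (Option X) → ℝ) × (ℝ × ℝ) := fun z =>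
    (att z.1 Finset.univ, pushLen (plus Finset.univ) z.1 z.2.1, z.2.2) with hFA
  have hSPp : ∀ z ∈ SP, z.2.2 = p₀ := fun z hz => by
    have := ((hSP z).1 hz).2.root_mem
    rw [hrootP, Function.update_self] at this
    exact this
  have hFGinj : ∀ w ∈ IG, ∀ w₁ ∈ IG, FG w = FG w₁ → w = w₁ := by
    rintro ⟨⟨σ, l, p⟩, B, j⟩ hw ⟨⟨σ₁, l₁, p₁⟩, B₁, j₁⟩ hw₁ he
    obtain ⟨hz, hB, -⟩ := (hIGmem _).1 hw
    obtain ⟨hz₁, hB₁, -⟩ := (hIGmem _).1 hw₁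
    obtain ⟨t, -, -, ht, hst⟩ := hs _ hw
    obtain ⟨t₁, -, -, ht₁, hst₁⟩ := hs _ hw₁
    simp only [hFG, Prod.mk.injEq] at he hB hB₁ hst hst₁
    obtain ⟨he1, he2, rfl⟩ := he
    obtain ⟨rfl, rfl⟩ := graft_inj hz.type.1 hz₁.type.1 hB hB₁ he1
    have hσ : IsHier σ := hz.type.1
    have hc := mem_ch_treeParent hσ hB
    have hP := (treeParent σ B).2
    have hs2 := congrFun he2 (Finset.insertNone B)
    rw [graftLen_insertNone hσ hP hc, graftLen_insertNone hσ hP hc] at hs2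
    have hl : l = l₁ := by
      funext A
      by_cases hA : A ∈ σ
      · have := congrFun he2 (plus (treeParent σ B).1 A)
        rw [graftLen_plus hσ hP hc _ hA, graftLen_plus hσ hP hc _ hA, hs2] at this
        exact sub_left_injective this
      · rw [show l A = 0 from hz.zero A hA, show l₁ A = 0 from hz₁.zero A hA]
    subst hl
    -- The crossing point is in the interior of only one ray, so it determines `j`.
    rw [hs2, hst₁] at hst
    rw [(smul_dir_injective ht₁ ht (add_left_cancel hst)).1]
  have hFAinj : ∀ z ∈ SP, ∀ z₁ ∈ SP, FA z = FA z₁ → z = z₁ := by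
    rintro ⟨σ, l, p⟩ hz ⟨σ₁, l₁, p₁⟩ hz₁ he
    simp only [hFA, Prod.mk.injEq] at he
    obtain ⟨he1, he2, rfl⟩ := he
    obtain rfl := att_injective _ he1
    have hl : l = l₁ := by
      funext A
      by_cases hA : A ∈ σ
      · have := congrFun he2 (plus Finset.univ A)
        rwa [pushLen_apply (plus_injective _) hA, pushLen_apply (plus_injective _) hA] at this
      · rw [show l A = 0 from ((hSP _).1 hz).2.zero A hA,
          show l₁ A = 0 from ((hSP _).1 hz₁).2.zero A hA]
    rw [hl]
  -- A graft has a vertex other than the root above which the new leaf lies; after attaching at the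
  -- root there is none.
  have hdisj : Disjoint (IG.image FG) (SP.image FA) := by
    rw [Finset.disjoint_left]
    intro z' h1 h2
    obtain ⟨w, hw, rfl⟩ := Finset.mem_image.1 h1
    obtain ⟨z, hz, he⟩ := Finset.mem_image.1 h2
    have h3 : Finset.insertNone w.2.1 ∈ att z.1 Finset.univ := by
      rw [show att z.1 Finset.univ = graft w.1.1 w.2.1 from congrArg Prod.fst he]
      exact Finset.mem_insert_self _ _
    obtain ⟨A, hA, hA'⟩ := Finset.mem_image.1 h3
    have h4 : none ∈ plus Finset.univ A := by rw [hA']; simp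
    exact (((hSP z).1 hz).2.type.1.1 A hA).2 (Finset.univ_subset_iff.1 (none_mem_plus.1 h4))
  refine (hasCount_iff (m := m') hk' _).2 ⟨IG.image FG ∪ SP.image FA, fun z' => ?_, ?_⟩
  · rw [Finset.mem_union, Finset.mem_image, Finset.mem_image]
    constructor
    · rintro (⟨⟨⟨σ, l, p⟩, B, j⟩, hw, rfl⟩ | ⟨⟨σ, l, p⟩, hz, rfl⟩)
      · obtain ⟨hz, hB, -⟩ := (hIGmem _).1 hw
        obtain ⟨t, h1, h2, h3, h4⟩ := hs _ hw
        exact (isSolData_graft_iff hE hins hx hz.type (treeParent σ B).2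
          (mem_ch_treeParent hz.type.1 hB) hz.zero _).2 ⟨hz, h1, h2, j, t, h3.le, h4⟩
      · obtain ⟨hk0, hzP⟩ := (hSP _).1 hz
        have hp : p = p₀ := hSPp _ hz
        subst hp
        exact (isSolData_att_iff hE (ins := insP) (by rw [hpsi', hpsiP hk0]) hroot' hrootP
          (fun i => by rw [hinsP, hins]) hx hzP.type.1 hzP.zero).2 ⟨hzP, hp₀, hp₀'⟩
    · intro hz'
      obtain ⟨σ', l', p⟩ := z'
      have htype : IsType (insL m.root).psi σ' := hpsi' ▸ hz'.type
      -- The three positions of the new point: beside a contracted edge, excluded by `g4`; at the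
      -- root with a `ψ`-power; on an edge or end.
      rcases htype.forget_cases with h1 | ⟨k, σ, hk, hσ, rfl⟩ | ⟨σ, hσ, B, hB, rfl⟩
      · exact absurd h1 (g4 _ hz')
      · right
        have hl' : l' = pushLen (plus Finset.univ) σ fun A => l' (plus Finset.univ A) :=
          eq_pushLen (plus_injective _) hz'.zero
        have hk0 : (insL m.root).psi ≠ 0 := by omega
        have hz'' := hz'
        rw [hl'] at hz''
        obtain ⟨hz, hp, hp'⟩ := (isSolData_att_iff hE (ins := insP) (by rw [hpsi', hpsiP hk0])
          hroot' hrootP (fun i => by rw [hinsP, hins]) hx hσ.1 fun A hA => hz'.zero _ fun h => by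
            obtain ⟨A', hA', he⟩ := Finset.mem_image.1 h
            exact hA (plus_injective _ he ▸ hA')).1 hz''
        obtain rfl := line_inter_unique g5 hp hp' hp₀ hp₀'
        exact ⟨_, (hSP _).2 ⟨hk0, hz⟩, by simp only [hFA, ← hl']⟩
      · left
        have hc := mem_ch_treeParent hσ.1 hB
        obtain ⟨l, hl, he⟩ := eq_graftLen hσ.1 (treeParent σ B).2 hc hz'.zero
        simp only at he
        rw [he] at hz'
        obtain ⟨hz, hs0, hsB, j, t, ht, heq⟩ :=
          (isSolData_graft_iff hE hins hx hσ (treeParent σ B).2 hc hl _).1 hz'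
        -- The new point is not the vertex of the new line, since by `g3` that vertex is not on the
        -- line spanned by any edge.
        have ht' : 0 < t := by
          refine ht.lt_of_ne fun ht0 => ?_
          refine g3 _ hz (treeParent σ B).1 (Sum.inr B) (l' (Finset.insertNone B)) ?_
          rw [← hstart _ hz B hB]
          simp only [Sum.elim_inr]
          rw [heq, ← ht0, zero_smul, add_zero]
        have hw : (((σ, l, p), B, j) : (Finset (Finset X) × (Finset X → ℝ) × (ℝ × ℝ)) ×
            Finset X × Fin 3) ∈ IG :=
          (hIGmem _).2 ⟨hz, hB, _, t, hs0, hsB, ht', heq⟩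
        refine ⟨_, hw, ?_⟩
        obtain ⟨t₁, -, -, -, heq₁⟩ := hs _ hw
        -- The parameter was chosen arbitrarily in `hs`; it is the given one because the edge meets
        -- a ray only once.
        have hss : s ((σ, l, p), B, j) = l' (Finset.insertNone B) := by
          refine cross_unique ?_ heq₁ heq
          rw [hstart _ hz B hB]
          exact hoff _ hz _
        simp only [hFG, hss, ← he]
  · have hmultG : ∀ w ∈ IG, solMult m' ins' Ξ' (FG w) = solMult m insL (Ξ' ∘ r) w.1 *
        (idet (slopeOf m.slopes w.2.1) (dir w.2.2)).natAbs := by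
      rintro ⟨⟨σ, l, p⟩, B, j'⟩ hw
      obtain ⟨hz, hB, -⟩ := (hIGmem _).1 hw
      obtain ⟨t', -, -, ht', heq⟩ := hs _ hw
      obtain ⟨j, t, ht, hp⟩ := hz.exists_line hroot
      have htpos := hz.pos_of_generic hpts hcard g2 hp ht
      have hcone := hz.coneCoord hpts hp htpos
      refine solMult_graft hE hins hroot hpts hx hz.type.1 (mem_ch_treeParent hz.type.1 hB) hz.zero
        htpos ht' (by rw [hp, hE.root]; rfl) heq (g1 _ ?_ ⟨_, hcone⟩)
      have hσ : σ.card + (insL m.root).psi + 2 = Fintype.card X := hz.type.card_eq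
      rw [Finset.card_disjSum, Finset.card_singleton, finrank_plane_pi]
      change σ.card + 1 = _
      omega
    have hmultA : ∀ z ∈ SP, solMult m' ins' Ξ' (FA z) =
        solMult m insP (Function.update (Ξ' ∘ r) m.root p₀) z := by
      rintro ⟨σ, l, p⟩ hz
      have hp : p = p₀ := hSPp _ hz
      subst hp
      obtain ⟨hk0, hzP⟩ := (hSP _).1 hz
      obtain ⟨j, t, ht, hpt⟩ := mem_line_iff.1 hp₀
      obtain ⟨j', t', ht', hpt'⟩ := mem_line_iff.1 hp₀'
      obtain ⟨hjj, h1, h2⟩ := line_inter_pos g5 ht ht' (hpt.symm.trans hpt')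
      exact solMult_att hE hroot' hrootP (fun i => by rw [hinsP, hins])
        (fun i => by rw [hinsP, hpts]) hx hzP.type.1 h1 h2 hpt hpt' hjj _
    -- By Bézout the crossings of the new line with one solution have total weight `d`, the number
    -- of ends of slope `(1, 1)`.
    have hbez : ∀ z ∈ SL, (∑ B ∈ nodes z.1, ∑ j : Fin 3,
        if Cross m.slopes z.1 z.2.1 z.2.2 (Ξ' (m'.mark (some none))) B j then
          (idet (slopeOf m.slopes B) (dir j)).natAbs else 0) = d := by
      intro z hzS
      have hz := (hSL z).1 hzS
      have h1 := sum_cross_eq m.slopes hz.type.1 hz.pos hz.zero z.2.2 (Ξ' (m'.mark (some none)))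
        m.slopes_cases ((m.sum_leafSlope _).trans (sum_degreeEnds d)) (fun B _ => hoff z hz B)
        (fun B _ hB0 => det_ne_zero_of_ne hB0 fun s => g3 z hz B (Sum.inr B) s)
      rw [m.card_slopes_eq] at h1
      have h2 : ∀ n : ℤ, |(n : ℝ)| = ((n.natAbs : ℕ) : ℝ) := fun n => by
        rw [Nat.cast_natAbs, Int.cast_abs]
      simp only [h2] at h1
      exact_mod_cast h1
    have hsumG : ∑ w ∈ IG, solMult m insL (Ξ' ∘ r) w.1 *
        (idet (slopeOf m.slopes w.2.1) (dir w.2.2)).natAbs =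
        ∑ z ∈ SL, solMult m insL (Ξ' ∘ r) z * d := by
      rw [hIG, Finset.sum_filter, Finset.sum_product]
      refine Finset.sum_congr rfl fun z hz => ?_
      refine Eq.trans ?_ (congrArg (solMult m insL (Ξ' ∘ r) z * ·) (hbez z hz))
      rw [Finset.sum_product, Finset.mul_sum, ← Finset.sum_subset (Finset.subset_univ (nodes z.1))]
      · refine Finset.sum_congr rfl fun B hB => ?_
        rw [Finset.mul_sum]
        refine Finset.sum_congr rfl fun j _ => ?_
        simp only [hB, true_and, mul_ite, mul_zero]
      · intro B _ hB
        exact Finset.sum_eq_zero fun j _ => if_neg fun h => hB h.1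
    have htotal : ∑ z ∈ IG.image FG ∪ SP.image FA, solMult m' ins' Ξ' z =
        d * ∑ z ∈ SL, solMult m insL (Ξ' ∘ r) z +
          ∑ z ∈ SP, solMult m insP (Function.update (Ξ' ∘ r) m.root p₀) z := by
      rw [Finset.sum_union hdisj, Finset.sum_image hFGinj, Finset.sum_image hFAinj,
        Finset.sum_congr rfl hmultG, Finset.sum_congr rfl hmultA, hsumG, ← Finset.sum_mul, mul_comm]
    rw [hNP', ← Nat.cast_sum, ← Nat.cast_sum, ← Nat.cast_sum, htotal]
    push_cast
    ring

end HasCount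

/-! ### Concrete labellings for one and two special insertions. -/

section Labellings

variable (d n : ℕ)

/-- The labelling of the ends for `n` points and one further marked point, the root. -/
def labellingOne :
    Labelling ((Fin 3 × Fin d) ⊕ Fin n) (Fin n) (Fin 3 × Fin d) (Fin n ⊕ Fin 1) where
  leaf :=
    { toFun := fun x => x.elim (Sum.inr (Sum.inr 0)) (Sum.map id Sum.inl)
      invFun := Sum.elim (fun e => some (Sum.inl e))
        (Sum.elim (fun i => some (Sum.inr i)) fun _ => none)
      left_inv := by rintro (_ | _ | _) <;> rfl
      right_inv := by
        rintro (_ | _ | j)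
        · rfl
        · rfl
        · rw [Subsingleton.elim j 0]; rfl }
  mark :=
    { toFun := fun x => x.elim (Sum.inr 0) Sum.inl
      invFun := Sum.elim some fun _ => none
      left_inv := by rintro (_ | _) <;> rfl
      right_inv := by
        rintro (_ | j)
        · rfl
        · rw [Subsingleton.elim j 0]; rfl }
  pt := Sum.inr
  leaf_none := rfl
  leaf_pt := fun _ => rfl

/-- The labelling of the ends for `n` points and two further marked points, the second of which is
the root. -/
def labellingTwo : Labelling (Option ((Fin 3 × Fin d) ⊕ Fin n)) (Option (Fin n)) (Fin 3 × Fin d)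
    (Fin n ⊕ Fin 2) where
  leaf :=
    { toFun := fun x => x.elim (Sum.inr (Sum.inr 1)) fun y =>
        y.elim (Sum.inr (Sum.inr 0)) (Sum.map id Sum.inl)
      invFun := Sum.elim (fun e => some (some (Sum.inl e)))
        (Sum.elim (fun i => some (some (Sum.inr i))) ![some none, none])
      left_inv := by rintro (_ | _ | _ | _) <;> rfl
      right_inv := by
        rintro (_ | _ | j)
        · rfl
        · rfl
        · fin_cases j <;> rfl }
  mark :=
    { toFun := fun x => x.elim (Sum.inr 1) fun y => y.elim (Sum.inr 0) Sum.inl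
      invFun := Sum.elim (fun i => some (some i)) ![some none, none]
      left_inv := by rintro (_ | _ | _) <;> rfl
      right_inv := by
        rintro (_ | j)
        · rfl
        · fin_cases j <;> rfl }
  pt := Option.map Sum.inr
  leaf_none := rfl
  leaf_pt := by rintro (_ | _) <;> rfl

/-- The special insertion of the small problem becomes the second one, index `1`, and stays at the
root; index `0` is the line to be forgotten. -/
theorem isExtension_labellingTwo :
    IsExtension (labellingTwo d n) (labellingOne d n) (Sum.map id fun _ => 1) where
  root := rfl
  mark := fun _ => rfl
  pt_none := rfl
  pt_some := fun _ => rfl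
  slope := by rintro (_ | _) <;> rfl

variable {d n}

theorem psi_withPoints_one (s : Insertion) (i : Fin n ⊕ Fin 1) (hi : i ≠ (labellingOne d n).root) :
    (withPoints n ![s] i).psi = 0 := by
  rcases i with i | j
  · rfl
  · exact absurd (by rw [Subsingleton.elim j 0]; rfl) hi

theorem psi_withPoints_two {s t : Insertion} (hs : s.psi = 0) (i : Fin n ⊕ Fin 2)
    (hi : i ≠ (labellingTwo d n).root) : (withPoints n ![s, t] i).psi = 0 := by
  rcases i with i | j
  · rfl
  · fin_cases j
    · exact hs
    · exact absurd rfl hi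

end Labellings

/-! ### The invariants and the divisor equation. -/

section Invariant

variable {d k n : ℕ}

theorem IsInvariant.unique {r : ℕ} {s : Fin r → Insertion} {X M : Type} [Fintype X]
    [DecidableEq X] [Nontrivial X] [Fintype M] [DecidableEq M]
    (m : Labelling X M (Fin 3 × Fin d) (Fin n ⊕ Fin r))
    (hk : ∀ i, i ≠ m.root → (withPoints n s i).psi = 0) {N N' : ℚ} (h : IsInvariant d n s N)
    (h' : IsInvariant d n s N') : N = N' := by
  -- `IsInvariant` unfolds to a `Generic` property, and two such properties hold at a common
  -- configuration, where the count is unique.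
  obtain ⟨Ξ, hΞ, hΞ'⟩ := (Generic.and h h').exists
  exact hΞ.unique m hk hΞ'

/-- The choice operator returns some value with the defining property, and uniqueness identifies it.
-/
theorem invariant_eq {r : ℕ} {s : Fin r → Insertion} {N : ℚ} (h : IsInvariant d n s N)
    (hu : ∀ N', IsInvariant d n s N' → N' = N) : invariant d n s = N :=
  hu _ (Classical.epsilon_spec ⟨N, h⟩)

theorem nontrivial_labels (hd : d ≠ 0) : Nontrivial ((Fin 3 × Fin d) ⊕ Fin n) := by
  have : NeZero d := ⟨hd⟩
  exact ⟨Sum.inl (0, 0), Sum.inl (1, 0), by simp⟩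

theorem exists_isInvariant_psiL (hdim : n + k + 1 = 3 * d) :
    ∃ N, IsInvariant d n ![psiL k] N := by
  have := nontrivial_labels (n := n) (show d ≠ 0 by omega)
  refine exists_generic_hasCount_line (m := labellingOne d n) (psi_withPoints_one _) rfl
    (fun _ => rfl) ?_
  change _ = 2 * _ + k + 1
  simp
  omega

theorem exists_isInvariant_psiP (hdim : n + k + 2 = 3 * d) :
    ∃ N, IsInvariant d n ![psiP k] N := by
  have := nontrivial_labels (n := n) (show d ≠ 0 by omega)
  refine exists_generic_hasCount_point (m := labellingOne d n) (psi_withPoints_one _) ?_ ?_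
  · rintro (_ | j)
    · rfl
    · rw [Subsingleton.elim j 0]; rfl
  · change _ = 2 * _ + k + 2
    simp
    omega

theorem IsInvariant.divisor (hdim : n + k + 1 = 3 * d) {NL NP : ℚ}
    (hL : IsInvariant d n ![psiL k] NL) (hP : k ≠ 0 → IsInvariant d n ![psiP (k - 1)] NP) :
    IsInvariant d n ![psiL 0, psiL k] (d * NL + if k = 0 then 0 else NP) := by
  have := nontrivial_labels (n := n) (show d ≠ 0 by omega)
  have hE := isExtension_labellingTwo d n
  have h1 := generic_hasCount_extension hE (insL := withPoints n ![psiL k])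
    (insP := withPoints n ![psiP (k - 1)]) (ins' := withPoints n ![psiL 0, psiL k])
    (psi_withPoints_one _) (psi_withPoints_one _) (psi_withPoints_two rfl)
    (by
      rintro (_ | j)
      · rfl
      · rw [Subsingleton.elim j 0]; rfl)
    rfl (fun _ => rfl) rfl (fun _ => rfl) rfl
    (fun h => (Nat.succ_pred_eq_of_ne_zero h).symm)
    (by change _ = 2 * _ + k + 1; simp; omega)
  have h2 := hE.generic_comp (p := fun Ξ => HasCount d (withPoints n ![psiL k]) Ξ NL) hL
  have h3 := Generic.imp fun h : k ≠ 0 => generic_update_inter hE (hP h)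
  exact (h1.and (h2.and h3)).mono fun Ξ' h => h.1 NL NP h.2.1 h.2.2

end Invariant

end TropDesc

theorem mainTheorem11 (d k n : ℕ) (hdim : n + k + 1 = 3 * d) :
    (∃! N, TropDesc.IsInvariant d n ![TropDesc.psiL 0, TropDesc.psiL k] N) ∧
    (∃! N, TropDesc.IsInvariant d n ![TropDesc.psiL k] N) ∧
    (1 ≤ k → ∃! N, TropDesc.IsInvariant d n ![TropDesc.psiP (k - 1)] N) ∧
    TropDesc.invariant d n ![TropDesc.psiL 0, TropDesc.psiL k] =
      d * TropDesc.invariant d n ![TropDesc.psiL k] +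
        (if k = 0 then 0 else TropDesc.invariant d n ![TropDesc.psiP (k - 1)]) := by
  have := TropDesc.nontrivial_labels (n := n) (show d ≠ 0 by omega)
  have hu₁ : ∀ (s : TropDesc.Insertion) {N N' : ℚ}, TropDesc.IsInvariant d n ![s] N' →
      TropDesc.IsInvariant d n ![s] N → N' = N := fun s _ _ h' h =>
    h'.unique (TropDesc.labellingOne d n) (TropDesc.psi_withPoints_one s) h
  have hu₂ : ∀ {N N' : ℚ}, TropDesc.IsInvariant d n ![TropDesc.psiL 0, TropDesc.psiL k] N' →
      TropDesc.IsInvariant d n ![TropDesc.psiL 0, TropDesc.psiL k] N → N' = N := fun h' h =>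
    h'.unique (TropDesc.labellingTwo d n) (TropDesc.psi_withPoints_two rfl) h
  obtain ⟨NL, hL⟩ := TropDesc.exists_isInvariant_psiL hdim
  have hP : 1 ≤ k → ∃ N, TropDesc.IsInvariant d n ![TropDesc.psiP (k - 1)] N := fun hk =>
    TropDesc.exists_isInvariant_psiP (by omega)
  -- For `k = 0` the term is absent from the equation, so any value of `NP` will do.
  obtain ⟨NP, hNP⟩ : ∃ NP, k ≠ 0 → TropDesc.IsInvariant d n ![TropDesc.psiP (k - 1)] NP := by
    by_cases hk : k = 0
    · exact ⟨0, fun h => absurd hk h⟩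
    · obtain ⟨NP, h⟩ := hP (Nat.one_le_iff_ne_zero.2 hk)
      exact ⟨NP, fun _ => h⟩
  have hLL := TropDesc.IsInvariant.divisor hdim hL hNP
  refine ⟨⟨_, hLL, fun _ h => hu₂ h hLL⟩, ⟨NL, hL, fun _ h => hu₁ _ h hL⟩, fun hk => ?_, ?_⟩
  · obtain ⟨N, hN⟩ := hP hk
    exact ⟨N, hN, fun _ h => hu₁ _ h hN⟩
  · rw [TropDesc.invariant_eq hLL fun _ h => hu₂ h hLL,
      TropDesc.invariant_eq hL fun _ h => hu₁ _ h hL]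
    by_cases hk : k = 0
    · rw [if_pos hk, if_pos hk]
    · rw [if_neg hk, if_neg hk, TropDesc.invariant_eq (hNP hk) fun _ h => hu₁ _ h (hNP hk)]
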